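/- Let $r\ge 1$, $s\ge 0$, $n_1,\dots,n_s\ge 1$ be integers, $M=\sum_j n_j$, $\lambda_1,\dots,\lambda_s\in\mathbb C$ (not assumed distinct), and let $$A(x)=\sum_{j\le r}A_j\,x^{j-1},\qquad A_j\in \mathrm{Mat}_{M}(\mathbb C),$$ be a formal connection at $x=\infty$ whose leading coefficient is in Jordan form $A_r=\mathrm{diag}(J_1,\dots,J_s)$, where $J_j$ is the upper triangular Jordan cell of size $n_j$ with eigenvalue $\lambda_j$. Let $L$ be the $s\times s$ Lidskii matrix: $L_{ij}$ is the lower-left entry of the $(i,j)$ block of $A_{r-1}$ in the corresponding block partition. For an eigenvalue $\lambda$ and a size $m$ occurring among the pairs $(\lambda_j,n_j)$ let $P_{\lambda,m}(\mu)$ be the determinant of the principal submatrix of $L$ on the indices $\{j:\lambda_j=\lambda,\ n_j\ge m\}$ minus $\mu$ times the projector onto the indices with $n_j=m$. The roots of the $P_{\lambda,m}$ are the Lidskii pseudovalues. Assume that they are generic: no pseudovalue is $0$ and every $P_{\lambda,m}$ has nonzero discriminant. If $r=1$, assume in addition that, for each $\lambda$ having a cell of size $1$, no two roots of $P_{\lambda,1}$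 differ by a nonzero integer. For $n\ge 1$ let $\mathcal H_{(n)}(x)$ be the $n\times n$ matrix with ones below the diagonal, $x$ in the upper right corner and zeros elsewhere ($\mathcal H_{(1)}=x$). Put $\mathcal H_j=\mathcal H_{(n_j)}$ and $G_j=\mathrm{diag}(0,1,\dots,n_j-1)$. Call $(Y,t)$ a normalizing pair if $Y(x)=Y_0+\sum_{k\ge1}x^{-k}Y_k$ is a formal series with $\det Y_0\ne0$, $t=(t_{J,j})_{1\le j\le s,\ 0\le J\le rn_j}$ are complex numbers with $t_{rn_j,j}=n_j\lambda_j$, and $$Y^{-1}AY-Y^{-1}Y'=\mathrm{diag}(D_1,\dots,D_s),\qquad D_j=\frac1{n_jx}\sum_{J=0}^{rn_j}t_{J,j}\,\mathcal H_j(x)^J-\frac{G_j}{n_jx}.$$ Then: 1. A normalizing pair exists. 2. For every normalizing pair $(Y,t)$, $$\Psi_{form}=Y(x)\cdot\mathrm{diag}_{j}\Big(\exp\Big(\sum_{J=1}^{rn_j}\frac{t_{J,j}}J\mathcal H_j^J\Big)\,x^{(t_{0,j}-G_j)/n_j}\Big)$$ is a fundamental (i.e. invertible) formal solution of $\Psi'=A\Psi$.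 Here formal solutions have entries in the differential ring $\mathbb C((x^{-1}))\otimes_{\mathbb C[x,x^{-1}]}\mathcal O$, where $\mathcal O$ is the ring of holomorphic functions on the universal covering of $\mathbb C\setminus\{0\}$. 3. $Y$ is uniquely determined by $t$ up to the normalization of each block: if $(Y,t)$ and $(\tilde Y,t)$ are normalizing pairs, then $\tilde Y=Y\,\mathrm{diag}(c_1\mathbf 1_{n_1},\dots,c_s\mathbf 1_{n_s})$ with nonzero constants $c_j$. 4. $(Y,t)$ is unique up to this normalization, the numbering of the blocks and the determination of the roots $x^{1/n_j}$: if $(Y,t)$ and $(\tilde Y,\tilde t)$ are normalizing pairs, there are a permutation $\sigma$ of $\{1,\dots,s\}$ with $n_{\sigma(j)}=n_j$, $\lambda_{\sigma(j)}=\lambda_j$, roots of unity $\zeta_j$ with $\zeta_j^{n_j}=1$, and nonzero constants $c_j$, such that $t_{J,\sigma(j)}=\zeta_j^J\,\tilde t_{J,j}$ for $0\le J\le rn_j$ and $\tilde Y=YP$, where $P$ is the constant matrix whose $(\sigma(j),j)$ block is $c_j\,\mathrm{diag}(1,\zeta_j,\dots,\zeta_j^{n_j-1})$ and whose other blocks are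 zero. -/

import Mathlib

open scoped TensorProduct

noncomputable section

namespace ResonantConnection

/-! ### Formal Laurent series at `x = ∞` -/

/-- The field of formal series `∑_{k ≤ N} a_k x ^ k` at `x = ∞`, i.e. formal Laurent series in the
local parameter `z = x⁻¹`. -/
abbrev FormalSeries : Type := LaurentSeries ℂ

instance : Field FormalSeries := inferInstance

instance : CommRing FormalSeries := Field.toCommRing

instance : CommSemiring FormalSeries := CommRing.toCommSemiring

instance : Ring FormalSeries := CommRing.toRing

instance : Semiring FormalSeries := Ring.toSemiring

namespace FormalSeries

/-- The formal variable `x = z⁻¹`. -/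
def x : FormalSeries := HahnSeries.single (-1 : ℤ) (1 : ℂ)

/-- The coefficient of `x ^ k`. -/
def xcoeff (f : FormalSeries) (k : ℤ) : ℂ := f.coeff (-k)

/-- The derivation `d/dx = - z ^ 2 d/dz`. -/
def ddx (f : FormalSeries) : FormalSeries :=
  -(HahnSeries.single (2 : ℤ) (1 : ℂ) * LaurentSeries.derivative ℂ f)

theorem xcoeff_ext {f g : FormalSeries} (h : ∀ k, xcoeff f k = xcoeff g k) : f = g := by
  refine HahnSeries.ext (funext fun k => ?_)
  simpa [xcoeff] using h (-k)

theorem xcoeff_ddx (f : FormalSeries) (k : ℤ) :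
    xcoeff (ddx f) k = (k + 1) * xcoeff f (k + 1) := by
  unfold xcoeff ddx
  have h : (-k : ℤ) = (-k - 2) + 2 := by ring
  rw [HahnSeries.coeff_neg, h, HahnSeries.coeff_single_mul_add, LaurentSeries.derivative_apply,
    LaurentSeries.hasseDeriv_coeff]
  have h2 : (-k - 2 + ((1 : ℕ) : ℤ) : ℤ) = -(k + 1) := by push_cast; ring
  rw [h2, Ring.choose_one_right, zsmul_eq_mul]
  push_cast
  ring

theorem ddx_add (f g : FormalSeries) : ddx (f + g) = ddx f + ddx g := by
  unfold ddx
  rw [map_add]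
  ring

/-- The Euler operator `z d/dz`, used only to check the Leibniz rule. -/
def euler (f : FormalSeries) : FormalSeries where
  coeff n := n * f.coeff n
  isPWO_support' := f.isPWO_support.mono fun n hn h0 => hn (by
    change (n : ℂ) * f.coeff n = 0
    rw [h0, mul_zero])

theorem support_euler (f : FormalSeries) : (euler f).support ⊆ f.support := fun n hn h0 =>
  hn (by change (n : ℂ) * f.coeff n = 0; rw [h0, mul_zero])

theorem euler_mul (f g : FormalSeries) : euler (f * g) = euler f * g + f * euler g := by
  ext n
  rw [HahnSeries.coeff_add, HahnSeries.coeff_mul_left' f.isPWO_support (support_euler f),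
    HahnSeries.coeff_mul_right' g.isPWO_support (support_euler g), ← Finset.sum_add_distrib]
  change (n : ℂ) * (f * g).coeff n = _
  rw [HahnSeries.coeff_mul, Finset.mul_sum]
  refine Finset.sum_congr rfl fun ij hij => ?_
  have h : ij.1 + ij.2 = n := by
    simp only [Finset.mem_antidiagonal] at hij
    exact hij.2.2
  change (n : ℂ) * _ = ((ij.1 : ℂ) * f.coeff ij.1) * _ + _ * ((ij.2 : ℂ) * g.coeff ij.2)
  rw [← h]
  push_cast
  ring

theorem ddx_eq_euler (f : FormalSeries) :
    ddx f = -(HahnSeries.single (1 : ℤ) (1 : ℂ) * euler f) := by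
  refine xcoeff_ext fun k => ?_
  rw [xcoeff_ddx]
  unfold xcoeff
  have h : (-k : ℤ) = (-k - 1) + 1 := by ring
  rw [HahnSeries.coeff_neg, h, HahnSeries.coeff_single_mul_add]
  change _ = -(1 * (((-k - 1 : ℤ) : ℂ) * HahnSeries.coeff f (-k - 1)))
  have h2 : (-(k + 1) : ℤ) = -k - 1 := by ring
  rw [h2]
  push_cast
  ring

theorem ddx_mul (f g : FormalSeries) : ddx (f * g) = ddx f * g + f * ddx g := by
  rw [ddx_eq_euler, ddx_eq_euler, ddx_eq_euler, euler_mul]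
  ring

theorem ddx_C (c : ℂ) : ddx (HahnSeries.C c) = 0 := by
  refine xcoeff_ext fun k => ?_
  rw [xcoeff_ddx]
  unfold xcoeff
  by_cases h : k + 1 = 0
  · have : (k : ℂ) + 1 = 0 := by exact_mod_cast h
    simp [this]
  · simp only [HahnSeries.C_apply, HahnSeries.coeff_zero]
    rw [HahnSeries.coeff_single_of_ne (neg_ne_zero.mpr h), mul_zero]

theorem ddx_x : ddx x = 1 := by
  refine xcoeff_ext fun k => ?_
  rw [xcoeff_ddx]
  change _ * HahnSeries.coeff (HahnSeries.single (-1 : ℤ) (1 : ℂ)) (-(k + 1)) =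
    HahnSeries.coeff (HahnSeries.single (0 : ℤ) (1 : ℂ)) (-k)
  by_cases h : k = 0
  · subst h; simp
  · rw [HahnSeries.coeff_single_of_ne (by omega), HahnSeries.coeff_single_of_ne (by omega),
      mul_zero]

/-- `x` as a unit. -/
def xUnit : FormalSeriesˣ := Units.mk0 x (by simp [x])

end FormalSeries

/-! ### Holomorphic functions on the universal covering of `ℂ ∖ {0}` -/

/-- The algebra of entire functions. -/
def entireFunctions : Subalgebra ℂ (ℂ → ℂ) where
  carrier := {f | Differentiable ℂ f}
  mul_mem' := fun hf hg => Differentiable.mul hf hg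
  add_mem' := fun hf hg => Differentiable.add hf hg
  algebraMap_mem' := fun c => differentiable_const c

/-- Holomorphic functions on the universal covering of `ℂ ∖ {0}`, uniformized by
`w ↦ x = exp w`; thus `w` is `log x` and `exp (a * w)` is `x ^ a`. -/
abbrev HolFun : Type := entireFunctions

namespace HolFun

/-- The coordinate `x = exp w`, as a unit. -/
def xUnit : HolFunˣ where
  val := ⟨fun w => Complex.exp w, Complex.differentiable_exp⟩
  inv := ⟨fun w => Complex.exp (-w), Complex.differentiable_exp.comp differentiable_neg⟩
  val_inv := Subtype.ext (funext fun w => by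
    change Complex.exp w * Complex.exp (-w) = 1
    rw [← Complex.exp_add, add_neg_cancel, Complex.exp_zero])
  inv_val := Subtype.ext (funext fun w => by
    change Complex.exp (-w) * Complex.exp w = 1
    rw [← Complex.exp_add, neg_add_cancel, Complex.exp_zero])

/-- The derivation `d/dx = exp (-w) d/dw`. -/
def ddx (f : HolFun) : HolFun :=
  ⟨fun w => Complex.exp (-w) * deriv f.1 w,
    (Complex.differentiable_exp.comp differentiable_neg).mul (Differentiable.deriv f.2)⟩

theorem ddx_add (f g : HolFun) : ddx (f + g) = ddx f + ddx g := by
  refine Subtype.ext (funext fun w => ?_)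
  change Complex.exp (-w) * deriv (f.1 + g.1) w =
    Complex.exp (-w) * deriv f.1 w + Complex.exp (-w) * deriv g.1 w
  rw [deriv_add (f.2 w) (g.2 w)]
  ring

theorem ddx_mul (f g : HolFun) : ddx (f * g) = ddx f * g + f * ddx g := by
  refine Subtype.ext (funext fun w => ?_)
  change Complex.exp (-w) * deriv (f.1 * g.1) w =
    Complex.exp (-w) * deriv f.1 w * g.1 w + f.1 w * (Complex.exp (-w) * deriv g.1 w)
  rw [deriv_mul (f.2 w) (g.2 w)]
  ring

theorem ddx_algebraMap (c : ℂ) : ddx (algebraMap ℂ HolFun c) = 0 := by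
  refine Subtype.ext (funext fun w => ?_)
  change Complex.exp (-w) * deriv (fun _ : ℂ => c) w = 0
  simp

theorem ddx_x : ddx xUnit = 1 := by
  refine Subtype.ext (funext fun w => ?_)
  change Complex.exp (-w) * deriv (fun w => Complex.exp w) w = 1
  rw [(Complex.hasDerivAt_exp w).deriv, ← Complex.exp_add]
  simp

end HolFun

/-! ### Formal solutions: formal series times holomorphic functions -/

/-- Laurent polynomials in `x` as formal series. -/
instance : Algebra (LaurentPolynomial ℂ) FormalSeries :=
  (LaurentPolynomial.eval₂ HahnSeries.C FormalSeries.xUnit).toAlgebra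

/-- Laurent polynomials in `x` as holomorphic functions. -/
instance : Algebra (LaurentPolynomial ℂ) HolFun :=
  (LaurentPolynomial.eval₂ (algebraMap ℂ HolFun) HolFun.xUnit).toAlgebra

/-- The ring in which formal solutions live: finite sums of products of a formal series in `x⁻¹`
(with finitely many positive powers) and a holomorphic function of `log x`, Laurent polynomials in
`x` being identified in the two factors. -/
abbrev FormalSolutionRing : Type := FormalSeries ⊗[LaurentPolynomial ℂ] HolFun

/-- Every Laurent polynomial has the same derivative as a formal series and as a function. -/
theorem exists_derivative (p : LaurentPolynomial ℂ) : ∃ p' : LaurentPolynomial ℂ,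
    FormalSeries.ddx (algebraMap _ FormalSeries p) = algebraMap _ FormalSeries p' ∧
    HolFun.ddx (algebraMap _ HolFun p) = algebraMap _ HolFun p' := by
  have hK : ∀ q : LaurentPolynomial ℂ, algebraMap _ FormalSeries q =
    LaurentPolynomial.eval₂ HahnSeries.C FormalSeries.xUnit q := fun _ => rfl
  have hO : ∀ q : LaurentPolynomial ℂ, algebraMap _ HolFun q =
    LaurentPolynomial.eval₂ (algebraMap ℂ HolFun) HolFun.xUnit q := fun _ => rfl
  have key : ∀ {S : Type} [CommRing S] (d : S → S)
      (_ : ∀ f g, d (f * g) = d f * g + f * d g) (u : Sˣ), d u = 1 →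
      d (u⁻¹ : Sˣ) = -((u⁻¹ : Sˣ) * (u⁻¹ : Sˣ)) := by
    intro S _ d hd u hu
    have h1 : d 1 = 0 := by
      have := hd 1 1
      simp only [mul_one, one_mul] at this
      exact left_eq_add.mp this
    have h2 := hd u (u⁻¹ : Sˣ)
    rw [Units.mul_inv, h1, hu, one_mul] at h2
    calc d (u⁻¹ : Sˣ) = (u⁻¹ : Sˣ) * (u * d (u⁻¹ : Sˣ)) := by rw [Units.inv_mul_cancel_left]
      _ = _ := by rw [eq_neg_of_add_eq_zero_right h2.symm, mul_neg]
  induction p using LaurentPolynomial.induction_on with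
  | h_C a =>
    refine ⟨0, ?_, ?_⟩
    · rw [hK, LaurentPolynomial.eval₂_C, FormalSeries.ddx_C, map_zero]
    · rw [hO, LaurentPolynomial.eval₂_C, HolFun.ddx_algebraMap, map_zero]
  | h_add hp hq =>
    obtain ⟨p', h1, h2⟩ := hp
    obtain ⟨q', h3, h4⟩ := hq
    exact ⟨p' + q', by rw [map_add, map_add, FormalSeries.ddx_add, h1, h3],
      by rw [map_add, map_add, HolFun.ddx_add, h2, h4]⟩
  | h_C_mul_T n a ih =>
    obtain ⟨p', h1, h2⟩ := ih
    refine ⟨p' * LaurentPolynomial.T 1 + LaurentPolynomial.C a * LaurentPolynomial.T n, ?_, ?_⟩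
    · rw [LaurentPolynomial.T_add, ← mul_assoc, map_mul, FormalSeries.ddx_mul, h1, map_add,
        map_mul _ p', hK (LaurentPolynomial.T 1), LaurentPolynomial.eval₂_T, zpow_one,
        show FormalSeries.ddx (FormalSeries.xUnit : FormalSeries) = 1 from FormalSeries.ddx_x,
        mul_one]
    · rw [LaurentPolynomial.T_add, ← mul_assoc, map_mul, HolFun.ddx_mul, h2, map_add,
        map_mul _ p', hO (LaurentPolynomial.T 1), LaurentPolynomial.eval₂_T, zpow_one,
        HolFun.ddx_x, mul_one]
  | h_C_mul_T_Z n a ih =>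
    obtain ⟨p', h1, h2⟩ := ih
    refine ⟨p' * LaurentPolynomial.T (-1) - LaurentPolynomial.C a * LaurentPolynomial.T (-n)
      * (LaurentPolynomial.T (-1) * LaurentPolynomial.T (-1)), ?_, ?_⟩
    · rw [sub_eq_add_neg (-(n : ℤ)) 1, LaurentPolynomial.T_add, ← mul_assoc, map_mul,
        FormalSeries.ddx_mul, h1, map_sub, map_mul _ p', map_mul _ (_ * _) (_ * _),
        map_mul _ (LaurentPolynomial.T (-1)) (LaurentPolynomial.T (-1)),
        hK (LaurentPolynomial.T (-1)), LaurentPolynomial.eval₂_T, zpow_neg_one,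
        key FormalSeries.ddx FormalSeries.ddx_mul FormalSeries.xUnit FormalSeries.ddx_x]
      ring
    · rw [sub_eq_add_neg (-(n : ℤ)) 1, LaurentPolynomial.T_add, ← mul_assoc, map_mul,
        HolFun.ddx_mul, h2, map_sub, map_mul _ p', map_mul _ (_ * _) (_ * _),
        map_mul _ (LaurentPolynomial.T (-1)) (LaurentPolynomial.T (-1)),
        hO (LaurentPolynomial.T (-1)), LaurentPolynomial.eval₂_T, zpow_neg_one,
        key HolFun.ddx HolFun.ddx_mul HolFun.xUnit HolFun.ddx_x]
      ring

namespace FormalSolutionRing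

/-- The derivation `d/dx` of the ring of formal solutions, given by
`(f ⊗ φ)' = f' ⊗ φ + f ⊗ φ'`. -/
def ddx : FormalSolutionRing →+ FormalSolutionRing :=
  TensorProduct.liftAddHom
    (AddMonoidHom.mk' (fun f => AddMonoidHom.mk'
        (fun φ => FormalSeries.ddx f ⊗ₜ[LaurentPolynomial ℂ] φ
          + f ⊗ₜ[LaurentPolynomial ℂ] HolFun.ddx φ)
        (fun φ ψ => by
          rw [HolFun.ddx_add, TensorProduct.tmul_add, TensorProduct.tmul_add]; abel))
      (fun f g => by
        ext φ
        simp only [AddMonoidHom.mk'_apply, AddMonoidHom.add_apply]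
        rw [FormalSeries.ddx_add, TensorProduct.add_tmul, TensorProduct.add_tmul]; abel))
    (fun p f φ => by
      obtain ⟨p', h1, h2⟩ := exists_derivative p
      simp only [AddMonoidHom.mk'_apply]
      have e1 : FormalSeries.ddx (p • f) = p' • f + p • FormalSeries.ddx f := by
        rw [Algebra.smul_def, Algebra.smul_def, Algebra.smul_def, FormalSeries.ddx_mul, h1]
      have e2 : HolFun.ddx (p • φ) = p' • φ + p • HolFun.ddx φ := by
        rw [Algebra.smul_def, Algebra.smul_def, Algebra.smul_def, HolFun.ddx_mul, h2]
      rw [e1, e2, TensorProduct.add_tmul, TensorProduct.tmul_add,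
        TensorProduct.smul_tmul, TensorProduct.smul_tmul, TensorProduct.smul_tmul]
      abel)

theorem ddx_tmul (f : FormalSeries) (φ : HolFun) :
    ddx (f ⊗ₜ[LaurentPolynomial ℂ] φ) =
      FormalSeries.ddx f ⊗ₜ[LaurentPolynomial ℂ] φ
        + f ⊗ₜ[LaurentPolynomial ℂ] HolFun.ddx φ := rfl

/-- The Leibniz rule. -/
theorem ddx_mul (u v : FormalSolutionRing) : ddx (u * v) = ddx u * v + u * ddx v := by
  induction u using TensorProduct.induction_on with
  | zero => simp
  | add u₁ u₂ h₁ h₂ => rw [add_mul, map_add, h₁, h₂, map_add]; ring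
  | tmul f φ =>
    induction v using TensorProduct.induction_on with
    | zero => simp
    | add v₁ v₂ h₁ h₂ => rw [mul_add, map_add, h₁, h₂, map_add]; ring
    | tmul g ψ =>
      rw [Algebra.TensorProduct.tmul_mul_tmul, ddx_tmul, ddx_tmul, ddx_tmul,
        FormalSeries.ddx_mul, HolFun.ddx_mul]
      simp only [add_mul, mul_add, TensorProduct.add_tmul, TensorProduct.tmul_add,
        Algebra.TensorProduct.tmul_mul_tmul]
      abel

/-- A formal series as an element of the ring of formal solutions. -/
def ofSeries (f : FormalSeries) : FormalSolutionRing := f ⊗ₜ[LaurentPolynomial ℂ] 1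

/-- A holomorphic function as an element of the ring of formal solutions. -/
def ofHol (φ : HolFun) : FormalSolutionRing := 1 ⊗ₜ[LaurentPolynomial ℂ] φ

end FormalSolutionRing

/-! ### Jordan cells, Lidskii matrices and genericity -/

/-- The index set of matrices partitioned into blocks of sizes `n 0, …, n (s - 1)`. -/
abbrev BlockIndex {s : ℕ} (n : Fin s → ℕ) : Type := Σ j : Fin s, Fin (n j)

/-- The upper triangular Jordan cell of size `m` with eigenvalue `c`. -/
def jordanCell (c : ℂ) (m : ℕ) : Matrix (Fin m) (Fin m) ℂ :=
  Matrix.of fun a b => if a = b then c else if (b : ℕ) = a + 1 then 1 else 0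

/-- The Lidskii matrix of `B`: the lower-left entries of the blocks of `B`. -/
def lidskiiMatrix {s : ℕ} {n : Fin s → ℕ} (hn : ∀ j, 1 ≤ n j)
    (B : Matrix (BlockIndex n) (BlockIndex n) ℂ) : Matrix (Fin s) (Fin s) ℂ :=
  Matrix.of fun i j => B ⟨i, ⟨n i - 1, Nat.sub_lt (hn i) one_pos⟩⟩ ⟨j, ⟨0, hn j⟩⟩

open Classical in
/-- The Lidskii pseudo-characteristic polynomial attached to the cells with eigenvalue `c` and
size `m`: the determinant of the submatrix of the Lidskii matrix on the cells with eigenvalue `c`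
and size at least `m`, minus the variable times the projector onto the cells of size exactly
`m`. -/
def pseudoCharpoly {s : ℕ} {n : Fin s → ℕ} (hn : ∀ j, 1 ≤ n j) (lam : Fin s → ℂ)
    (B : Matrix (BlockIndex n) (BlockIndex n) ℂ) (c : ℂ) (m : ℕ) : Polynomial ℂ :=
  Matrix.det (Matrix.of fun i j : {j : Fin s // lam j = c ∧ m ≤ n j} =>
    Polynomial.C (lidskiiMatrix hn B i j) -
      if i = j ∧ n i = m then Polynomial.X else 0)

/-- The Lidskii pseudovalues (roots of the pseudo-characteristic polynomials) of `B` are generic: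
none of them is zero and every pseudo-characteristic polynomial has nonzero discriminant. -/
def LidskiiGeneric {s : ℕ} {n : Fin s → ℕ} (hn : ∀ j, 1 ≤ n j) (lam : Fin s → ℂ)
    (B : Matrix (BlockIndex n) (BlockIndex n) ℂ) : Prop :=
  ∀ j, ¬ (pseudoCharpoly hn lam B (lam j) (n j)).IsRoot 0 ∧
    (pseudoCharpoly hn lam B (lam j) (n j)).discr ≠ 0

/-! ### The normal form -/

/-- The `m × m` matrix `H(x)` with ones below the diagonal and `x` in the upper right corner
(`H(x) = (x)` for `m = 1`). -/
def shiftMatrix {R : Type*} [CommRing R] (m : ℕ) (x : R) : Matrix (Fin m) (Fin m) R :=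
  Matrix.of fun a b =>
    if (a : ℕ) = b + 1 then 1 else if (a : ℕ) = 0 ∧ (b : ℕ) + 1 = m then x else 0

/-- The matrix of coefficients of `x ^ k`. -/
def coeffMatrix {ι : Type*} (A : Matrix ι ι FormalSeries) (k : ℤ) : Matrix ι ι ℂ :=
  A.map fun f => FormalSeries.xcoeff f k

/-- The block `(m x)⁻¹ ∑_{J = 0}^{r m} t_J H(x) ^ J - (m x)⁻¹ G`, `G = diag (0, 1, …, m - 1)`. -/
def normalBlock (r m : ℕ) (t : ℕ → ℂ) : Matrix (Fin m) (Fin m) FormalSeries :=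
  ((m : FormalSeries) * FormalSeries.x)⁻¹ •
    (∑ J ∈ Finset.range (r * m + 1),
        (HahnSeries.C (t J) : FormalSeries) • shiftMatrix m FormalSeries.x ^ J
      - Matrix.diagonal fun a : Fin m => ((a : ℕ) : FormalSeries))

/-- The block diagonal connection `D = diag (D_1, …, D_s)`. -/
def normalForm {s : ℕ} (r : ℕ) (n : Fin s → ℕ) (t : Fin s → ℕ → ℂ) :
    Matrix (BlockIndex n) (BlockIndex n) FormalSeries :=
  Matrix.blockDiagonal' fun j => normalBlock r (n j) (t j)

/-- `Y = Y_0 + ∑_{j ≥ 1} x ^ (-j) Y_j` with `det Y_0 ≠ 0`. -/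
def IsFormalGauge {ι : Type*} [Fintype ι] [DecidableEq ι] (Y : Matrix ι ι FormalSeries) : Prop :=
  (∀ k : ℤ, 0 < k → coeffMatrix Y k = 0) ∧ (coeffMatrix Y 0).det ≠ 0

/-- `Y` is a formal gauge that transforms `A` into the normal form with parameters
`t j J`, `0 ≤ J ≤ r n_j`, where `t j (r n_j) = n_j λ_j`. -/
def IsNormalizingGauge {s : ℕ} (r : ℕ) (n : Fin s → ℕ) (lam : Fin s → ℂ)
    (A Y : Matrix (BlockIndex n) (BlockIndex n) FormalSeries) (t : Fin s → ℕ → ℂ) : Prop :=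
  IsFormalGauge Y ∧ (∀ j, t j (r * n j) = n j * lam j) ∧
    Y⁻¹ * A * Y - Y⁻¹ * Y.map FormalSeries.ddx = normalForm r n t

/-! ### The bare solution -/

/-- The value at `w = log x` of `exp (∑_{J = 1}^{r m} (t_J / J) H(x) ^ J) x ^ ((t_0 - G) / m)`. -/
def bareBlock (r m : ℕ) (t : ℕ → ℂ) (w : ℂ) : Matrix (Fin m) (Fin m) ℂ :=
  NormedSpace.exp (∑ J ∈ Finset.Icc 1 (r * m), (t J / J) • shiftMatrix m (Complex.exp w) ^ J) *
    Matrix.diagonal fun a : Fin m => Complex.exp ((t 0 - (a : ℕ)) / m * w)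

section

attribute [local instance] Matrix.linftyOpNormedRing Matrix.linftyOpNormedAlgebra

theorem differentiable_bareBlock (r m : ℕ) (t : ℕ → ℂ) : Differentiable ℂ (bareBlock r m t) := by
  have hH : Differentiable ℂ fun w : ℂ => shiftMatrix m (Complex.exp w) := by
    have : (fun w : ℂ => shiftMatrix m (Complex.exp w)) = fun w =>
        shiftMatrix m (0 : ℂ) + Complex.exp w • (shiftMatrix m (1 : ℂ) - shiftMatrix m 0) := by
      funext w
      ext a b
      simp only [shiftMatrix, Matrix.of_apply, Matrix.add_apply, Matrix.smul_apply,
        Matrix.sub_apply, smul_eq_mul]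
      split_ifs <;> simp
    rw [this]
    exact (differentiable_const _).add (Complex.differentiable_exp.smul_const _)
  have hS : Differentiable ℂ fun w : ℂ =>
      ∑ J ∈ Finset.Icc 1 (r * m), (t J / J) • shiftMatrix m (Complex.exp w) ^ J :=
    Differentiable.fun_sum fun J _ => (hH.fun_pow J).fun_const_smul _
  have hE : Differentiable ℂ (NormedSpace.exp : Matrix (Fin m) (Fin m) ℂ → _) := fun M =>
    (NormedSpace.exp_analytic (𝕂 := ℂ) M).differentiableAt
  have hD : Differentiable ℂ fun w : ℂ =>
      (Matrix.diagonal fun a : Fin m => Complex.exp ((t 0 - (a : ℕ)) / m * w) :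
        Matrix (Fin m) (Fin m) ℂ) := by
    have : (fun w : ℂ => (Matrix.diagonal fun a : Fin m =>
        Complex.exp ((t 0 - (a : ℕ)) / m * w) : Matrix (Fin m) (Fin m) ℂ)) = fun w =>
        ∑ a : Fin m, Complex.exp ((t 0 - (a : ℕ)) / m * w) • Matrix.single a a (1 : ℂ) := by
      funext w
      rw [← Matrix.sum_single_eq_diagonal]
      simp [Matrix.smul_single]
    rw [this]
    exact Differentiable.fun_sum fun a _ =>
      ((differentiable_id.const_mul _).cexp).smul_const _
  exact (hE.comp hS).mul hD

theorem differentiable_bareBlock_apply (r m : ℕ) (t : ℕ → ℂ) (a b : Fin m) :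
    Differentiable ℂ fun w => bareBlock r m t w a b :=
  (LinearMap.toContinuousLinearMap (Matrix.entryLinearMap ℂ ℂ a b)).differentiable.comp
    (differentiable_bareBlock r m t)

end

/-- The matrix `Ψ^bare`, with entries holomorphic in `w = log x`. -/
def bareSolution {s : ℕ} (r : ℕ) (n : Fin s → ℕ) (t : Fin s → ℕ → ℂ) :
    Matrix (BlockIndex n) (BlockIndex n) HolFun :=
  Matrix.blockDiagonal' fun j => Matrix.of fun a b =>
    (⟨fun w => bareBlock r (n j) (t j) w a b, differentiable_bareBlock_apply r (n j) (t j) a b⟩ :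
      HolFun)

/-- The product `Y · Ψ^bare`. -/
def formalSolution {s : ℕ} (r : ℕ) (n : Fin s → ℕ)
    (Y : Matrix (BlockIndex n) (BlockIndex n) FormalSeries) (t : Fin s → ℕ → ℂ) :
    Matrix (BlockIndex n) (BlockIndex n) FormalSolutionRing :=
  Y.map FormalSolutionRing.ofSeries * (bareSolution r n t).map FormalSolutionRing.ofHol

/-- `Ψ` is a fundamental formal solution of `Ψ' = A Ψ`. -/
def IsFundamentalSolution {ι : Type*} [Fintype ι] [DecidableEq ι]
    (A : Matrix ι ι FormalSeries) (Ψ : Matrix ι ι FormalSolutionRing) : Prop :=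
  Ψ.map FormalSolutionRing.ddx = A.map FormalSolutionRing.ofSeries * Ψ ∧ IsUnit Ψ.det

/-- The constant matrix that sends the `j`-th block to the `σ j`-th block, of the same size, by
`c_j diag (1, ζ_j, …, ζ_j ^ (n_j - 1))`. -/
def monomialMatrix {s : ℕ} (n : Fin s → ℕ) (σ : Equiv.Perm (Fin s)) (ζ c : Fin s → ℂ) :
    Matrix (BlockIndex n) (BlockIndex n) FormalSeries :=
  Matrix.of fun p q => if p.1 = σ q.1 ∧ (p.2 : ℕ) = q.2 then
    HahnSeries.C (c q.1 * ζ q.1 ^ (q.2 : ℕ)) else 0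

end ResonantConnection

end

/-! ### Eigenvectors of the Lidskii pencils -/

noncomputable section

namespace ResonantConnection
open Polynomial

/-! Existence reduces to one ramified formal eigenvector per cell. Write A = x^(r-1) Â(1/x), fix a
cell of size m = n_j, and put z = x^(-1/m), so that x d/dx = -(1/m) z d/dz. Suppose that Â(z^m) v +
(1/m) z^(rm) z dv/dz = Q v with Q a polynomial in z of degree at most rm. Split v = ∑_b z^b y_b(x)
by residues of exponents modulo m. On the columns y_0, …, y_(m-1), multiplication of v by 1/z is
right multiplication by H(x), and differentiating the factors z^b produces G. The equation for v is
therefore the gauge equation for one block, with t_J = m Q_(rm-J) (`sectorMatrix_eqn`).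

The eigenvectors come from Lidskii's perturbation theory. On the cells with eigenvalue λ_j, weight
the a-th coordinate by z^min(a, m); elsewhere use weight 0. The leading operator (`principalPart`)
then couples the nilpotent shift with entries of A_(r-1), and its eigenvectors with eigenvalue μ
come from those of the pencil L - ν Π with ν = μ^m (`principalPart_leadingVector`,
`pencil_of_kernel`). A nonzero, simple pseudovalue makes the kernel one-dimensional, so each further
coefficient of v, together with a correction of Q, can be solved for (`exists_solution_of_simple`).
If rm = 1 the derivation enters the leading operator and replaces μ by μ - k; the absence of integer
differences keeps it invertible (`exists_solution_of_not_isRoot`). A scalar factor removes the part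
of Q of degree above rm. That the resulting Y_0 is invertible follows from the independence of the
pencil eigenvectors (`det_ne_zero_of_toeplitz`).

For uniqueness, W = Y⁻¹ Y' intertwines two normal forms. Extend the basis of a block by e_(b+m) = x
e_b: then H is the shift of the basis, and a block of W becomes a doubly indexed array F with a
simple recursion (`IsIntertwiner`). Comparing terms of highest weight in a nonzero block forces
equal eigenvalues, then equal sizes, because t_(rm-1) ≠ 0 when m ≥ 2 (`IsNormalizingGauge.ne_zero`),
then a single geometric diagonal (`IsIntertwiner.eq_monomial`). Distinctness of the pseudovalues
leaves one nonzero block per column, so W is monomial (`exists_eq_monomialMatrix`). Nonresonance is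
verified for the constructed gauge and passes to all others through W.

For the fundamental solution, conjugation by x^(-G/m) turns H(x) into x^(1/m) H(1). The exponent
then takes values in commuting matrices and can be differentiated like a scalar
(`hasDerivAt_bareBlock`). -/

theorem nodup_roots_of_discr_ne_zero {f : ℂ[X]} (h : f.discr ≠ 0) : f.roots.Nodup := by
  rcases eq_or_ne f.natDegree 0 with h0 | h0
  · rw [eq_C_of_natDegree_eq_zero h0, roots_C]; exact Multiset.nodup_zero
  have hd : 0 < f.degree := natDegree_pos_iff_degree_pos.mp (Nat.pos_of_ne_zero h0)
  have hf : f ≠ 0 := by rintro rfl; simp at h0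
  have h1 := resultant_deriv hd
  have h2 : resultant f f.derivative f.natDegree (f.natDegree - 1) ≠ 0 := by
    rw [h1]
    exact mul_ne_zero (mul_ne_zero (pow_ne_zero _ (by norm_num)) (leadingCoeff_ne_zero.mpr hf)) h
  rw [← natDegree_derivative f] at h2
  refine nodup_roots ?_
  by_contra h3
  exact h2 (resultant_eq_zero_iff.mpr ⟨Or.inl hf, h3⟩)

/-- Over ℂ a squarefree characteristic polynomial has as many roots as the dimension, and
eigenvectors for distinct eigenvalues are independent. -/
theorem exists_eigenbasis {κ : Type*} [Fintype κ] [DecidableEq κ] (S : Matrix κ κ ℂ)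
    (h : S.charpoly.roots.Nodup) :
    ∃ (m : κ → ℂ) (p : Module.Basis κ ℂ (κ → ℂ)), Function.Injective m ∧
      (∀ j, S.charpoly.IsRoot (m j)) ∧ ∀ j, S.mulVec (p j) = m j • p j := by
  classical
  have hcard : S.charpoly.roots.toFinset.card = Fintype.card κ := by
    rw [Multiset.toFinset_card_of_nodup h, ← S.charpoly_natDegree_eq_dim]
    exact (IsAlgClosed.splits S.charpoly).natDegree_eq_card_roots.symm
  have e : κ ≃ S.charpoly.roots.toFinset := Fintype.equivOfCardEq (by
    rw [Fintype.card_coe, hcard])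
  have hroot : ∀ j, S.charpoly.IsRoot (e j : ℂ) := fun j =>
    isRoot_of_mem_roots (Multiset.mem_toFinset.mp (e j).2)
  have hev : ∀ j, Module.End.HasEigenvalue (Matrix.toLin' S) (e j : ℂ) := fun j => by
    rw [Module.End.hasEigenvalue_iff_isRoot_charpoly, Matrix.charpoly_toLin']
    exact hroot j
  choose v hv using fun j => (hev j).exists_hasEigenvector
  have hinj : Function.Injective fun j => (e j : ℂ) := Subtype.val_injective.comp e.injective
  have hli := Module.End.eigenvectors_linearIndependent' (Matrix.toLin' S) _ hinj v hv
  refine ⟨fun j => e j, Module.Basis.mk hli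
    (hli.span_eq_top_of_card_eq_finrank' (by simp)).ge, hinj, hroot, ?_⟩
  intro j
  rw [Module.Basis.mk_apply]
  have := (hv j).apply_eq_smul
  rwa [Matrix.toLin'_apply] at this

/-! ### Eigenvectors of a matrix pencil through the Schur complement -/

section Pencil

variable {ι : Type*} [Fintype ι]

theorem sum_eq_sum_subtype_add {p q : ι → Prop} [DecidablePred p] [DecidablePred q]
    (hpq : ∀ i, p i → ¬ q i) (f : ι → ℂ) (hf : ∀ i, f i ≠ 0 → p i ∨ q i) :
    ∑ i, f i = ∑ i : {i // p i}, f i + ∑ i : {i // q i}, f i := by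
  rw [← Finset.sum_subtype (Finset.univ.filter p) (by simp) f,
    ← Finset.sum_subtype (Finset.univ.filter q) (by simp) f, Finset.sum_filter, Finset.sum_filter,
    ← Finset.sum_add_distrib]
  refine Finset.sum_congr rfl fun i _ => ?_
  by_cases h1 : p i
  · simp [h1, hpq i h1]
  · by_cases h2 : q i
    · simp [h1, h2]
    · have : f i = 0 := by
        by_contra h
        rcases hf i h with h | h <;> contradiction
      simp [h1, h2, this]

/-- The determinant of a pencil `L - X Π`, where `Π` projects onto the indices in `q`, through the
Schur complement of the remaining block. -/
theorem det_pencil {κ₁ κ₂ : Type*} [Fintype κ₁] [Fintype κ₂] [DecidableEq κ₁] [DecidableEq κ₂]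
    (T : Matrix κ₁ κ₁ ℂ) (B : Matrix κ₁ κ₂ ℂ) (B' : Matrix κ₂ κ₁ ℂ) (D : Matrix κ₂ κ₂ ℂ)
    (hT : T.det ≠ 0) :
    (Matrix.fromBlocks (T.map C) (B.map C) (B'.map C)
      (D.map C - Matrix.scalar κ₂ (X : ℂ[X]))).det =
      C (T.det * (-1) ^ Fintype.card κ₂) * (D - B' * T⁻¹ * B).charpoly := by
  have hu : IsUnit T.det := isUnit_iff_ne_zero.mpr hT
  let _ : Invertible (T.map (C : ℂ → ℂ[X])) :=
    ⟨(T⁻¹).map C, by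
      rw [← Matrix.map_mul, Matrix.nonsing_inv_mul _ hu, Matrix.map_one _ C_0 C_1], by
      rw [← Matrix.map_mul, Matrix.mul_nonsing_inv _ hu, Matrix.map_one _ C_0 C_1]⟩
  have hinv : ⅟(T.map (C : ℂ → ℂ[X])) = (T⁻¹).map C := rfl
  rw [Matrix.det_fromBlocks₁₁, hinv, ← Matrix.map_mul, ← Matrix.map_mul]
  have h1 : D.map C - Matrix.scalar κ₂ (X : ℂ[X]) - (B' * T⁻¹ * B).map C =
      -Matrix.charmatrix (D - B' * T⁻¹ * B) := by
    ext i j : 1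
    simp only [Matrix.sub_apply, Matrix.map_apply, Matrix.neg_apply, Matrix.charmatrix_apply,
      Matrix.scalar_apply, C_sub]
    ring
  have h2 : (T.map (C : ℂ → ℂ[X])).det = C T.det := by
    rw [RingHom.map_det]; rfl
  rw [h1, Matrix.det_neg, h2, Matrix.charpoly]
  simp only [C_mul, C_pow, C_neg, C_1]
  ring

variable [DecidableEq ι]

/-- Eigenvectors of a pencil `L - ν Π`, `Π` the projector onto the indices in `q`, on the indices
in `p` or `q`. -/
theorem exists_pencil_eigenvectors (L : Matrix ι ι ℂ) (p q : ι → Prop) [DecidablePred p]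
    [DecidablePred q] (hpq : ∀ i, p i → ¬ q i)
    (hT : (Matrix.of fun i j : {i // p i} => L i j).det ≠ 0) (P : ℂ[X])
    (hP : P = Matrix.det (Matrix.of fun i j : {i // p i} ⊕ {i // q i} =>
      C (L (Sum.elim (↑) (↑) i) (Sum.elim (↑) (↑) j)) -
        if i = j ∧ q (Sum.elim (↑) (↑) i) then X else 0))
    (hnod : P.roots.Nodup) :
    ∃ (ν : ι → ℂ) (U : ι → ι → ℂ),
      (∀ j, q j → P.IsRoot (ν j)) ∧
      (∀ j j', q j → q j' → ν j = ν j' → j = j') ∧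
      (∀ j i, U j i ≠ 0 → p i ∨ q i) ∧
      (∀ j, q j → ∀ i, p i ∨ q i → ∑ k, L i k * U j k = if q i then ν j * U j i else 0) ∧
      (∀ j, q j → ∀ (u : ι → ℂ) (a : ℂ), (∀ i, u i ≠ 0 → p i ∨ q i) →
        (∀ i, p i ∨ q i → ∑ k, L i k * u k = if q i then ν j * u i + a * U j i else 0) →
        a = 0 ∧ ∃ b : ℂ, u = b • U j) ∧
      (∀ a : ι → ℂ, (∀ i, q i → ∑ k, (if q k then a k else 0) * U k i = 0) →
        ∀ k, q k → a k = 0) := by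
  set T : Matrix {i // p i} {i // p i} ℂ := Matrix.of fun i j => L i j with hTdef
  set B : Matrix {i // p i} {i // q i} ℂ := Matrix.of fun i j => L i j with hBdef
  set B' : Matrix {i // q i} {i // p i} ℂ := Matrix.of fun i j => L i j with hB'def
  set D : Matrix {i // q i} {i // q i} ℂ := Matrix.of fun i j => L i j with hDdef
  have hP' : P = C (T.det * (-1) ^ Fintype.card {i // q i}) * (D - B' * T⁻¹ * B).charpoly := by
    rw [← det_pencil T B B' D hT, hP]
    congr 1
    ext i j : 1
    rcases i with i | i <;> rcases j with j | j
    · have := hpq i i.2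
      simp [T, this]
    · simp [B]
    · simp [B']
    · have := i.2
      by_cases hij : i = j <;> simp [D, Matrix.diagonal, hij, j.2]
  have hc : T.det * (-1) ^ Fintype.card {i // q i} ≠ 0 :=
    mul_ne_zero hT (pow_ne_zero _ (by norm_num))
  have hnod' : (D - B' * T⁻¹ * B).charpoly.roots.Nodup := by
    rwa [hP', roots_C_mul _ hc] at hnod
  obtain ⟨m, e, hm, hroot, heig⟩ := exists_eigenbasis _ hnod'
  have hu : IsUnit T.det := isUnit_iff_ne_zero.mpr hT
  -- An eigenvector e of the Schur complement D - B' T⁻¹ B extends to the pencil by solving the rows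
  -- in `p`: the remaining components are -T⁻¹ B e.
  let V : {i // q i} → ι → ℂ := fun j i =>
    if h : p i then -(T⁻¹.mulVec (B.mulVec (e j))) ⟨i, h⟩ else
      if h : q i then e j ⟨i, h⟩ else 0
  have hVp : ∀ j (i : {i // p i}), V j i = -(T⁻¹.mulVec (B.mulVec (e j))) i := fun j i => by
    simp [V, i.2]
  have hVq : ∀ j (i : {i // q i}), V j i = e j i := fun j i => by
    have : ¬ p i := fun h => hpq i h i.2
    simp [V, this, i.2]
  have hVs : ∀ j i, V j i ≠ 0 → p i ∨ q i := fun j i h => by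
    by_contra h'
    rw [not_or] at h'
    exact h (by simp [V, h'.1, h'.2])
  -- the equations in block form
  have hsplit : ∀ u : ι → ℂ, (∀ i, u i ≠ 0 → p i ∨ q i) → ∀ i, ∑ k, L i k * u k =
      ∑ k : {i // p i}, L i k * u k + ∑ k : {i // q i}, L i k * u k := fun u hu i =>
    sum_eq_sum_subtype_add hpq _ fun k hk => hu k (right_ne_zero_of_mul hk)
  have hVeq : ∀ j i, p i ∨ q i → ∑ k, L i k * V j k = if q i then m j * V j i else 0 := by
    intro j i hi
    rw [hsplit _ (hVs j)]
    simp only [hVp, hVq]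
    rcases hi with hi | hi
    · rw [if_neg (hpq i hi)]
      have h1 : T.mulVec (-(T⁻¹.mulVec (B.mulVec (e j)))) + B.mulVec (e j) = 0 := by
        rw [Matrix.mulVec_neg, Matrix.mulVec_mulVec, Matrix.mul_nonsing_inv _ hu,
          Matrix.one_mulVec, neg_add_cancel]
      exact congrFun h1 ⟨i, hi⟩
    · rw [if_pos hi]
      have h1 : B'.mulVec (-(T⁻¹.mulVec (B.mulVec (e j)))) + D.mulVec (e j) = m j • e j := by
        rw [← heig j, Matrix.sub_mulVec, Matrix.mulVec_neg, ← Matrix.mulVec_mulVec,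
          ← Matrix.mulVec_mulVec]
        abel
      have h2 := congrFun h1 ⟨i, hi⟩
      have h3 := hVq j ⟨i, hi⟩
      simp only at h3
      rw [h3]
      exact h2
  refine ⟨fun j => if h : q j then m ⟨j, h⟩ else 0, fun j => if h : q j then V ⟨j, h⟩ else 0,
    ?_, ?_, ?_, ?_, ?_, ?_⟩
  · intro j hj
    simp only [hj, dif_pos]
    rw [hP', IsRoot, eval_mul, hroot ⟨j, hj⟩, mul_zero]
  · intro j j' hj hj' h
    simp only [hj, hj', dif_pos] at h
    exact congrArg Subtype.val (hm h)
  · intro j i h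
    by_cases hj : q j
    · simp only [hj, dif_pos] at h
      exact hVs _ i h
    · simp [hj] at h
  · intro j hj i hi
    simp only [hj, dif_pos]
    exact hVeq _ i hi
  · intro j hj u a hus heq
    simp only [hj, dif_pos] at heq ⊢
    set j' : {i // q i} := ⟨j, hj⟩
    let u1 : {i // p i} → ℂ := fun i => u i
    let u2 : {i // q i} → ℂ := fun i => u i
    have e1 : T.mulVec u1 + B.mulVec u2 = 0 := by
      funext i
      have := heq i (Or.inl i.2)
      rw [if_neg (hpq i i.2), hsplit u hus] at this
      exact this
    have e2 : B'.mulVec u1 + D.mulVec u2 = m j' • u2 + a • e j' := by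
      funext i
      have := heq i (Or.inr i.2)
      rw [if_pos i.2, hsplit u hus, hVq] at this
      exact this
    have e3 : u1 = -(T⁻¹.mulVec (B.mulVec u2)) := by
      have := congrArg T⁻¹.mulVec (eq_neg_of_add_eq_zero_left e1)
      rwa [Matrix.mulVec_mulVec, Matrix.nonsing_inv_mul _ hu, Matrix.one_mulVec,
        Matrix.mulVec_neg] at this
    have e4 : (D - B' * T⁻¹ * B).mulVec u2 = m j' • u2 + a • e j' := by
      rw [← e2, e3, Matrix.sub_mulVec, Matrix.mulVec_neg, ← Matrix.mulVec_mulVec,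
        ← Matrix.mulVec_mulVec]
      abel
    -- In the eigenbasis the inhomogeneous equation is diagonal. The coordinate `j'` gives `a = 0`,
    -- and the other coordinates vanish because the eigenvalues are distinct.
    have e5 : ∀ k, e.repr u2 k * m k = m j' * e.repr u2 k + a * (if k = j' then 1 else 0) := by
      intro k
      have h1 : (D - B' * T⁻¹ * B).mulVec u2 = ∑ k, (e.repr u2 k * m k) • e k := by
        conv_lhs => rw [← e.sum_repr u2]
        rw [Matrix.mulVec_sum]
        refine Finset.sum_congr rfl fun k _ => ?_
        rw [Matrix.mulVec_smul, heig, smul_smul]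
      have h2 := congrArg (fun v => e.repr v k) e4
      simp only [h1, map_sum, map_add, map_smul, Module.Basis.repr_self, Finsupp.coe_finsetSum,
        Finset.sum_apply, Finsupp.coe_add, Pi.add_apply, Finsupp.coe_smul, Pi.smul_apply,
        smul_eq_mul, Finsupp.single_apply] at h2
      rw [Finset.sum_eq_single k (fun b _ hb => by simp [hb]) (by simp)] at h2
      simpa [eq_comm] using h2
    have ha : a = 0 := by
      have := e5 j'
      rw [if_pos rfl, mul_one, mul_comm] at this
      simpa using this
    refine ⟨ha, e.repr u2 j', ?_⟩
    have e6 : u2 = e.repr u2 j' • e j' := by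
      conv_lhs => rw [← e.sum_repr u2]
      refine Finset.sum_eq_single j' (fun k _ hk => ?_) (by simp)
      have := e5 k
      rw [ha, zero_mul, add_zero, mul_comm, ← sub_eq_zero, ← sub_mul] at this
      rcases mul_eq_zero.mp this with h | h
      · exact absurd (hm (sub_eq_zero.mp h)) hk
      · rw [h, zero_smul]
    funext i
    by_cases hp : p i
    · have h1 := congrFun e3 ⟨i, hp⟩
      rw [e6, Matrix.mulVec_smul, Matrix.mulVec_smul] at h1
      rw [Pi.smul_apply, hVp j' ⟨i, hp⟩]
      simpa [u1] using h1
    · by_cases hq : q i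
      · have h1 := congrFun e6 ⟨i, hq⟩
        rw [Pi.smul_apply, hVq j' ⟨i, hq⟩]
        exact h1
      · have h1 : u i = 0 := by
          by_contra h; rcases hus i h with h | h <;> contradiction
        have h2 : V j' i = 0 := by simp [V, hp, hq]
        rw [Pi.smul_apply, h1, h2, smul_zero]
  · intro a ha
    have h1 : ∑ k : {i // q i}, a k • e k = 0 := by
      funext i
      have := ha i i.2
      rw [sum_eq_sum_subtype_add hpq _ (fun k hk => by
        right; by_contra h; simp [h] at hk)] at this
      rw [Finset.sum_eq_zero (fun k _ => by simp [hpq k k.2]), zero_add] at this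
      rw [Finset.sum_apply, Pi.zero_apply, ← this]
      refine Finset.sum_congr rfl fun k _ => ?_
      simp [k.2, hVq]
    intro k hk
    exact (Fintype.linearIndependent_iff.mp e.linearIndependent) (fun k => a k) h1 ⟨k, hk⟩

end Pencil

/-! ### Pseudo-eigenvectors of the Lidskii matrix -/

section Lidskii

variable {s : ℕ} {n : Fin s → ℕ} (hn : ∀ j, 1 ≤ n j) (lam : Fin s → ℂ)
  (B : Matrix (BlockIndex n) (BlockIndex n) ℂ)

/-- The indices of the cells that interact with the `j`-th one: same eigenvalue, size at least
`n j`. -/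
def Above (j i : Fin s) : Prop := lam i = lam j ∧ n j ≤ n i

/-- Pseudovalues `ν j` and pseudo-eigenvectors `U j` of a Lidskii matrix, one for each cell. -/
structure LidskiiBasis (ν : Fin s → ℂ) (U : Fin s → Fin s → ℂ) : Prop where
  isRoot : ∀ j, (pseudoCharpoly hn lam B (lam j) (n j)).IsRoot (ν j)
  injective : ∀ j j', lam j' = lam j → n j' = n j → ν j = ν j' → j = j'
  support : ∀ j i, U j i ≠ 0 → Above (n := n) lam j i
  eigen : ∀ j i, Above (n := n) lam j i →
    ∑ k, lidskiiMatrix hn B i k * U j k = if n i = n j then ν j * U j i else 0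
  simple : ∀ j (u : Fin s → ℂ) (a : ℂ), (∀ i, u i ≠ 0 → Above (n := n) lam j i) →
    (∀ i, Above (n := n) lam j i → ∑ k, lidskiiMatrix hn B i k * u k =
      if n i = n j then ν j * u i + a * U j i else 0) → a = 0 ∧ ∃ b : ℂ, u = b • U j
  indep : ∀ j (a : Fin s → ℂ), (∀ i, lam i = lam j → n i = n j →
    ∑ k, (if lam k = lam j ∧ n k = n j then a k else 0) * U k i = 0) →
      ∀ k, lam k = lam j → n k = n j → a k = 0

variable {hn lam B}

/-- If m' is the smallest size above `m` that occurs for the eigenvalue `c`, this minor is the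
pseudo-characteristic polynomial of size m' at 0. This is where the absence of zero pseudovalues
makes the Schur complement available. -/
theorem det_lidskii_above_ne_zero (hgen : LidskiiGeneric hn lam B) (c : ℂ) (m : ℕ) :
    (Matrix.of fun i j : {i : Fin s // lam i = c ∧ m < n i} =>
      lidskiiMatrix hn B i j).det ≠ 0 := by
  classical
  by_cases hne : ∃ i : Fin s, lam i = c ∧ m < n i
  · obtain ⟨j, hj, hmin⟩ := Finset.exists_min_image
      (Finset.univ.filter fun i : Fin s => lam i = c ∧ m < n i) n
      (by obtain ⟨i, hi⟩ := hne; exact ⟨i, by simpa using hi⟩)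
    have hj' : lam j = c ∧ m < n j := by simpa using hj
    have h0 := (hgen j).1
    rw [IsRoot, pseudoCharpoly, ← coe_evalRingHom, RingHom.map_det] at h0
    let e : {i : Fin s // lam i = c ∧ m < n i} ≃ {i : Fin s // lam i = lam j ∧ n j ≤ n i} :=
      Equiv.subtypeEquivRight fun i => by
        constructor
        · rintro ⟨h1, h2⟩
          exact ⟨h1.trans hj'.1.symm, hmin i (by simp [h1, h2])⟩
        · rintro ⟨h1, h2⟩
          exact ⟨h1.trans hj'.1, hj'.2.trans_le h2⟩
    rw [← Matrix.det_submatrix_equiv_self e] at h0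
    convert! h0 using 2
    ext a b
    simp only [Matrix.of_apply, Matrix.submatrix_apply, RingHom.mapMatrix_apply, Matrix.map_apply,
      coe_evalRingHom, eval_sub, eval_C]
    split_ifs <;> simp [e]
  · have : IsEmpty {i : Fin s // lam i = c ∧ m < n i} := ⟨fun i => hne ⟨i, i.2⟩⟩
    rw [Matrix.det_isEmpty]
    exact one_ne_zero

/-- Cells with a common eigenvalue and size share a pencil: the larger cells form the invertible
block, the cells of that exact size carry the variable. The distinct roots of that pencil are
distributed among those cells. -/
theorem exists_lidskiiBasis (hgen : LidskiiGeneric hn lam B) :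
    ∃ ν U, LidskiiBasis hn lam B ν U := by
  classical
  have hP : ∀ (c : ℂ) (m : ℕ), _ := fun c m =>
    exists_pencil_eigenvectors (lidskiiMatrix hn B) (fun i => lam i = c ∧ m < n i)
      (fun i => lam i = c ∧ n i = m) (fun i h1 h2 => by omega)
      (by convert! det_lidskii_above_ne_zero hgen c m)
      (pseudoCharpoly hn lam B c m)
      (by
        let e : {i : Fin s // lam i = c ∧ m < n i} ⊕ {i : Fin s // lam i = c ∧ n i = m} ≃
            {i : Fin s // lam i = c ∧ m ≤ n i} :=
          (subtypeOrEquiv (fun i => lam i = c ∧ m < n i) (fun i => lam i = c ∧ n i = m)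
            (by
              rw [Pi.disjoint_iff]
              intro i
              rw [Prop.disjoint_iff]
              grind)).symm.trans
            (Equiv.subtypeEquivRight fun i => by
              constructor
              · rintro (h | h)
                · exact ⟨h.1, h.2.le⟩
                · exact ⟨h.1, h.2.ge⟩
              · rintro ⟨h1, h2⟩
                rcases h2.lt_or_eq with h | h
                · exact Or.inl ⟨h1, h⟩
                · exact Or.inr ⟨h1, h.symm⟩)
        have he : ∀ a, (e a : Fin s) = Sum.elim (↑) (↑) a := by
          rintro (a | a) <;> rfl
        unfold pseudoCharpoly
        rw [← Matrix.det_submatrix_equiv_self e]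
        congr 1
        ext a b : 1
        simp only [Matrix.of_apply, Matrix.submatrix_apply, he, e.injective.eq_iff]
        have : lam (Sum.elim (↑) (↑) a) = c := by
          rcases a with a | a
          · exact a.2.1
          · exact a.2.1
        simp only [this, true_and])
  choose! ν U hνU using hP
  have hor : ∀ j i, (lam i = lam j ∧ n j < n i ∨ lam i = lam j ∧ n i = n j) ↔
      Above (n := n) lam j i := fun j i => by
    unfold Above
    constructor
    · rintro (h | h)
      · exact ⟨h.1, h.2.le⟩
      · exact ⟨h.1, h.2.ge⟩
    · rintro ⟨h1, h2⟩
      rcases h2.lt_or_eq with h | h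
      · exact Or.inl ⟨h1, h⟩
      · exact Or.inr ⟨h1, h.symm⟩
  have key := fun j : Fin s => hνU (lam j) (n j) (nodup_roots_of_discr_ne_zero (hgen j).2)
  simp only [hor] at key
  refine ⟨fun j => ν (lam j) (n j) j, fun j => U (lam j) (n j) j, ?_, ?_, ?_, ?_, ?_, ?_⟩
  · intro j
    exact (key j).1 j ⟨rfl, rfl⟩
  · intro j j' h1 h2 h3
    rw [h1, h2] at h3
    exact (key j).2.1 j j' ⟨rfl, rfl⟩ ⟨h1, h2⟩ h3
  · intro j i h
    exact (key j).2.2.1 j i h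
  · intro j i h
    rw [(key j).2.2.2.1 j ⟨rfl, rfl⟩ i h]
    simp only [h.1, true_and]
  · intro j u a h1 h2
    refine (key j).2.2.2.2.1 j ⟨rfl, rfl⟩ u a h1 fun i h => ?_
    rw [h2 i h]
    simp only [h.1, true_and]
  · intro j a h k hk1 hk2
    refine (key j).2.2.2.2.2 a (fun i hi => ?_) k ⟨hk1, hk2⟩
    refine (Finset.sum_congr rfl fun l _ => ?_).trans (h i hi.1 hi.2)
    split_ifs with hl
    · rw [hl.1, hl.2]
    · simp

/-- A pseudo-characteristic polynomial does not vanish outside the pseudovalues. -/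
theorem eq_zero_of_not_isRoot {j : Fin s} {μ : ℂ}
    (hμ : ¬ (pseudoCharpoly hn lam B (lam j) (n j)).IsRoot μ) {u : Fin s → ℂ}
    (hu : ∀ i, u i ≠ 0 → Above (n := n) lam j i)
    (h : ∀ i, Above (n := n) lam j i → ∑ k, lidskiiMatrix hn B i k * u k =
      if n i = n j then μ * u i else 0) : u = 0 := by
  classical
  rw [IsRoot, pseudoCharpoly, ← coe_evalRingHom, RingHom.map_det] at hμ
  have h0 := Matrix.eq_zero_of_mulVec_eq_zero hμ
    (v := fun i : {i : Fin s // lam i = lam j ∧ n j ≤ n i} => u i) (by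
      funext i
      have h1 := h i i.2
      simp only [Matrix.mulVec, dotProduct, RingHom.mapMatrix_apply, Matrix.map_apply,
        Matrix.of_apply, coe_evalRingHom, eval_sub, eval_C, sub_mul, Finset.sum_sub_distrib,
        Pi.zero_apply]
      have h2 : ∑ k : {i : Fin s // lam i = lam j ∧ n j ≤ n i}, lidskiiMatrix hn B i k * u k =
          ∑ k, lidskiiMatrix hn B i k * u k := by
        rw [← Finset.sum_subtype (Finset.univ.filter fun i => lam i = lam j ∧ n j ≤ n i)
          (by simp) fun k => lidskiiMatrix hn B i k * u k]
        refine Finset.sum_subset (Finset.filter_subset _ _) fun k _ hk => ?_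
        have : u k = 0 := by
          by_contra h; exact hk (Finset.mem_filter.mpr ⟨Finset.mem_univ _, hu k h⟩)
        rw [this, mul_zero]
      rw [h2, h1, Finset.sum_eq_single i (fun b _ hb => by simp [hb.symm]) (by simp)]
      split_ifs <;> simp_all)
  funext i
  by_cases hi : Above (n := n) lam j i
  · exact congrFun h0 ⟨i, hi⟩
  · by_contra h'
    exact hi (hu i h')

theorem LidskiiBasis.ne_zero {ν : Fin s → ℂ} {U : Fin s → Fin s → ℂ}
    (h : LidskiiBasis hn lam B ν U) (hgen : LidskiiGeneric hn lam B) (j : Fin s) : ν j ≠ 0 := by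
  intro h0
  have := h.isRoot j
  rw [h0] at this
  exact (hgen j).1 this

end Lidskii
end ResonantConnection
end

/-! ### Formal eigenvalue problems with a derivation -/

noncomputable section

namespace ResonantConnection

/-- A sequence that satisfies a list of conditions, the `k`-th of which involves only the terms up
to the `k`-th and can be met by changing the `k`-th term. -/
theorem exists_seq_of_step {W : Type*} [Inhabited W] (Φ : ℕ → (ℕ → W) → Prop)
    (hlocal : ∀ k ω ω', (∀ i ≤ k, ω i = ω' i) → Φ k ω → Φ k ω')
    (hstep : ∀ k ω, (∀ i < k, Φ i ω) → ∃ a, Φ k (Function.update ω k a)) :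
    ∃ ω, ∀ k, Φ k ω := by
  classical
  choose! f hf using hstep
  let g : ℕ → ℕ → W := fun k =>
    Nat.rec (fun _ => default) (fun k ω => Function.update ω k (f k ω)) k
  have gs : ∀ k, g (k + 1) = Function.update (g k) k (f k (g k)) := fun k => rfl
  have hstab : ∀ k l i, k ≤ l → i < k → g l i = g k i := by
    intro k l i hkl hi
    induction l, hkl using Nat.le_induction with
    | base => rfl
    | succ l hl ih => rw [gs, Function.update_of_ne (by omega), ih]
  have hg : ∀ k, ∀ i < k, Φ i (g k) := by
    intro k
    induction k with
    | zero => intro i hi; omega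
    | succ k ih =>
      intro i hi
      rcases Nat.lt_succ_iff_lt_or_eq.mp hi with h | h
      · exact hlocal i (g k) _ (fun l hl => (hstab k (k + 1) l (by omega) (by omega)).symm)
          (ih i h)
      · rw [h, gs]
        exact hf k (g k) ih
  refine ⟨fun i => g (i + 1) i, fun k => ?_⟩
  exact hlocal k (g (k + 1)) _ (fun i hi => hstab (i + 1) (k + 1) i (by omega) (by omega))
    (hg (k + 1) k (by omega))

open PowerSeries in
/-- The Euler operator `X d/dX`. -/
def theta (f : PowerSeries ℂ) : PowerSeries ℂ := X * d⁄dX ℂ f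

theorem coeff_theta (f : PowerSeries ℂ) (k : ℕ) :
    PowerSeries.coeff k (theta f) = k * PowerSeries.coeff k f := by
  unfold theta
  cases k with
  | zero => simp
  | succ k =>
    rw [PowerSeries.coeff_succ_X_mul, PowerSeries.coeff_derivative]
    push_cast
    ring

theorem theta_mul (f g : PowerSeries ℂ) : theta (f * g) = theta f * g + f * theta g := by
  unfold theta
  rw [Derivation.leibniz, smul_eq_mul, smul_eq_mul]
  ring

theorem theta_add (f g : PowerSeries ℂ) : theta (f + g) = theta f + theta g := by
  unfold theta
  rw [map_add, mul_add]

theorem theta_X_pow (k : ℕ) :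
    theta (PowerSeries.X ^ k) = k * (PowerSeries.X : PowerSeries ℂ) ^ k := by
  ext i
  rw [coeff_theta, ← map_natCast (PowerSeries.C (R := ℂ)), PowerSeries.coeff_C_mul,
    PowerSeries.coeff_X_pow]
  split_ifs with h <;> simp [h]

/-! ### Order-by-order solution of weighted eigenvalue problems -/

section Perturbation

open PowerSeries

variable {ι : Type*} [Fintype ι]

/-- The residual of a formal eigenvalue problem. -/
def residual (B : Matrix ι ι ℂ⟦X⟧) (ε : ι → Prop) [DecidablePred ε] (d : ι → ℂ) (κ : ℂ) (N : ℕ)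
    (w : ι → ℂ⟦X⟧) (Q : ℂ⟦X⟧) (p : ι) : ℂ⟦X⟧ :=
  ∑ q, B p q * w q + C κ * X ^ (if ε p then N - 1 else N) * (theta (w p) + C (d p) * w p) -
    X ^ (if ε p then 0 else 1) * (Q * w p)

theorem coeff_mul_congr {f g f' g' : ℂ⟦X⟧} {k : ℕ} (hf : ∀ i ≤ k, coeff i f = coeff i f')
    (hg : ∀ i ≤ k, coeff i g = coeff i g') : ∀ i ≤ k, coeff i (f * g) = coeff i (f' * g') := by
  intro i hi
  rw [coeff_mul, coeff_mul]
  refine Finset.sum_congr rfl fun a ha => ?_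
  have := Finset.HasAntidiagonal.mem_antidiagonal.mp ha
  rw [hf _ (by omega), hg _ (by omega)]

theorem residual_congr (B : Matrix ι ι ℂ⟦X⟧) (ε : ι → Prop) [DecidablePred ε] (d : ι → ℂ) (κ : ℂ)
    (N : ℕ) {w w' : ι → ℂ⟦X⟧} {Q Q' : ℂ⟦X⟧} {k : ℕ}
    (hw : ∀ p, ∀ i ≤ k, coeff i (w p) = coeff i (w' p)) (hQ : ∀ i ≤ k, coeff i Q = coeff i Q')
    (p : ι) : coeff k (residual B ε d κ N w Q p) = coeff k (residual B ε d κ N w' Q' p) := by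
  unfold residual
  rw [map_sub, map_add, map_sum, map_sub, map_add, map_sum]
  congr 1
  · congr 1
    · exact Finset.sum_congr rfl fun q _ => coeff_mul_congr (fun _ _ => rfl) (hw q) k le_rfl
    · refine coeff_mul_congr (fun _ _ => rfl) (fun i hi => ?_) k le_rfl
      rw [map_add, map_add, coeff_theta, coeff_theta, coeff_C_mul, coeff_C_mul, hw p i hi]
  · exact coeff_mul_congr (fun _ _ => rfl) (coeff_mul_congr hQ (hw p)) k le_rfl

/-- The rows in `ε` are those whose row weight exceeds their column weight by one; after division by
the row weight, Q appears there without a factor X and the derivation with X^(N-1). Hence a change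
of the k-th coefficients affects order k through constant terms only, and the derivation contributes
only if N = 1. The product of the two increments has order 2k, so it is invisible because k ≥ 1. -/
theorem residual_add_monomial (B : Matrix ι ι ℂ⟦X⟧) (ε : ι → Prop) [DecidablePred ε] (d : ι → ℂ)
    (κ : ℂ) {N : ℕ} (hN : 1 ≤ N) (w : ι → ℂ⟦X⟧) (Q : ℂ⟦X⟧) {k : ℕ} (hk : 1 ≤ k) (a : ι → ℂ)
    (b : ℂ) (p : ι) :
    coeff k (residual B ε d κ N (fun q => w q + C (a q) * X ^ k) (Q + C b * X ^ k) p) =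
      coeff k (residual B ε d κ N w Q p) + (∑ q, constantCoeff (B p q) * a q +
        (if N = 1 ∧ ε p then κ * ((k + d p) * a p) else 0) -
        if ε p then constantCoeff Q * a p + b * constantCoeff (w p) else 0) := by
  have hcX : ∀ (f : ℂ⟦X⟧) (c : ℂ), coeff k (f * (C c * X ^ k)) = constantCoeff f * c := by
    intro f c
    rw [← mul_assoc, coeff_mul_X_pow', if_pos le_rfl, Nat.sub_self, coeff_zero_eq_constantCoeff,
      map_mul, constantCoeff_C]
  have hth : theta (w p + C (a p) * X ^ k) + C (d p) * (w p + C (a p) * X ^ k) =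
      (theta (w p) + C (d p) * w p) + C ((k + d p) * a p) * X ^ k := by
    rw [theta_add, theta_mul, theta_X_pow]
    have : theta (C (a p)) = 0 := by simp [theta]
    rw [this]
    simp only [map_mul, map_add, map_natCast]
    ring
  have hQ : X ^ (if ε p then 0 else 1) * ((Q + C b * X ^ k) * (w p + C (a p) * X ^ k)) =
      X ^ (if ε p then 0 else 1) * (Q * w p) +
        ((X ^ (if ε p then 0 else 1) * Q) * (C (a p) * X ^ k) +
        (X ^ (if ε p then 0 else 1) * w p) * (C b * X ^ k) +
        (X ^ (if ε p then 0 else 1) * C b * X ^ k) * (C (a p) * X ^ k)) := by ring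
  have hk0 : (0 : ℂ) ^ k = 0 := zero_pow (by omega)
  have e1 : constantCoeff (C κ * X ^ (if ε p then N - 1 else N)) * ((↑k + d p) * a p) =
      if N = 1 ∧ ε p then κ * ((k + d p) * a p) else 0 := by
    by_cases hε : ε p
    · by_cases h1 : N = 1
      · simp [h1, hε]
      · simp [hε, h1, show N - 1 ≠ 0 by omega]
    · simp [hε, show N ≠ 0 by omega]
  have e2 : constantCoeff (X ^ (if ε p then 0 else 1) * Q) * a p +
      constantCoeff (X ^ (if ε p then 0 else 1) * w p) * b +
      constantCoeff (X ^ (if ε p then 0 else 1) * C b * X ^ k) * a p =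
      if ε p then constantCoeff Q * a p + b * constantCoeff (w p) else 0 := by
    by_cases hε : ε p
    · simp [hε, hk0, mul_comm b]
    · simp [hε]
  have e3 : C κ * X ^ (if ε p then N - 1 else N) * ((theta (w p) + C (d p) * w p) +
      C ((k + d p) * a p) * X ^ k) = C κ * X ^ (if ε p then N - 1 else N) *
      (theta (w p) + C (d p) * w p) +
      (C κ * X ^ (if ε p then N - 1 else N)) * (C ((k + d p) * a p) * X ^ k) := by ring
  have e4 : ∑ q, B p q * (w q + C (a q) * X ^ k) =
      ∑ q, B p q * w q + ∑ q, B p q * (C (a q) * X ^ k) := by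
    rw [← Finset.sum_add_distrib]
    exact Finset.sum_congr rfl fun q _ => mul_add _ _ _
  unfold residual
  rw [hth, hQ, e3, e4, ← e1, ← e2]
  simp only [map_add, map_sub, map_sum, hcX]
  ring

/-- `h0` is the equation of order 0, and `hsurj` is the solvability of the linearized equation that
each later order imposes on the next coefficients of the vector and of the eigenvalue. -/
theorem exists_formal_eigenvector (B : Matrix ι ι ℂ⟦X⟧) (ε : ι → Prop) [DecidablePred ε]
    (d : ι → ℂ) (κ : ℂ) {N : ℕ} (hN : 1 ≤ N) (w₀ : ι → ℂ) (μ : ℂ)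
    (h0 : ∀ p, ∑ q, constantCoeff (B p q) * w₀ q +
      (if N = 1 ∧ ε p then κ * (d p * w₀ p) else 0) = if ε p then μ * w₀ p else 0)
    (hsurj : ∀ k : ℕ, 1 ≤ k → ∀ R : ι → ℂ, ∃ (a : ι → ℂ) (b : ℂ), ∀ p,
      ∑ q, constantCoeff (B p q) * a q + (if N = 1 ∧ ε p then κ * ((k + d p) * a p) else 0) -
        (if ε p then μ * a p + b * w₀ p else 0) = R p) :
    ∃ (w : ι → ℂ⟦X⟧) (Q : ℂ⟦X⟧), (∀ p, constantCoeff (w p) = w₀ p) ∧ constantCoeff Q = μ ∧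
      ∀ p, residual B ε d κ N w Q p = 0 := by
  classical
  let wS : (ℕ → (ι → ℂ) × ℂ) → ι → ℂ⟦X⟧ := fun ω p => mk fun k => (ω k).1 p
  let QS : (ℕ → (ι → ℂ) × ℂ) → ℂ⟦X⟧ := fun ω => mk fun k => (ω k).2
  obtain ⟨ω, hω⟩ := exists_seq_of_step
    (fun k ω => (k = 0 → ω 0 = (w₀, μ)) ∧ ∀ p, coeff k (residual B ε d κ N (wS ω) (QS ω) p) = 0)
    (by
      rintro k ω ω' h ⟨h1, h2⟩
      refine ⟨fun hk => by rw [← h 0 (by omega)]; exact h1 hk, fun p => ?_⟩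
      rw [← h2 p]
      exact residual_congr B ε d κ N (fun p i hi => by simp [wS, h i hi])
        (fun i hi => by simp [QS, h i hi]) p)
    (by
      intro k ω h
      rcases Nat.eq_zero_or_pos k with rfl | hk
      · refine ⟨(w₀, μ), fun _ => by simp, fun p => ?_⟩
        have := h0 p
        unfold residual
        rw [coeff_zero_eq_constantCoeff]
        have hc : ∀ q, constantCoeff (wS (Function.update ω 0 (w₀, μ)) q) = w₀ q := fun q => by
          rw [← coeff_zero_eq_constantCoeff]; simp [wS]
        have hQ : constantCoeff (QS (Function.update ω 0 (w₀, μ))) = μ := by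
          rw [← coeff_zero_eq_constantCoeff]; simp [QS]
        have hth : ∀ f, constantCoeff (theta f) = 0 := fun f => by
          rw [← coeff_zero_eq_constantCoeff, coeff_theta]; simp
        simp only [map_sub, map_add, map_sum, map_mul, map_pow, hc, hQ, hth, constantCoeff_X,
          constantCoeff_C, zero_add]
        by_cases hε : ε p
        · by_cases h1 : N = 1
          · simp [hε, h1] at this ⊢
            rw [this]; ring
          · simp [hε, h1, show N - 1 ≠ 0 by omega] at this ⊢
            rw [this]; ring
        · simp [hε, show N ≠ 0 by omega] at this ⊢
          exact this
      · obtain ⟨a, b, hab⟩ := hsurj k hk fun p =>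
          -coeff k (residual B ε d κ N (wS (Function.update ω k 0)) (QS (Function.update ω k 0)) p)
        refine ⟨(a, b), fun h => by omega, fun p => ?_⟩
        have h00 := (h 0 hk).1 rfl
        have e1 : wS (Function.update ω k (a, b)) =
            fun q => wS (Function.update ω k 0) q + C (a q) * X ^ k := by
          funext q
          ext i
          simp only [wS, coeff_mk, map_add, coeff_C_mul, coeff_X_pow]
          by_cases hi : i = k
          · subst hi; simp
          · simp [hi]
        have e2 : QS (Function.update ω k (a, b)) =
            QS (Function.update ω k 0) + C b * X ^ k := by
          ext i
          simp only [QS, coeff_mk, map_add, coeff_C_mul, coeff_X_pow]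
          by_cases hi : i = k
          · subst hi; simp
          · simp [hi]
        have e3 : ∀ p, constantCoeff (wS (Function.update ω k 0) p) = w₀ p := fun p => by
          rw [← coeff_zero_eq_constantCoeff]
          simp [wS, Function.update_of_ne (show 0 ≠ k by omega), h00]
        have e4 : constantCoeff (QS (Function.update ω k 0)) = μ := by
          rw [← coeff_zero_eq_constantCoeff]
          simp [QS, Function.update_of_ne (show 0 ≠ k by omega), h00]
        rw [e1, e2, residual_add_monomial B ε d κ hN _ _ hk, e3, e4, hab p, add_neg_cancel])
  have h00 := (hω 0).1 rfl
  refine ⟨wS ω, QS ω, fun p => ?_, ?_, fun p => ?_⟩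
  · rw [← coeff_zero_eq_constantCoeff]; simp [wS, h00]
  · rw [← coeff_zero_eq_constantCoeff]; simp [QS, h00]
  · ext k
    rw [(hω k).2 p, map_zero]

/-- Morally f = exp ∫ g dX / X. Since g has no constant term, the k-th coefficient of g f involves
only earlier coefficients of f, and division by k determines the next one. -/
theorem exists_theta_eq_mul {g : ℂ⟦X⟧} (hg : constantCoeff g = 0) :
    ∃ f : ℂ⟦X⟧, constantCoeff f = 1 ∧ theta f = g * f := by
  obtain ⟨ω, hω⟩ := exists_seq_of_step
    (fun k (ω : ℕ → ℂ) => (k = 0 → ω 0 = 1) ∧ coeff k (theta (mk ω)) = coeff k (g * mk ω))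
    (by
      rintro k ω ω' h ⟨h1, h2⟩
      refine ⟨fun hk => by rw [← h 0 (by omega)]; exact h1 hk, ?_⟩
      have hc : ∀ i ≤ k, coeff i (mk ω) = coeff i (mk ω') := fun i hi => by
        rw [coeff_mk, coeff_mk, h i hi]
      rw [← coeff_mul_congr (fun _ _ => rfl) hc k le_rfl, ← h2, coeff_theta, coeff_theta,
        hc k le_rfl])
    (by
      intro k ω h
      rcases Nat.eq_zero_or_pos k with rfl | hk
      · exact ⟨1, fun _ => by simp, by simp [coeff_theta, hg]⟩
      · have hk' : (k : ℂ) ≠ 0 := Nat.cast_ne_zero.mpr (by omega)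
        refine ⟨(k : ℂ)⁻¹ * coeff k (g * mk (Function.update ω k 0)), fun h => by omega, ?_⟩
        have e : ∀ a : ℂ, mk (Function.update ω k a) =
            mk (Function.update ω k 0) + C a * X ^ k := fun a => by
          ext i
          simp only [coeff_mk, map_add, coeff_C_mul, coeff_X_pow]
          by_cases hi : i = k
          · subst hi; simp
          · simp [hi]
        have e' : ∀ a : ℂ, coeff k (g * (C a * X ^ k)) = 0 := fun a => by
          rw [← mul_assoc, coeff_mul_X_pow', if_pos le_rfl, Nat.sub_self,
            coeff_zero_eq_constantCoeff, map_mul, hg, zero_mul]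
        rw [coeff_theta, coeff_mk, Function.update_self, mul_inv_cancel_left₀ hk',
          e ((k : ℂ)⁻¹ * _), mul_add, map_add, e', add_zero])
  refine ⟨mk ω, ?_, ?_⟩
  · rw [← coeff_zero_eq_constantCoeff, coeff_mk, (hω 0).1 rfl]
  · ext k
    exact (hω k).2

/-- Rescaling a formal eigenvector by a scalar series removes the tail of the eigenvalue. -/
theorem exists_truncated_eigenvalue (B : Matrix ι ι ℂ⟦X⟧) {κ : ℂ} (hκ : κ ≠ 0) (N : ℕ)
    (v : ι → ℂ⟦X⟧) (Q : ℂ⟦X⟧)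
    (h : ∀ p, ∑ q, B p q * v q + C κ * X ^ N * theta (v p) = Q * v p) :
    ∃ f : ℂ⟦X⟧, constantCoeff f = 1 ∧ ∀ p, ∑ q, B p q * (f * v q) +
      C κ * X ^ N * theta (f * v p) = (mk fun i => if i ≤ N then coeff i Q else 0) * (f * v p) := by
  -- The part of `Q` of degree above `N`, divided by X^N; degree `N` itself is kept, hence the zero
  -- constant term. A factor f with θ f = -κ⁻¹ g f absorbs this part.
  let g : ℂ⟦X⟧ := mk fun i => if i = 0 then 0 else coeff (N + i) Q
  have hQ : Q = (mk fun i => if i ≤ N then coeff i Q else 0) + X ^ N * g := by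
    ext i
    rw [map_add, coeff_X_pow_mul', coeff_mk, coeff_mk]
    by_cases h1 : i ≤ N
    · by_cases h2 : N ≤ i
      · simp [le_antisymm h1 h2]
      · simp [h1, h2]
    · have h2 : N ≤ i := by omega
      have h3 : i - N ≠ 0 := by omega
      simp [h1, h2, h3]
  obtain ⟨f, hf, hfg⟩ := exists_theta_eq_mul (g := C (-κ⁻¹) * g) (by
    rw [map_mul, ← coeff_zero_eq_constantCoeff_apply g, coeff_mk, if_pos rfl, mul_zero])
  refine ⟨f, hf, fun p => ?_⟩
  have h1 : ∑ q, B p q * (f * v q) = f * ∑ q, B p q * v q := by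
    rw [Finset.mul_sum]; exact Finset.sum_congr rfl fun q _ => by ring
  have h2 : C κ * C (-κ⁻¹) = (-1 : ℂ⟦X⟧) := by
    rw [← map_mul, mul_neg, mul_inv_cancel₀ hκ, map_neg, map_one]
  rw [h1, theta_mul, hfg]
  have h3 := h p
  rw [hQ] at h3
  linear_combination f * h3 + X ^ N * g * f * v p * h2

end Perturbation
end ResonantConnection
end

/-! ### Coefficients of formal series and extended bases -/

noncomputable section

namespace ResonantConnection

namespace FormalSeries

theorem x_ne_zero : x ≠ 0 := by simp [x]

theorem x_zpow (k : ℤ) : x ^ k = HahnSeries.single (-k) (1 : ℂ) := by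
  have hnat : ∀ m : ℕ, x ^ m = HahnSeries.single (-(m : ℤ)) (1 : ℂ) := fun m => by
    unfold x
    rw [HahnSeries.single_pow]
    simp
  obtain ⟨m, rfl | rfl⟩ := k.eq_nat_or_neg
  · rw [zpow_natCast, hnat]
  · rw [zpow_neg, zpow_natCast, hnat, HahnSeries.inv_single]
    simp

theorem xcoeff_zpow_mul (k m : ℤ) (f : FormalSeries) :
    xcoeff (x ^ k * f) m = xcoeff f (m - k) := by
  unfold xcoeff
  rw [x_zpow, show -m = -(m - k) + -k by ring, HahnSeries.coeff_single_mul_add, one_mul]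

theorem xcoeff_x_mul (m : ℤ) (f : FormalSeries) : xcoeff (x * f) m = xcoeff f (m - 1) := by
  simpa using xcoeff_zpow_mul 1 m f

theorem xcoeff_sub (f g : FormalSeries) (k : ℤ) :
    xcoeff (f - g) k = xcoeff f k - xcoeff g k := rfl

theorem xcoeff_zero (k : ℤ) : xcoeff 0 k = 0 := rfl

theorem xcoeff_sum {ι : Type*} (s : Finset ι) (f : ι → FormalSeries) (k : ℤ) :
    xcoeff (∑ i ∈ s, f i) k = ∑ i ∈ s, xcoeff (f i) k :=
  HahnSeries.coeff_sum ..

theorem xcoeff_C_mul (c : ℂ) (f : FormalSeries) (k : ℤ) :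
    xcoeff (HahnSeries.C c * f) k = c * xcoeff f k := by
  unfold xcoeff
  rw [HahnSeries.C_mul_eq_smul]
  rfl

theorem natCast_eq_C (m : ℕ) : (m : FormalSeries) = HahnSeries.C (m : ℂ) := by
  rw [map_natCast]

theorem natCast_ne_zero {m : ℕ} (hm : m ≠ 0) : (m : FormalSeries) ≠ 0 := by
  rw [natCast_eq_C]
  exact HahnSeries.C_ne_zero (Nat.cast_ne_zero.mpr hm)

theorem xcoeff_natCast_mul (c : ℕ) (f : FormalSeries) (k : ℤ) :
    xcoeff ((c : FormalSeries) * f) k = c * xcoeff f k := by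
  rw [natCast_eq_C, xcoeff_C_mul]

theorem xcoeff_x_mul_ddx (f : FormalSeries) (k : ℤ) :
    xcoeff (x * ddx f) k = k * xcoeff f k := by
  rw [xcoeff_x_mul, xcoeff_ddx]
  simp

end FormalSeries

open FormalSeries

/-! ### The shift as translation of an extended basis -/

section Extension

variable {m : ℕ}

/-- The residue of an integer modulo `m`. -/
def residue (hm : 1 ≤ m) (β : ℤ) : Fin m :=
  ⟨(β % m).toNat, by have := Int.emod_lt_of_pos β (b := m) (by omega); omega⟩

theorem residue_natCast (hm : 1 ≤ m) (b : Fin m) : residue hm (b : ℕ) = b := by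
  ext
  simp only [residue]
  rw [Int.emod_eq_of_lt (by omega) (by have := b.2; omega), Int.toNat_natCast]

theorem residue_add_mul (hm : 1 ≤ m) (β l : ℤ) : residue hm (β + m * l) = residue hm β := by
  ext
  simp [residue]

theorem residue_add_ediv (hm : 1 ≤ m) (β : ℤ) : ((residue hm β : ℕ) : ℤ) + m * (β / m) = β := by
  have h1 := Int.emod_nonneg β (b := m) (by omega)
  have h2 := Int.emod_add_mul_ediv β m
  simp only [residue]
  rw [Int.toNat_of_nonneg h1]
  exact h2

/-- The basis vector `e_b`, `0 ≤ b < m`, being extended by `e_{b + m} = x e_b`, the image of `e_β`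
under the linear form `y`. -/
def colExt (hm : 1 ≤ m) (y : Fin m → FormalSeries) (β : ℤ) : FormalSeries :=
  x ^ (β / m) * y (residue hm β)

/-- The coefficient of the vector `y` with respect to `e_α`, extended as in `colExt`. -/
def rowExt (hm : 1 ≤ m) (y : Fin m → FormalSeries) (α : ℤ) : FormalSeries :=
  x ^ (-(α / m)) * y (residue hm α)

theorem colExt_add_mul (hm : 1 ≤ m) (y : Fin m → FormalSeries) (β l : ℤ) :
    colExt hm y (β + m * l) = x ^ l * colExt hm y β := by
  unfold colExt
  rw [residue_add_mul, Int.add_mul_ediv_left _ _ (by omega), zpow_add₀ x_ne_zero]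
  ring

theorem rowExt_add_mul (hm : 1 ≤ m) (y : Fin m → FormalSeries) (α l : ℤ) :
    rowExt hm y (α + m * l) = x ^ (-l) * rowExt hm y α := by
  unfold rowExt
  rw [residue_add_mul, Int.add_mul_ediv_left _ _ (by omega), neg_add, zpow_add₀ x_ne_zero]
  ring

theorem colExt_natCast (hm : 1 ≤ m) (y : Fin m → FormalSeries) (b : Fin m) :
    colExt hm y (b : ℕ) = y b := by
  unfold colExt
  rw [residue_natCast, Int.ediv_eq_zero_of_lt (by omega) (by have := b.2; omega), zpow_zero,
    one_mul]

theorem rowExt_natCast (hm : 1 ≤ m) (y : Fin m → FormalSeries) (a : Fin m) :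
    rowExt hm y (a : ℕ) = y a := by
  unfold rowExt
  rw [residue_natCast, Int.ediv_eq_zero_of_lt (by omega) (by have := a.2; omega), neg_zero,
    zpow_zero, one_mul]

/-- In the extended basis the shift sends e_β to e_(β+1) without exception: the corner entry x is
the relation e_m = x e_0. -/
theorem vecMul_shiftMatrix (hm : 1 ≤ m) (y : Fin m → FormalSeries) (b : Fin m) :
    Matrix.vecMul y (shiftMatrix m x) b = colExt hm y ((b : ℕ) + 1) := by
  rw [Matrix.vecMul, dotProduct]
  by_cases hb : (b : ℕ) + 1 < m
  · have h1 := colExt_natCast hm y ⟨b + 1, hb⟩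
    push_cast at h1
    rw [h1, Finset.sum_eq_single ⟨b + 1, hb⟩]
    · simp [shiftMatrix]
    · intro a _ ha
      have h2 : (a : ℕ) ≠ b + 1 := fun h => ha (Fin.ext h)
      simp [shiftMatrix, h2, show (b : ℕ) + 1 ≠ m by omega]
    · simp
  · have hb' : (b : ℕ) + 1 = m := by have := b.2; omega
    have h0 := colExt_natCast hm y ⟨0, hm⟩
    have h1 := colExt_add_mul hm y 0 1
    simp only [Nat.cast_zero] at h0
    rw [zero_add, mul_one, zpow_one, h0] at h1
    rw [show ((b : ℕ) : ℤ) + 1 = m by exact_mod_cast hb', h1, Finset.sum_eq_single ⟨0, hm⟩]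
    · simp [shiftMatrix, hb', mul_comm, show 0 ≠ m by omega]
    · intro a _ ha
      have h2 : (a : ℕ) ≠ 0 := fun h => ha (Fin.ext h)
      have := a.2
      simp [shiftMatrix, h2, show (a : ℕ) ≠ b + 1 by omega]
    · simp

theorem shiftMatrix_mulVec (hm : 1 ≤ m) (y : Fin m → FormalSeries) (a : Fin m) :
    Matrix.mulVec (shiftMatrix m x) y a = rowExt hm y ((a : ℕ) - 1) := by
  rw [Matrix.mulVec, dotProduct]
  have ham := a.2
  by_cases ha : (a : ℕ) = 0
  · have h1 := rowExt_natCast hm y ⟨m - 1, by omega⟩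
    have h2 := rowExt_add_mul hm y ((m - 1 : ℕ) : ℤ) (-1)
    rw [neg_neg, zpow_one] at h2
    simp only at h1
    rw [h1] at h2
    rw [show ((a : ℕ) : ℤ) - 1 = ((m - 1 : ℕ) : ℤ) + m * (-1) by push_cast [hm]; omega, h2,
      Finset.sum_eq_single ⟨m - 1, by omega⟩]
    · simp [shiftMatrix, ha, show m - 1 + 1 = m by omega, show 0 ≠ m by omega]
    · intro b _ hb
      have h2 : (b : ℕ) ≠ m - 1 := fun h => hb (Fin.ext h)
      simp [shiftMatrix, ha, show (b : ℕ) + 1 ≠ m by omega]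
    · simp
  · have h1 := rowExt_natCast hm y ⟨a - 1, by omega⟩
    simp only at h1
    rw [show ((a : ℕ) : ℤ) - 1 = ((a - 1 : ℕ) : ℤ) by omega, h1,
      Finset.sum_eq_single ⟨a - 1, by omega⟩]
    · simp [shiftMatrix, show (a : ℕ) - 1 + 1 = a by omega]
    · intro b _ hb
      have h2 : (b : ℕ) ≠ a - 1 := fun h => hb (Fin.ext h)
      simp [shiftMatrix, ha, show (a : ℕ) ≠ b + 1 by omega]
    · simp

theorem colExt_vecMul_shiftMatrix_pow (hm : 1 ≤ m) (y : Fin m → FormalSeries) (J : ℕ) (β : ℤ) :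
    colExt hm (Matrix.vecMul y (shiftMatrix m x ^ J)) β = colExt hm y (β + J) := by
  induction J generalizing β with
  | zero => simp
  | succ J ih =>
    rw [pow_succ, ← Matrix.vecMul_vecMul]
    conv_lhs => rw [colExt, vecMul_shiftMatrix hm, ← colExt_add_mul, ih]
    congr 1
    have := residue_add_ediv hm β
    push_cast
    linarith

theorem rowExt_shiftMatrix_pow_mulVec (hm : 1 ≤ m) (y : Fin m → FormalSeries) (J : ℕ) (α : ℤ) :
    rowExt hm (Matrix.mulVec (shiftMatrix m x ^ J) y) α = rowExt hm y (α - J) := by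
  induction J generalizing α with
  | zero => simp
  | succ J ih =>
    rw [pow_succ', ← Matrix.mulVec_mulVec]
    conv_lhs => rw [rowExt, shiftMatrix_mulVec hm, ← rowExt_add_mul, ih]
    congr 1
    have := residue_add_ediv hm α
    push_cast
    linarith

theorem vecMul_normalBlock (hm : 1 ≤ m) (r : ℕ) (t : ℕ → ℂ) (y : Fin m → FormalSeries)
    (b : Fin m) :
    (m : FormalSeries) * x * Matrix.vecMul y (normalBlock r m t) b =
      ∑ J ∈ Finset.range (r * m + 1), HahnSeries.C (t J) * colExt hm y ((b : ℕ) + (J : ℕ))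
        - (b : ℕ) * y b := by
  have hmx : (m : FormalSeries) * x ≠ 0 :=
    mul_ne_zero (natCast_ne_zero (by omega)) x_ne_zero
  rw [normalBlock, Matrix.vecMul_smul, Pi.smul_apply, smul_eq_mul, mul_inv_cancel_left₀ hmx,
    Matrix.vecMul_sub, Pi.sub_apply]
  congr 1
  · rw [Matrix.vecMul_sum, Finset.sum_apply]
    refine Finset.sum_congr rfl fun J _ => ?_
    rw [Matrix.vecMul_smul, Pi.smul_apply, smul_eq_mul, ← colExt_vecMul_shiftMatrix_pow,
      colExt_natCast]
  · rw [Matrix.vecMul_diagonal, mul_comm]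

theorem normalBlock_mulVec (hm : 1 ≤ m) (r : ℕ) (t : ℕ → ℂ) (y : Fin m → FormalSeries)
    (a : Fin m) :
    (m : FormalSeries) * x * Matrix.mulVec (normalBlock r m t) y a =
      ∑ J ∈ Finset.range (r * m + 1), HahnSeries.C (t J) * rowExt hm y ((a : ℕ) - (J : ℕ))
        - (a : ℕ) * y a := by
  have hmx : (m : FormalSeries) * x ≠ 0 :=
    mul_ne_zero (natCast_ne_zero (by omega)) x_ne_zero
  rw [normalBlock, Matrix.smul_mulVec, Pi.smul_apply, smul_eq_mul, mul_inv_cancel_left₀ hmx,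
    Matrix.sub_mulVec, Pi.sub_apply]
  congr 1
  · rw [Matrix.sum_mulVec, Finset.sum_apply]
    refine Finset.sum_congr rfl fun J _ => ?_
    rw [Matrix.smul_mulVec, Pi.smul_apply, smul_eq_mul, ← rowExt_shiftMatrix_pow_mulVec,
      rowExt_natCast]
  · rw [Matrix.mulVec_diagonal]

end Extension

end ResonantConnection
end

/-! ### Intertwiners of normal blocks -/

noncomputable section

namespace ResonantConnection

/-- The coefficients of an intertwiner `W` of two normal blocks of sizes `m` and `l`, with respect
to the extended bases `e_α`: `W e_β = ∑ F α β e_α`. -/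
structure IsIntertwiner (r m l : ℕ) (t t' : ℕ → ℂ) (F : ℤ → ℤ → ℂ) : Prop where
  periodic : ∀ α β, F (α + m) (β + l) = F α β
  bounded : ∃ K : ℤ, ∀ α β, K < α * l - β * m → F α β = 0
  eqn : ∀ α β, l * ∑ J ∈ Finset.range (r * m + 1), t J * F (α - J) β -
    m * ∑ J ∈ Finset.range (r * l + 1), t' J * F α (β + J) = (α * l - β * m) * F α β

namespace IsIntertwiner

variable {r m l : ℕ} {t t' : ℕ → ℂ} {F : ℤ → ℤ → ℂ}

theorem periodic_mul (h : IsIntertwiner r m l t t' F) (α β : ℤ) (k : ℕ) :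
    F (α + m * k) (β + l * k) = F α β := by
  induction k with
  | zero => simp
  | succ k ih =>
    rw [← ih, ← h.periodic (α + m * k)]
    push_cast
    congr 1 <;> ring

/-- A nonzero coefficient of maximal weight. -/
theorem exists_leading (h : IsIntertwiner r m l t t' F) (hF : ∃ α β, F α β ≠ 0) :
    ∃ α β, F α β ≠ 0 ∧ ∀ α' β', α * l - β * m < α' * l - β' * m → F α' β' = 0 := by
  obtain ⟨K, hK⟩ := h.bounded
  obtain ⟨w, ⟨α, β, hαβ, hw⟩, hmax⟩ := Int.exists_greatest_of_bdd
    (P := fun w => ∃ α β, F α β ≠ 0 ∧ α * l - β * m = w)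
    ⟨K, by
      rintro w ⟨α, β, h1, rfl⟩
      by_contra h2
      exact h1 (hK α β (by omega))⟩
    (by obtain ⟨α, β, h1⟩ := hF; exact ⟨_, α, β, h1, rfl⟩)
  refine ⟨α, β, hαβ, fun α' β' h' => ?_⟩
  by_contra h2
  have := hmax _ ⟨α', β', h2, rfl⟩
  omega

/-- At a weight r m l above the leading one, only the top terms of the two sums reach a nonzero
coefficient. By periodicity they reach the same one. -/
theorem eigenvalue_eq (h : IsIntertwiner r m l t t' F) (hr : 1 ≤ r) (hm : 1 ≤ m) (hl : 1 ≤ l)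
    {a a' : ℂ} (ht : t (r * m) = m * a) (ht' : t' (r * l) = l * a') (hF : ∃ α β, F α β ≠ 0) :
    a = a' := by
  obtain ⟨α, β, h0, hmax⟩ := h.exists_leading hF
  have hpos : (0 : ℤ) < r * m * l := by positivity
  have e := h.eqn (α + r * m) β
  rw [Finset.sum_eq_single (r * m), Finset.sum_eq_single (r * l),
    hmax (α + r * m) β (by linarith [hpos])] at e
  · have p := h.periodic_mul α β r
    rw [show α + (r : ℤ) * m = α + m * r by ring, show β + ((r * l : ℕ) : ℤ) = β + l * r by
      push_cast; ring, p, ht, ht',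
      show α + (m : ℤ) * r - ((r * m : ℕ) : ℤ) = α by push_cast; ring] at e
    have hm' : (m : ℂ) ≠ 0 := Nat.cast_ne_zero.mpr (by omega)
    have hl' : (l : ℂ) ≠ 0 := Nat.cast_ne_zero.mpr (by omega)
    have : (m : ℂ) * l * F α β * (a - a') = 0 := by linear_combination e
    exact sub_eq_zero.mp ((mul_eq_zero.mp this).resolve_left
      (mul_ne_zero (mul_ne_zero hm' hl') h0))
  · intro J hJ hne
    have : (J : ℤ) < r * l := by
      have := Finset.mem_range.mp hJ
      have : J < r * l := by omega
      exact_mod_cast this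
    rw [hmax _ _ (by nlinarith), mul_zero]
  · intro hc
    exact absurd (Finset.mem_range.mpr (by omega)) hc
  · intro J hJ hne
    have : (J : ℤ) < r * m := by
      have := Finset.mem_range.mp hJ
      have : J < r * m := by omega
      exact_mod_cast this
    rw [hmax _ _ (by nlinarith), mul_zero]
  · intro hc
    exact absurd (Finset.mem_range.mpr (by omega)) hc

/-- The equation without its leading terms, which cancel. -/
theorem eqn_of_eigenvalue_eq (h : IsIntertwiner r m l t t' F) {a : ℂ} (ht : t (r * m) = m * a)
    (ht' : t' (r * l) = l * a) (α β : ℤ) :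
    l * ∑ J ∈ Finset.range (r * m), t J * F (α - J) β -
      m * ∑ J ∈ Finset.range (r * l), t' J * F α (β + J) = (α * l - β * m) * F α β := by
  have e := h.eqn α β
  have p := h.periodic_mul (α - m * r) β r
  rw [sub_add_cancel] at p
  rw [Finset.sum_range_succ, Finset.sum_range_succ, ht, ht',
    show β + ((r * l : ℕ) : ℤ) = β + l * r by push_cast; ring, p,
    show α - ((r * m : ℕ) : ℤ) = α - m * r by push_cast; ring] at e
  linear_combination e

/-- Once the leading terms cancel, the next term of the block of size m lies 1/m below the top in
powers of x. If l < m this precedes the corresponding drop 1/l, so it cannot be balanced by the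
other block. -/
theorem not_lt_of_ne_zero (h : IsIntertwiner r m l t t' F) (hr : 1 ≤ r) (hl : 1 ≤ l) {a : ℂ}
    (ht : t (r * m) = m * a) (ht' : t' (r * l) = l * a) (h1 : t (r * m - 1) ≠ 0)
    (hF : ∃ α β, F α β ≠ 0) : ¬ l < m := by
  intro hlm
  obtain ⟨α, β, h0, hmax⟩ := h.exists_leading hF
  -- At this index the first sum meets the leading coefficient only for J = rm - 1. Terms of the
  -- second sum have weight at least m - l above the leading weight and vanish.
  have e := h.eqn_of_eigenvalue_eq ht ht' (α + (r * m - 1 : ℕ)) β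
  have hrm : 1 < r * m := by nlinarith
  have hlt : ((r * m - 1 : ℕ) : ℤ) = r * m - 1 := by push_cast [show 1 ≤ r * m by omega]; ring
  have hrm' : (1 : ℤ) < r * m := by exact_mod_cast hrm
  have hl' : (1 : ℤ) ≤ l := by exact_mod_cast hl
  have hlm' : (l : ℤ) < m := by exact_mod_cast hlm
  rw [Finset.sum_eq_single (r * m - 1), Finset.sum_eq_zero, hmax (α + _) β,
    add_sub_cancel_right] at e
  · have hl'' : (l : ℂ) ≠ 0 := Nat.cast_ne_zero.mpr (by omega)
    have : (l : ℂ) * (t (r * m - 1) * F α β) = 0 := by linear_combination e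
    simp [hl'', h1, h0] at this
  · rw [hlt]
    nlinarith
  · intro J hJ
    have hJ' : (J : ℤ) < r * l := by exact_mod_cast Finset.mem_range.mp hJ
    rw [hmax _ _ (by rw [hlt]; nlinarith), mul_zero]
  · intro J hJ hne
    have := Finset.mem_range.mp hJ
    have hJ' : (J : ℤ) < ((r * m - 1 : ℕ) : ℤ) := by
      have : J < r * m - 1 := by omega
      exact_mod_cast this
    rw [hmax _ _ (by nlinarith), mul_zero]
  · intro hc
    exact absurd (Finset.mem_range.mpr (by omega)) hc

theorem not_gt_of_ne_zero (h : IsIntertwiner r m l t t' F) (hr : 1 ≤ r) (hm : 1 ≤ m) {a : ℂ}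
    (ht : t (r * m) = m * a) (ht' : t' (r * l) = l * a) (h1 : t' (r * l - 1) ≠ 0)
    (hF : ∃ α β, F α β ≠ 0) : ¬ m < l := by
  intro hlm
  obtain ⟨α, β, h0, hmax⟩ := h.exists_leading hF
  have e := h.eqn_of_eigenvalue_eq ht ht' α (β - (r * l - 1 : ℕ))
  have hrm : 1 < r * l := by nlinarith
  have hlt : ((r * l - 1 : ℕ) : ℤ) = r * l - 1 := by push_cast [show 1 ≤ r * l by omega]; ring
  have hrm' : (1 : ℤ) < r * l := by exact_mod_cast hrm
  have hl' : (1 : ℤ) ≤ m := by exact_mod_cast hm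
  have hlm' : (m : ℤ) < l := by exact_mod_cast hlm
  rw [Finset.sum_eq_zero, Finset.sum_eq_single (r * l - 1), hmax α (β - _),
    sub_add_cancel] at e
  · have hl'' : (m : ℂ) ≠ 0 := Nat.cast_ne_zero.mpr (by omega)
    have : (m : ℂ) * (t' (r * l - 1) * F α β) = 0 := by linear_combination -e
    simp [hl'', h1, h0] at this
  · rw [hlt]
    nlinarith
  · intro J hJ hne
    have := Finset.mem_range.mp hJ
    have hJ' : (J : ℤ) < ((r * l - 1 : ℕ) : ℤ) := by
      have : J < r * l - 1 := by omega
      exact_mod_cast this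
    rw [hmax _ _ (by nlinarith), mul_zero]
  · intro hc
    exact absurd (Finset.mem_range.mpr (by omega)) hc
  · intro J hJ
    have hJ' : (J : ℤ) < r * m := by exact_mod_cast Finset.mem_range.mp hJ
    rw [hmax _ _ (by rw [hlt]; nlinarith), mul_zero]

/-- Twisted differences of intertwiners of blocks of the same size are intertwiners. -/
theorem sub_shift (h : IsIntertwiner r m m t t' F) (ζ : ℂ) :
    IsIntertwiner r m m t t' fun α β => F α β - ζ * F (α - 1) (β - 1) where
  periodic α β := by
    rw [h.periodic, show α + (m : ℤ) - 1 = α - 1 + m by ring,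
      show β + (m : ℤ) - 1 = β - 1 + m by ring, h.periodic]
  bounded := by
    obtain ⟨K, hK⟩ := h.bounded
    refine ⟨K, fun α β h' => ?_⟩
    rw [hK α β h', hK (α - 1) (β - 1) (by linarith), mul_zero, sub_zero]
  eqn α β := by
    have e1 := h.eqn α β
    have e2 := h.eqn (α - 1) (β - 1)
    have s1 : ∑ J ∈ Finset.range (r * m + 1),
        t J * (F (α - J) β - ζ * F (α - J - 1) (β - 1)) =
        ∑ J ∈ Finset.range (r * m + 1), t J * F (α - J) β -
          ζ * ∑ J ∈ Finset.range (r * m + 1), t J * F (α - 1 - J) (β - 1) := by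
      rw [Finset.mul_sum, ← Finset.sum_sub_distrib]
      refine Finset.sum_congr rfl fun J _ => ?_
      rw [sub_right_comm]
      ring
    have s2 : ∑ J ∈ Finset.range (r * m + 1),
        t' J * (F α (β + J) - ζ * F (α - 1) (β + J - 1)) =
        ∑ J ∈ Finset.range (r * m + 1), t' J * F α (β + J) -
          ζ * ∑ J ∈ Finset.range (r * m + 1), t' J * F (α - 1) (β - 1 + J) := by
      rw [Finset.mul_sum, ← Finset.sum_sub_distrib]
      refine Finset.sum_congr rfl fun J _ => ?_
      rw [add_sub_right_comm]
      ring
    rw [s1, s2]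
    push_cast at e2
    linear_combination e1 - ζ * e2

/-- The leading diagonal of an intertwiner of blocks of the same size is geometric. -/
theorem leading_diagonal (h : IsIntertwiner r m m t t' F) (hr : 1 ≤ r) (hm : 2 ≤ m) {a : ℂ}
    (ht : t (r * m) = m * a) (ht' : t' (r * m) = m * a) (h1 : t (r * m - 1) ≠ 0) {δ : ℤ}
    (hmax : ∀ α β, δ < α - β → F α β = 0) (α β : ℤ) (hαβ : α - β = δ) :
    F α β = t' (r * m - 1) / t (r * m - 1) * F (α - 1) (β - 1) := by
  have e := h.eqn_of_eigenvalue_eq ht ht' (α + (r * m - 1 : ℕ)) β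
  have hrm : 1 < r * m := by nlinarith
  have hlt : ((r * m - 1 : ℕ) : ℤ) = r * m - 1 := by push_cast [show 1 ≤ r * m by omega]; ring
  have hrm' : (1 : ℤ) < r * m := by exact_mod_cast hrm
  have p := h.periodic_mul (α - 1) (β - 1) r
  have hm' : (m : ℂ) ≠ 0 := Nat.cast_ne_zero.mpr (by omega)
  rw [Finset.sum_eq_single (r * m - 1), Finset.sum_eq_single (r * m - 1),
    hmax (α + (r * m - 1 : ℕ)) β (by rw [hlt]; linarith), add_sub_cancel_right,
    show α + ((r * m - 1 : ℕ) : ℤ) = α - 1 + m * r by rw [hlt]; ring,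
    show β + ((r * m - 1 : ℕ) : ℤ) = β - 1 + m * r by rw [hlt]; ring, p] at e
  · have h2 : (m : ℂ) * (t (r * m - 1) * F α β - t' (r * m - 1) * F (α - 1) (β - 1)) = 0 := by
      linear_combination e
    have h3 := (mul_eq_zero.mp h2).resolve_left hm'
    rw [div_mul_eq_mul_div, eq_div_iff h1]
    linear_combination h3
  · intro J hJ hne
    have := Finset.mem_range.mp hJ
    have hJ' : (J : ℤ) < ((r * m - 1 : ℕ) : ℤ) := by
      have : J < r * m - 1 := by omega
      exact_mod_cast this
    rw [hmax _ _ (by linarith), mul_zero]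
  · intro hc
    exact absurd (Finset.mem_range.mpr (by omega)) hc
  · intro J hJ hne
    have := Finset.mem_range.mp hJ
    have hJ' : (J : ℤ) < ((r * m - 1 : ℕ) : ℤ) := by
      have : J < r * m - 1 := by omega
      exact_mod_cast this
    rw [hmax _ _ (by linarith), mul_zero]
  · intro hc
    exact absurd (Finset.mem_range.mpr (by omega)) hc

theorem exists_leading_diagonal (h : IsIntertwiner r m m t t' F) (hm : 1 ≤ m)
    (hF : ∃ α β, F α β ≠ 0) :
    ∃ α β, F α β ≠ 0 ∧ ∀ α' β', α - β < α' - β' → F α' β' = 0 := by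
  obtain ⟨α, β, h0, hmax⟩ := h.exists_leading hF
  refine ⟨α, β, h0, fun α' β' h' => hmax α' β' ?_⟩
  rw [← sub_mul, ← sub_mul]
  exact mul_lt_mul_of_pos_right h' (by omega)

theorem geometric_iterate {g : ℤ → ℂ} {ζ : ℂ} (hg : ∀ β, g β = ζ * g (β - 1)) (β : ℤ) (k : ℕ) :
    g (β + k) = ζ ^ k * g β := by
  induction k with
  | zero => simp
  | succ k ih =>
    rw [hg, show β + ((k + 1 : ℕ) : ℤ) - 1 = β + k by push_cast; ring, ih]
    ring

/-- The ratio on the leading diagonal is an m-th root of unity by periodicity. If F were not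
geometric throughout, its twisted difference would be a nonzero intertwiner with the same ratio on
its own leading diagonal; along that diagonal F would be a geometric sequence times a nonconstant
affine function, contradicting periodicity. -/
theorem exists_geometric (h : IsIntertwiner r m m t t' F) (hr : 1 ≤ r) (hm : 1 ≤ m) {a : ℂ}
    (ht : t (r * m) = m * a) (ht' : t' (r * m) = m * a) (h1 : 2 ≤ m → t (r * m - 1) ≠ 0)
    (hF : ∃ α β, F α β ≠ 0) :
    ∃ ζ : ℂ, ζ ^ m = 1 ∧ ∀ α β, F α β = ζ * F (α - 1) (β - 1) := by
  -- For blocks of size 1 periodicity is already the claim with ratio 1, so no condition on the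
  -- subleading parameter is needed.
  rcases hm.eq_or_lt with rfl | hm2
  · refine ⟨1, one_pow _, fun α β => ?_⟩
    rw [one_mul, ← h.periodic (α - 1) (β - 1)]
    simp
  replace hm2 : 2 ≤ m := hm2
  set ζ := t' (r * m - 1) / t (r * m - 1) with hζ
  have hζ1 : ζ ^ m = 1 := by
    obtain ⟨α, β, h0, hmax⟩ := h.exists_leading_diagonal hm hF
    have hg := geometric_iterate (g := fun γ => F (γ + (α - β)) γ) (fun γ => by
      have := h.leading_diagonal hr hm2 ht ht' (h1 hm2) hmax (γ + (α - β)) γ (by ring)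
      rw [this]
      congr 2
      ring) β m
    rw [show β + (m : ℤ) + (α - β) = α + m by ring, h.periodic,
      show β + (α - β) = α by ring] at hg
    exact (mul_right_cancel₀ h0 (by rw [one_mul]; exact hg)).symm
  refine ⟨ζ, hζ1, ?_⟩
  by_contra hne
  push Not at hne
  have h2 := h.sub_shift ζ
  have hF2 : ∃ α β, F α β - ζ * F (α - 1) (β - 1) ≠ 0 := by
    obtain ⟨α, β, h3⟩ := hne
    exact ⟨α, β, sub_ne_zero.mpr h3⟩
  obtain ⟨α, β, h0, hmax⟩ := h2.exists_leading_diagonal hm hF2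
  let f : ℤ → ℂ := fun γ => F (γ + (α - β)) γ
  have hg := geometric_iterate (g := fun γ => f γ - ζ * f (γ - 1)) (fun γ => by
    have := h2.leading_diagonal hr hm2 ht ht' (h1 hm2) hmax (γ + (α - β)) γ (by ring)
    simp only [f]
    rw [← hζ] at this
    rw [show γ - 1 + (α - β) = γ + (α - β) - 1 by ring,
      show γ - 1 - 1 + (α - β) = γ + (α - β) - 1 - 1 by ring]
    exact this)
  -- the twisted sum telescopes
  have htel : ∀ k : ℕ, f (β + k - 1) = ζ ^ k * (f (β - 1)) +
      k * ζ ^ (k - 1 : ℕ) * (f β - ζ * f (β - 1)) := by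
    intro k
    induction k with
    | zero => simp
    | succ k ih =>
      have e1 := hg β k
      rw [show β + ((k + 1 : ℕ) : ℤ) - 1 = β + k by push_cast; ring]
      rw [ih] at e1
      rcases Nat.eq_zero_or_pos k with rfl | hk
      · simp
      · obtain ⟨k', rfl⟩ : ∃ k', k = k' + 1 := ⟨k - 1, by omega⟩
        simp only [Nat.add_sub_cancel] at e1 ⊢
        push_cast at e1 ⊢
        linear_combination e1
  have e2 := htel m
  have e3 : f (β + m - 1) = f (β - 1) := by
    simp only [f]
    rw [show β + (m : ℤ) - 1 + (α - β) = β - 1 + (α - β) + m by ring,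
      show β + (m : ℤ) - 1 = β - 1 + m by ring, h.periodic]
  rw [e3, hζ1, one_mul] at e2
  have hm' : (m : ℂ) ≠ 0 := Nat.cast_ne_zero.mpr (by omega)
  have hζ0 : ζ ≠ 0 := by
    rintro h3
    rw [h3, zero_pow (by omega)] at hζ1
    exact zero_ne_one hζ1
  have e4 : (m : ℂ) * ζ ^ (m - 1) * (f β - ζ * f (β - 1)) = 0 := by linear_combination -e2
  have e5 := (mul_eq_zero.mp e4).resolve_left (mul_ne_zero hm' (pow_ne_zero _ hζ0))
  apply h0
  simp only [f] at e5
  rw [show β + (α - β) = α by ring, show β - 1 + (α - β) = α - 1 by ring] at e5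
  exact e5

/-- Intertwiners of normal blocks are monomial. -/
theorem eq_monomial (h : IsIntertwiner r m m t t' F) (hr : 1 ≤ r) (hm : 1 ≤ m) {a : ℂ}
    (ht : t (r * m) = m * a) (ht' : t' (r * m) = m * a) (h1 : 2 ≤ m → t (r * m - 1) ≠ 0)
    (hF : ∃ α β, F α β ≠ 0) :
    ∃ (ζ c : ℂ) (δ : ℤ), ζ ^ m = 1 ∧ c ≠ 0 ∧
      (∀ α (β : ℕ), F α β = if α - β = δ then c * ζ ^ β else 0) ∧
      (∀ J, 1 ≤ J → J ≤ r * m → t J = ζ ^ J * t' J) ∧ t 0 - t' 0 = δ := by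
  obtain ⟨ζ, hζ, hgeo⟩ := h.exists_geometric hr hm ht ht' h1 hF
  have hsh : ∀ α β (k : ℕ), F (α + k) (β + k) = ζ ^ k * F α β := fun α β k => by
    have := geometric_iterate (g := fun γ => F (γ + (α - β)) γ) (fun γ => by
      rw [hgeo (γ + (α - β)) γ]
      congr 2
      ring) β k
    rwa [show β + (k : ℤ) + (α - β) = α + k by ring, show β + (α - β) = α by ring] at this
  have hF0 : ∀ α (β : ℕ), F α β = ζ ^ β * F (α - β) 0 := fun α β => by
    rw [← hsh]
    congr 1 <;> ring
  obtain ⟨α₀, β₀, h0, hmax⟩ := h.exists_leading_diagonal hm hF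
  have hD : F (α₀ - β₀) 0 ≠ 0 := by
    obtain ⟨k, rfl | rfl⟩ := β₀.eq_nat_or_neg
    · intro h2
      rw [hF0, h2, mul_zero] at h0
      exact h0 rfl
    · have h2 := hsh α₀ (-k) k
      rw [neg_add_cancel] at h2
      rw [sub_neg_eq_add, h2]
      refine mul_ne_zero (pow_ne_zero _ ?_) h0
      rintro rfl
      rw [zero_pow (by omega)] at hζ
      exact zero_ne_one hζ
  set D := α₀ - β₀
  have hmax0 : ∀ α, D < α → F α 0 = 0 := fun α hα => hmax α 0 (by simpa using hα)
  have hm' : (m : ℂ) ≠ 0 := Nat.cast_ne_zero.mpr (by omega)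
  -- The geometric law reduces the recursion to the column β = 0, in which only the differences t_J
  -- - ζ^J t'_J appear.
  have heq : ∀ α : ℤ, ∑ J ∈ Finset.range (r * m + 1), (t J - ζ ^ J * t' J) * F (α - J) 0 =
      α * F α 0 := fun α => by
    have e := h.eqn α 0
    have s1 : ∑ J ∈ Finset.range (r * m + 1), t' J * F α (0 + J) =
        ∑ J ∈ Finset.range (r * m + 1), ζ ^ J * t' J * F (α - J) 0 :=
      Finset.sum_congr rfl fun J _ => by rw [zero_add, hF0]; ring
    rw [s1, ← mul_sub, ← Finset.sum_sub_distrib] at e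
    apply mul_left_cancel₀ hm'
    rw [show (∑ J ∈ Finset.range (r * m + 1), (t J - ζ ^ J * t' J) * F (α - J) 0) =
      ∑ J ∈ Finset.range (r * m + 1), (t J * F (α - J) 0 - ζ ^ J * t' J * F (α - J) 0) from
      Finset.sum_congr rfl fun J _ => by ring, e]
    push_cast
    ring
  have hs : ∀ J, 1 ≤ J → J ≤ r * m → t J = ζ ^ J * t' J := by
    by_contra hne
    push Not at hne
    obtain ⟨J₀, hJ1, hJ2, hJ3⟩ := hne
    obtain ⟨J, hJ, hJmax⟩ := Finset.exists_max_image
      ((Finset.range (r * m + 1)).filter fun J => 1 ≤ J ∧ t J ≠ ζ ^ J * t' J) id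
      ⟨J₀, by simp only [Finset.mem_filter, Finset.mem_range]; exact ⟨by omega, hJ1, hJ3⟩⟩
    simp only [Finset.mem_filter, Finset.mem_range, id] at hJ hJmax
    -- `J` is the largest index with a nonzero difference and `D` the highest row with a nonzero
    -- coefficient: at D + J exactly one term survives, and it cannot vanish.
    have e := heq (D + J)
    rw [Finset.sum_eq_single J, add_sub_cancel_right, hmax0 (D + J) (by omega), mul_zero] at e
    · rcases mul_eq_zero.mp e with h2 | h2
      · exact hJ.2.2 (sub_eq_zero.mp h2)
      · exact hD h2
    · intro J' hJ' hne
      rcases lt_or_gt_of_ne hne with h2 | h2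
      · rw [hmax0 _ (by omega), mul_zero]
      · by_cases h3 : t J' = ζ ^ J' * t' J'
        · rw [h3, sub_self, zero_mul]
        · have := hJmax J' ⟨Finset.mem_range.mp hJ', by omega, h3⟩
          omega
    · intro h2
      exact absurd (Finset.mem_range.mpr hJ.1) h2
  -- What remains says that a coefficient in row α is nonzero only if α = t 0 - t' 0, so a single
  -- row survives.
  have heq0 : ∀ α : ℤ, (t 0 - t' 0) * F α 0 = α * F α 0 := fun α => by
    rw [← heq α, Finset.sum_eq_single 0]
    · simp
    · intro J hJ hne
      rw [hs J (by omega) (by have := Finset.mem_range.mp hJ; omega), sub_self, zero_mul]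
    · simp
  have hD0 : t 0 - t' 0 = D := mul_right_cancel₀ hD (heq0 D)
  refine ⟨ζ, F D 0, D, hζ, hD, fun α β => ?_, hs, hD0⟩
  rw [hF0]
  split_ifs with h2
  · rw [h2, mul_comm]
  · have h3 := heq0 (α - β)
    rw [hD0, ← sub_eq_zero, ← sub_mul] at h3
    rcases mul_eq_zero.mp h3 with h4 | h4
    · refine absurd ?_ h2
      have h5 : (D : ℂ) = ((α - β : ℤ) : ℂ) := sub_eq_zero.mp h4
      exact (Int.cast_injective h5).symm
    · rw [h4, mul_zero]

end IsIntertwiner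
end ResonantConnection
end

/-! ### Formal gauges -/

noncomputable section

namespace ResonantConnection
open FormalSeries

section Gauge

variable {ι : Type*} [Fintype ι] [DecidableEq ι]

theorem xcoeff_ofPowerSeries (f : PowerSeries ℂ) (k : ℕ) :
    xcoeff (HahnSeries.ofPowerSeries ℤ ℂ f) (-(k : ℤ)) = PowerSeries.coeff k f := by
  unfold xcoeff
  rw [neg_neg, HahnSeries.ofPowerSeries_apply_coeff]

theorem xcoeff_ofPowerSeries_of_pos (f : PowerSeries ℂ) {k : ℤ} (hk : 0 < k) :
    xcoeff (HahnSeries.ofPowerSeries ℤ ℂ f) k = 0 := by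
  unfold xcoeff
  rw [HahnSeries.ofPowerSeries_apply]
  apply HahnSeries.embDomain_of_notMem_range
  rintro ⟨m, hm⟩
  have : (m : ℤ) = -k := hm
  omega

theorem exists_ofPowerSeries {f : FormalSeries} (hf : ∀ k : ℤ, 0 < k → xcoeff f k = 0) :
    ∃ g : PowerSeries ℂ, f = HahnSeries.ofPowerSeries ℤ ℂ g := by
  refine ⟨PowerSeries.mk fun k => xcoeff f (-(k : ℤ)), xcoeff_ext fun k => ?_⟩
  rcases lt_or_ge 0 k with h | h
  · rw [hf k h, xcoeff_ofPowerSeries_of_pos _ h]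
  · obtain ⟨m, rfl⟩ : ∃ m : ℕ, k = -(m : ℤ) := ⟨(-k).toNat, by omega⟩
    rw [xcoeff_ofPowerSeries, PowerSeries.coeff_mk]

theorem coeffMatrix_ofPowerSeries {ι : Type*} (Y : Matrix ι ι (PowerSeries ℂ)) :
    coeffMatrix (Y.map (HahnSeries.ofPowerSeries ℤ ℂ)) 0 = Y.map PowerSeries.constantCoeff := by
  ext i j
  have := xcoeff_ofPowerSeries (Y i j) 0
  simpa [coeffMatrix] using this

/-- Gauges are the invertible matrices over power series in 1/x, invertibility being decided by the
constant term; closure under quotients is read off from this. -/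
theorem isFormalGauge_iff {Y : Matrix ι ι FormalSeries} :
    IsFormalGauge Y ↔ ∃ Z : Matrix ι ι (PowerSeries ℂ),
      Y = Z.map (HahnSeries.ofPowerSeries ℤ ℂ) ∧ IsUnit Z.det := by
  have hdet : ∀ Z : Matrix ι ι (PowerSeries ℂ),
      (coeffMatrix (Z.map (HahnSeries.ofPowerSeries ℤ ℂ)) 0).det ≠ 0 ↔ IsUnit Z.det := by
    intro Z
    rw [coeffMatrix_ofPowerSeries, PowerSeries.isUnit_iff_constantCoeff, RingHom.map_det,
      isUnit_iff_ne_zero]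
    rfl
  constructor
  · rintro ⟨h1, h2⟩
    choose Z hZ using fun i j => exists_ofPowerSeries (f := Y i j)
      (fun k hk => congrFun (congrFun (h1 k hk) i) j)
    have : Y = (Matrix.of Z).map (HahnSeries.ofPowerSeries ℤ ℂ) := by
      ext i j : 1
      exact hZ i j
    refine ⟨Matrix.of Z, this, ?_⟩
    rwa [← hdet, ← this]
  · rintro ⟨Z, rfl, hZ⟩
    refine ⟨fun k hk => ?_, (hdet Z).mpr hZ⟩
    ext i j
    exact xcoeff_ofPowerSeries_of_pos _ hk

theorem IsFormalGauge.isUnit_det {Y : Matrix ι ι FormalSeries} (h : IsFormalGauge Y) :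
    IsUnit Y.det := by
  obtain ⟨Z, rfl, hZ⟩ := isFormalGauge_iff.mp h
  have : (Z.map (HahnSeries.ofPowerSeries ℤ ℂ)).det = HahnSeries.ofPowerSeries ℤ ℂ Z.det := by
    rw [RingHom.map_det]; rfl
  rw [this]
  exact hZ.map _

theorem IsFormalGauge.inv_mul {Y Y' : Matrix ι ι FormalSeries} (h : IsFormalGauge Y)
    (h' : IsFormalGauge Y') : IsFormalGauge (Y⁻¹ * Y') := by
  obtain ⟨Z, hY, hZ⟩ := isFormalGauge_iff.mp h
  obtain ⟨Z', rfl, hZ'⟩ := isFormalGauge_iff.mp h'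
  have hinv : Y⁻¹ = (Z⁻¹).map (HahnSeries.ofPowerSeries ℤ ℂ) := by
    refine Matrix.inv_eq_left_inv ?_
    rw [hY, ← Matrix.map_mul, Matrix.nonsing_inv_mul _ hZ,
      Matrix.map_one _ (map_zero _) (map_one _)]
  refine isFormalGauge_iff.mpr ⟨Z⁻¹ * Z', ?_, ?_⟩
  · rw [hinv, Matrix.map_mul]
  · rw [Matrix.det_mul]
    exact (Matrix.isUnit_nonsing_inv_det _ hZ).mul hZ'

theorem map_ddx_mul {ι : Type*} [Fintype ι] (Y Z : Matrix ι ι FormalSeries) :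
    (Y * Z).map ddx = Y.map ddx * Z + Y * Z.map ddx := by
  have hsum : ∀ (s : Finset ι) (f : ι → FormalSeries), ddx (∑ i ∈ s, f i) = ∑ i ∈ s, ddx (f i) :=
    fun s f => map_sum (AddMonoidHom.mk' ddx ddx_add) f s
  ext i j : 1
  simp only [Matrix.map_apply, Matrix.mul_apply, Matrix.add_apply, hsum, ddx_mul,
    Finset.sum_add_distrib]

theorem gauge_eq_iff {A Y D : Matrix ι ι FormalSeries} (h : IsUnit Y.det) :
    Y⁻¹ * A * Y - Y⁻¹ * Y.map ddx = D ↔ A * Y - Y.map ddx = Y * D := by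
  rw [Matrix.mul_assoc, ← Matrix.mul_sub]
  constructor
  · rintro rfl
    rw [Matrix.mul_nonsing_inv_cancel_left _ _ h]
  · intro h'
    rw [h', Matrix.nonsing_inv_mul_cancel_left _ _ h]

end Gauge

variable {s : ℕ} {r : ℕ} {n : Fin s → ℕ} {lam : Fin s → ℂ}

theorem IsNormalizingGauge.eqn {A Y : Matrix (BlockIndex n) (BlockIndex n) FormalSeries}
    {t : Fin s → ℕ → ℂ} (h : IsNormalizingGauge r n lam A Y t) :
    A * Y - Y.map ddx = Y * normalForm r n t :=
  (gauge_eq_iff h.1.isUnit_det).mp h.2.2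

/-- Two normalizing gauges differ by an intertwiner of the normal forms. -/
theorem IsNormalizingGauge.intertwine {A Y Y' : Matrix (BlockIndex n) (BlockIndex n) FormalSeries}
    {t t' : Fin s → ℕ → ℂ} (h : IsNormalizingGauge r n lam A Y t)
    (h' : IsNormalizingGauge r n lam A Y' t') :
    normalForm r n t * (Y⁻¹ * Y') - (Y⁻¹ * Y').map ddx = (Y⁻¹ * Y') * normalForm r n t' := by
  obtain ⟨W, hW⟩ : ∃ W, W = Y⁻¹ * Y' := ⟨_, rfl⟩
  rw [← hW]
  have hu := h.1.isUnit_det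
  have hY' : Y' = Y * W := by rw [hW, Matrix.mul_nonsing_inv_cancel_left _ _ hu]
  have e1 := h.eqn
  have e2 := h'.eqn
  rw [hY', map_ddx_mul] at e2
  have e3 : Y * (normalForm r n t * W - W.map ddx) = Y * (W * normalForm r n t') := by
    rw [Matrix.mul_sub, ← Matrix.mul_assoc, ← e1, ← Matrix.mul_assoc, ← e2, Matrix.sub_mul,
      Matrix.mul_assoc A]
    abel
  have e4 := congrArg (Y⁻¹ * ·) e3
  simpa only [Matrix.nonsing_inv_mul_cancel_left _ _ hu] using e4

theorem normalForm_mul_apply (hn : ∀ j, 1 ≤ n j) (t : Fin s → ℕ → ℂ)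
    (W : Matrix (BlockIndex n) (BlockIndex n) FormalSeries) (i : Fin s) (a : Fin (n i))
    (q : BlockIndex n) :
    (n i : FormalSeries) * x * (normalForm r n t * W) ⟨i, a⟩ q =
      ∑ J ∈ Finset.range (r * n i + 1), HahnSeries.C (t i J) *
        rowExt (hn i) (fun a => W ⟨i, a⟩ q) ((a : ℕ) - (J : ℕ)) - (a : ℕ) * W ⟨i, a⟩ q := by
  rw [← normalBlock_mulVec (hn i)]
  congr 1
  rw [Matrix.mul_apply, Fintype.sum_sigma, Finset.sum_eq_single i]
  · simp [normalForm, Matrix.blockDiagonal'_apply_eq, Matrix.mulVec, dotProduct]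
  · intro k _ hk
    refine Finset.sum_eq_zero fun b _ => ?_
    rw [normalForm, Matrix.blockDiagonal'_apply_ne _ _ _ hk.symm, zero_mul]
  · simp

theorem mul_normalForm_apply {ι : Type*} (hn : ∀ j, 1 ≤ n j) (t : Fin s → ℕ → ℂ)
    (W : Matrix ι (BlockIndex n) FormalSeries) (p : ι) (j : Fin s) (b : Fin (n j)) :
    (n j : FormalSeries) * x * (W * normalForm r n t) p ⟨j, b⟩ =
      ∑ J ∈ Finset.range (r * n j + 1), HahnSeries.C (t j J) *
        colExt (hn j) (fun b => W p ⟨j, b⟩) ((b : ℕ) + (J : ℕ)) - (b : ℕ) * W p ⟨j, b⟩ := by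
  rw [← vecMul_normalBlock (hn j) r (t j) (fun b => W p ⟨j, b⟩)]
  congr 1
  rw [Matrix.mul_apply, Fintype.sum_sigma, Finset.sum_eq_single j]
  · simp [normalForm, Matrix.blockDiagonal'_apply_eq, Matrix.vecMul, dotProduct]
  · intro k _ hk
    refine Finset.sum_eq_zero fun b _ => ?_
    rw [normalForm, Matrix.blockDiagonal'_apply_ne _ _ _ hk, mul_zero]
  · simp

theorem xcoeff_rowExt {m : ℕ} (hm : 1 ≤ m) (y : Fin m → FormalSeries) (α k : ℤ) :
    xcoeff (rowExt hm y α) k = xcoeff (y (residue hm α)) (k + α / m) := by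
  rw [rowExt, xcoeff_zpow_mul, sub_neg_eq_add]

theorem xcoeff_colExt {m : ℕ} (hm : 1 ≤ m) (y : Fin m → FormalSeries) (β k : ℤ) :
    xcoeff (colExt hm y β) k = xcoeff (y (residue hm β)) (k - β / m) := by
  rw [colExt, xcoeff_zpow_mul]

/-- The coefficients of the `(i, j)` block of `W` with respect to the extended bases. -/
def blockCoeff (hn : ∀ j, 1 ≤ n j) (W : Matrix (BlockIndex n) (BlockIndex n) FormalSeries)
    (i j : Fin s) (α β : ℤ) : ℂ :=
  xcoeff (W ⟨i, residue (hn i) α⟩ ⟨j, residue (hn j) β⟩) (α / n i - β / n j)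

theorem blockCoeff_apply (hn : ∀ j, 1 ≤ n j)
    (W : Matrix (BlockIndex n) (BlockIndex n) FormalSeries) (i j : Fin s) (a : Fin (n i))
    (b : Fin (n j)) (k : ℤ) :
    blockCoeff hn W i j ((a : ℕ) + n i * k) (b : ℕ) = xcoeff (W ⟨i, a⟩ ⟨j, b⟩) k := by
  unfold blockCoeff
  have hi := hn i
  rw [residue_add_mul, residue_natCast, residue_natCast, Int.add_mul_ediv_left _ _ (by omega),
    Int.ediv_eq_zero_of_lt (by omega) (by have := a.2; omega),
    Int.ediv_eq_zero_of_lt (by omega) (by have := b.2; omega), zero_add, sub_zero]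

/-- Multiply the intertwining relation by n_i n_j x and take coefficients. The derivative
contributes the integer parts of α / n_i and β / n_j, the matrices G contribute the residues, and
together they give the factor α n_j - β n_i. -/
theorem isIntertwiner_blockCoeff (hn : ∀ j, 1 ≤ n j) {t t' : Fin s → ℕ → ℂ}
    {W : Matrix (BlockIndex n) (BlockIndex n) FormalSeries}
    (hpos : ∀ k : ℤ, 0 < k → coeffMatrix W k = 0)
    (heq : normalForm r n t * W - W.map ddx = W * normalForm r n t') (i j : Fin s) :
    IsIntertwiner r (n i) (n j) (t i) (t' j) (blockCoeff hn W i j) where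
  periodic α β := by
    have hi := hn i
    have hj := hn j
    have h1 := residue_add_mul (hn i) α 1
    have h2 := residue_add_mul (hn j) β 1
    have h3 := Int.add_mul_ediv_left α (b := n i) 1 (by omega)
    have h4 := Int.add_mul_ediv_left β (b := n j) 1 (by omega)
    rw [mul_one] at h1 h2 h3 h4
    unfold blockCoeff
    rw [h1, h2, h3, h4, add_sub_add_right_eq_sub]
  bounded := by
    -- Residues change the weight by less than n_i n_j, so a weight above this bound means a
    -- positive power of x, which a gauge does not contain.
    refine ⟨n i * n j, fun α β h => ?_⟩
    refine congrFun (congrFun (hpos (α / n i - β / n j) ?_) _) _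
    have h1 := residue_add_ediv (hn i) α
    have h2 := residue_add_ediv (hn j) β
    have h3 := (residue (hn i) α).2
    by_contra h4
    have h5 : ((residue (hn i) α : ℕ) : ℤ) < n i := by exact_mod_cast h3
    have h6 : (0 : ℤ) ≤ ((residue (hn j) β : ℕ) : ℤ) := by positivity
    have h7 : (0 : ℤ) < n i := by have := hn i; omega
    have h8 : (0 : ℤ) < n j := by have := hn j; omega
    have h9 : (n i : ℤ) * n j * (α / n i - β / n j) ≤ 0 :=
      mul_nonpos_of_nonneg_of_nonpos (by positivity) (by omega)
    have h10 : ((residue (hn i) α : ℕ) : ℤ) * n j < n i * n j := mul_lt_mul_of_pos_right h5 h8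
    have h11 : 0 ≤ ((residue (hn j) β : ℕ) : ℤ) * n i := by positivity
    rw [← h1, ← h2] at h
    nlinarith
  eqn α β := by
    have hi : n i ≠ 0 := by have := hn i; omega
    have hj : n j ≠ 0 := by have := hn j; omega
    set a := residue (hn i) α with ha
    set b := residue (hn j) β with hb
    have h1 := residue_add_ediv (hn i) α
    have h2 := residue_add_ediv (hn j) β
    rw [← ha] at h1
    rw [← hb] at h2
    have e0 := congrFun (congrFun heq ⟨i, a⟩) ⟨j, b⟩
    have eD := normalForm_mul_apply (r := r) hn t W i a ⟨j, b⟩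
    have eD' := mul_normalForm_apply (r := r) hn t' W ⟨i, a⟩ j b
    rw [Matrix.sub_apply, Matrix.map_apply] at e0
    have e1 : (n j : FormalSeries) * (∑ J ∈ Finset.range (r * n i + 1), HahnSeries.C (t i J) *
        rowExt (hn i) (fun a => W ⟨i, a⟩ ⟨j, b⟩) ((a : ℕ) - (J : ℕ)) - (a : ℕ) * W ⟨i, a⟩ ⟨j, b⟩)
        - (n i : FormalSeries) * ((n j : FormalSeries) * (x * ddx (W ⟨i, a⟩ ⟨j, b⟩))) =
        (n i : FormalSeries) * (∑ J ∈ Finset.range (r * n j + 1), HahnSeries.C (t' j J) *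
        colExt (hn j) (fun b => W ⟨i, a⟩ ⟨j, b⟩) ((b : ℕ) + (J : ℕ)) -
          (b : ℕ) * W ⟨i, a⟩ ⟨j, b⟩) := by
      rw [← eD, ← eD', ← e0]
      ring
    have e2 := congrArg (fun f => xcoeff f (α / n i - β / n j)) e1
    simp only [xcoeff_sub, xcoeff_natCast_mul, xcoeff_sum, xcoeff_C_mul, xcoeff_rowExt,
      xcoeff_colExt, xcoeff_x_mul_ddx] at e2
    have s1 : ∀ J : ℕ, blockCoeff hn W i j (α - J) β =
        xcoeff (W ⟨i, residue (hn i) ((a : ℕ) - (J : ℕ))⟩ ⟨j, b⟩)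
          (α / n i - β / n j + ((a : ℕ) - (J : ℕ)) / n i) := fun J => by
      unfold blockCoeff
      have h3 : α - J = ((a : ℕ) - (J : ℕ)) + n i * (α / n i) := by linarith
      conv_lhs => rw [h3, residue_add_mul, Int.add_mul_ediv_left _ _ (by omega)]
      congr 1
      ring
    have s2 : ∀ J : ℕ, blockCoeff hn W i j α (β + J) =
        xcoeff (W ⟨i, a⟩ ⟨j, residue (hn j) ((b : ℕ) + (J : ℕ))⟩)
          (α / n i - β / n j - ((b : ℕ) + (J : ℕ)) / n j) := fun J => by
      unfold blockCoeff
      have h3 : β + J = ((b : ℕ) + (J : ℕ)) + n j * (β / n j) := by linarith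
      conv_lhs => rw [h3, residue_add_mul, Int.add_mul_ediv_left _ _ (by omega)]
      congr 1
      ring
    have s3 : blockCoeff hn W i j α β = xcoeff (W ⟨i, a⟩ ⟨j, b⟩) (α / n i - β / n j) := rfl
    simp only [s1, s2, s3]
    have h1' : (α : ℂ) = (a : ℕ) + n i * ((α / n i : ℤ) : ℂ) := by exact_mod_cast h1.symm
    have h2' : (β : ℂ) = (b : ℕ) + n j * ((β / n j : ℤ) : ℂ) := by exact_mod_cast h2.symm
    rw [h1', h2']
    push_cast at e2
    linear_combination e2

end ResonantConnection
end

/-! ### Automorphisms of nonresonant normal forms -/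

noncomputable section

namespace ResonantConnection
open FormalSeries

variable {s : ℕ} {r : ℕ} {n : Fin s → ℕ} {lam : Fin s → ℂ}

/-- The parameters of a normal form without resonances. -/
structure IsNonresonant (r : ℕ) (n : Fin s → ℕ) (lam : Fin s → ℂ) (t : Fin s → ℕ → ℂ) : Prop where
  ne_zero : ∀ j, 2 ≤ n j → t j (r * n j - 1) ≠ 0
  eq_of_int : ∀ i j, lam i = lam j → n i = n j → r * n j = 1 →
    ∀ k : ℤ, t i 0 - t j 0 = k → i = j
  eq_of_pow : ∀ i j, lam i = lam j → n i = n j → r * n j ≠ 1 →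
    t i (r * n j - 1) ^ n j = t j (r * n j - 1) ^ n j → i = j

/-- A formal gauge that intertwines normal forms is a monomial matrix. -/
theorem exists_eq_monomialMatrix (hr : 1 ≤ r) (hn : ∀ j, 1 ≤ n j) {t t' : Fin s → ℕ → ℂ}
    {W : Matrix (BlockIndex n) (BlockIndex n) FormalSeries} (hW : IsFormalGauge W)
    (heq : normalForm r n t * W - W.map ddx = W * normalForm r n t')
    (ht : ∀ j, t j (r * n j) = n j * lam j) (ht' : ∀ j, t' j (r * n j) = n j * lam j)
    (hres : IsNonresonant r n lam t) (hne' : ∀ j, 2 ≤ n j → t' j (r * n j - 1) ≠ 0) :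
    ∃ (σ : Equiv.Perm (Fin s)) (ζ c : Fin s → ℂ),
      (∀ j, n (σ j) = n j ∧ lam (σ j) = lam j ∧ ζ j ^ n j = 1 ∧ c j ≠ 0) ∧
      (∀ j, ∀ J ≤ r * n j, t (σ j) J = ζ j ^ J * t' j J) ∧ W = monomialMatrix n σ ζ c := by
  obtain ⟨F, hF, hFW⟩ : ∃ F : Fin s → Fin s → ℤ → ℤ → ℂ,
      (∀ i j, IsIntertwiner r (n i) (n j) (t i) (t' j) (F i j)) ∧
      ∀ i j (a : Fin (n i)) (b : Fin (n j)) k,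
        F i j ((a : ℕ) + n i * k) (b : ℕ) = xcoeff (W ⟨i, a⟩ ⟨j, b⟩) k :=
    ⟨blockCoeff hn W, isIntertwiner_blockCoeff hn hW.1 heq, blockCoeff_apply hn W⟩
  have hFW0 : ∀ i j (a : Fin (n i)) (b : Fin (n j)),
      F i j (a : ℕ) (b : ℕ) = coeffMatrix W 0 ⟨i, a⟩ ⟨j, b⟩ := fun i j a b => by
    have := hFW i j a b 0
    rwa [mul_zero, add_zero] at this
  have hlam : ∀ i j, (∃ α β, F i j α β ≠ 0) → lam i = lam j := fun i j h =>
    (hF i j).eigenvalue_eq hr (hn i) (hn j) (ht i) (ht' j) h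
  have hsize : ∀ i j, (∃ α β, F i j α β ≠ 0) → n i = n j := fun i j h => by
    have hij := hlam i j h
    have h1 := hn i
    have h2 := hn j
    have ht'' := ht' j
    rw [← hij] at ht''
    refine le_antisymm ?_ ?_
    · by_contra h3
      exact (hF i j).not_lt_of_ne_zero hr (hn j) (ht i) ht'' (hres.ne_zero i (by omega)) h
        (by omega)
    · by_contra h3
      exact (hF i j).not_gt_of_ne_zero hr (hn i) (ht i) ht'' (hne' j (by omega)) h (by omega)
  have hmono : ∀ i j, (∃ α β, F i j α β ≠ 0) → ∃ (ζ c : ℂ) (δ : ℤ), ζ ^ n j = 1 ∧ c ≠ 0 ∧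
      (∀ α (β : ℕ), F i j α β = if α - β = δ then c * ζ ^ β else 0) ∧
      (∀ J, 1 ≤ J → J ≤ r * n j → t i J = ζ ^ J * t' j J) ∧ t i 0 - t' j 0 = δ := by
    intro i j h
    have h1 := hF i j
    have h2 := ht i
    have h3 := hres.ne_zero i
    rw [hsize i j h] at h1 h2 h3
    rw [hlam i j h] at h2
    exact h1.eq_monomial hr (hn j) h2 (ht' j) h3 h
  -- A vanishing first column of a block would make the constant term of `W` singular; this picks a
  -- row block σ j for each j.
  have hcol : ∀ j, ∃ i, ∃ a : Fin (n i), F i j (a : ℕ) 0 ≠ 0 := by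
    intro j
    by_contra hc
    push Not at hc
    refine hW.2 (Matrix.det_eq_zero_of_column_eq_zero ⟨j, ⟨0, hn j⟩⟩ ?_)
    rintro ⟨i, a⟩
    rw [← hFW0]
    exact hc i a
  choose σ a ha using hcol
  have hex : ∀ j, ∃ α β, F (σ j) j α β ≠ 0 := fun j => ⟨_, _, ha j⟩
  choose ζ c δ hζ hc hFm hts ht0 using fun j => hmono (σ j) j (hex j)
  -- The coefficient found in the first column shows that the offset is nonnegative. A positive
  -- offset would push the image of the last basis vector of the block into a positive power of x.
  have hδ : ∀ j, δ j = 0 := by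
    intro j
    have h1 : 0 ≤ δ j := by
      have h2 := hFm j (a j : ℕ) 0
      by_contra h3
      rw [if_neg (by push_cast; omega)] at h2
      exact ha j (by exact_mod_cast h2)
    refine le_antisymm ?_ h1
    by_contra h2
    have hnj := hn j
    have hs := hsize _ _ (hex j)
    have h3 := hFm j (((n j - 1 : ℕ) : ℤ) + δ j) (n j - 1)
    rw [if_pos (by ring)] at h3
    have hζ0 : ζ j ≠ 0 := by
      intro h4
      have := hζ j
      rw [h4, zero_pow (by omega)] at this
      exact zero_ne_one this
    have h4 := hFW (σ j) j (residue (hn (σ j)) (((n j - 1 : ℕ) : ℤ) + δ j)) ⟨n j - 1, by omega⟩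
      ((((n j - 1 : ℕ) : ℤ) + δ j) / n (σ j))
    rw [residue_add_ediv] at h4
    simp only at h4
    rw [h3] at h4
    have h5 : 0 < (((n j - 1 : ℕ) : ℤ) + δ j) / n (σ j) := by
      have h6 : (1 : ℤ) ≤ (((n j - 1 : ℕ) : ℤ) + δ j) / n (σ j) := by
        rw [Int.le_ediv_iff_mul_le (by omega)]
        omega
      omega
    rw [show xcoeff (W ⟨σ j, _⟩ ⟨j, _⟩) _ = 0 from congrFun (congrFun (hW.1 _ h5) _) _] at h4
    exact mul_ne_zero (hc j) (pow_ne_zero _ hζ0) h4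
  -- Two nonzero blocks in one column would relate their parameters through roots of unity, or
  -- through an integer difference when r n_j = 1; nonresonance excludes both.
  have huniq : ∀ i j, (∃ α β, F i j α β ≠ 0) → i = σ j := by
    intro i j h
    obtain ⟨ζ', c', δ', hζ', -, -, hts', ht0'⟩ := hmono i j h
    have hl : lam i = lam (σ j) := (hlam i j h).trans (hlam _ j (hex j)).symm
    have hs : n i = n (σ j) := (hsize i j h).trans (hsize _ j (hex j)).symm
    have hs' := hsize _ j (hex j)
    have hnj := hn j
    by_cases h1 : r * n j = 1
    · refine hres.eq_of_int i (σ j) hl hs (by rw [hs']; exact h1) (δ' - δ j) ?_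
      push_cast
      rw [← ht0', ← ht0 j]
      ring
    · refine hres.eq_of_pow i (σ j) hl hs (by rw [hs']; exact h1) ?_
      have h2 : 1 ≤ r * n j := Nat.mul_pos hr hnj
      rw [hs', hts' _ (by omega) (by omega), hts j _ (by omega) (by omega), mul_pow, mul_pow,
        ← pow_mul, ← pow_mul, mul_comm _ (n j), pow_mul, pow_mul, hζ', hζ j]
  have hFm' : ∀ i j α (β : ℕ), F i j α β = if i = σ j ∧ α = β then c j * ζ j ^ β else 0 := by
    intro i j α β
    by_cases h : i = σ j
    · rw [h, hFm j, hδ j]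
      simp [sub_eq_zero]
    · have : F i j α β = 0 := by
        by_contra h1
        exact h (huniq i j ⟨_, _, h1⟩)
      simp [this, h]
  have hσ : Function.Injective σ := by
    intro j j' hjj
    by_contra hne
    -- If two column blocks had the same image, their first columns in the constant term would be
    -- proportional; this combination would lie in its kernel.
    have hz := Matrix.eq_zero_of_mulVec_eq_zero hW.2
      (v := Pi.single ⟨j, ⟨0, hn j⟩⟩ (c j') - Pi.single ⟨j', ⟨0, hn j'⟩⟩ (c j)) (by
        rw [Matrix.mulVec_sub, Matrix.mulVec_single, Matrix.mulVec_single]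
        funext ⟨i, b⟩
        have e1 := hFW0 i j b ⟨0, hn j⟩
        have e2 := hFW0 i j' b ⟨0, hn j'⟩
        rw [hFm'] at e1 e2
        simp only [Pi.sub_apply, Pi.smul_apply, Matrix.col_apply, MulOpposite.smul_eq_mul_unop,
          MulOpposite.unop_op, Pi.zero_apply]
        rw [← e1, ← e2, hjj]
        split_ifs
        · simp [mul_comm]
        · simp)
    have := congrFun hz ⟨j, ⟨0, hn j⟩⟩
    rw [Pi.sub_apply, Pi.single_eq_same, Pi.single_eq_of_ne (by
      intro h
      exact hne (congrArg Sigma.fst h)), sub_zero] at this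
    exact hc j' this
  refine ⟨Equiv.ofBijective σ (Finite.injective_iff_bijective.mp hσ), ζ, c, ?_, ?_, ?_⟩
  · intro j
    exact ⟨hsize _ _ (hex j), hlam _ _ (hex j), hζ j, hc j⟩
  · intro j J hJ
    rcases Nat.eq_zero_or_pos J with rfl | hJ0
    · have := ht0 j
      rw [hδ j, Int.cast_zero, sub_eq_zero] at this
      simpa using this
    · exact hts j J hJ0 hJ
  · ext ⟨i, a⟩ ⟨j, b⟩ : 1
    refine xcoeff_ext fun k => ?_
    rw [← hFW i j a b k, hFm']
    simp only [monomialMatrix, Matrix.of_apply, Equiv.ofBijective_apply]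
    by_cases h : i = σ j
    · have hs : n i = n j := by rw [h]; exact hsize _ _ (hex j)
      have h1 := a.2
      have h2 := b.2
      have hnj := hn j
      rcases eq_or_ne k 0 with rfl | hk
      · by_cases hab : (a : ℕ) = b
        · rw [if_pos ⟨h, by rw [hab]; ring⟩, if_pos ⟨h, hab⟩]
          simp [xcoeff]
        · rw [if_neg (by rintro ⟨-, h3⟩; apply hab; rw [mul_zero, add_zero] at h3;
                         exact_mod_cast h3), if_neg (fun h3 => hab h3.2), xcoeff_zero]
      · have h3 : ¬ (((a : ℕ) : ℤ) + (n i : ℤ) * k = (b : ℕ)) := by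
          intro h3
          have h4 : (n i : ℤ) * k = ((b : ℕ) : ℤ) - (a : ℕ) := by linarith
          have h5 : |(n i : ℤ) * k| < n i := by rw [h4, abs_lt]; omega
          rw [abs_mul, Nat.abs_cast] at h5
          have h6 : 1 ≤ |k| := Int.one_le_abs hk
          nlinarith
        rw [if_neg (fun h4 => h3 h4.2)]
        split_ifs
        · unfold xcoeff
          rw [HahnSeries.C_apply, HahnSeries.coeff_single_of_ne (by omega)]
        · rw [xcoeff_zero]
    · rw [if_neg (fun h4 => h h4.1), if_neg (fun h4 => h h4.1), xcoeff_zero]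

end ResonantConnection
end

/-! ### Uniqueness of the normalizing gauge -/

noncomputable section

namespace ResonantConnection
open FormalSeries

variable {s : ℕ} {r : ℕ} {n : Fin s → ℕ} {lam : Fin s → ℂ}

theorem exists_zpow_mul_ofPowerSeries {f : FormalSeries} {K : ℤ}
    (hf : ∀ k : ℤ, K < k → xcoeff f k = 0) :
    ∃ g : PowerSeries ℂ, f = x ^ K * HahnSeries.ofPowerSeries ℤ ℂ g := by
  obtain ⟨g, hg⟩ := exists_ofPowerSeries (f := x ^ (-K) * f) (fun k hk => by
    rw [xcoeff_zpow_mul]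
    exact hf _ (by omega))
  refine ⟨g, ?_⟩
  rw [← hg, ← mul_assoc, ← zpow_add₀ x_ne_zero, add_neg_cancel, zpow_zero, one_mul]

theorem xcoeff_zpow_mul_ofPowerSeries (K : ℤ) (g : PowerSeries ℂ) (k : ℕ) :
    xcoeff (x ^ K * HahnSeries.ofPowerSeries ℤ ℂ g) (K - k) = PowerSeries.coeff k g := by
  rw [xcoeff_zpow_mul, sub_sub_cancel_left, xcoeff_ofPowerSeries]

theorem xcoeff_mul_leading {f g : FormalSeries} {K : ℤ} (hf : ∀ k : ℤ, K < k → xcoeff f k = 0)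
    (hg : ∀ k : ℤ, 0 < k → xcoeff g k = 0) : xcoeff (f * g) K = xcoeff f K * xcoeff g 0 := by
  obtain ⟨f', rfl⟩ := exists_zpow_mul_ofPowerSeries hf
  obtain ⟨g', rfl⟩ := exists_ofPowerSeries hg
  have h1 := xcoeff_zpow_mul_ofPowerSeries K (f' * g') 0
  have h2 := xcoeff_zpow_mul_ofPowerSeries K f' 0
  have h3 := xcoeff_ofPowerSeries g' 0
  simp only [Nat.cast_zero, sub_zero, neg_zero] at h1 h2 h3
  rw [mul_assoc, ← map_mul, h1, h2, h3]
  simp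

theorem jordan_mul_apply (v : BlockIndex n → ℂ) (i : Fin s) (a : Fin (n i)) :
    ∑ q, (Matrix.blockDiagonal' fun j => jordanCell (lam j) (n j)) ⟨i, a⟩ q * v q =
      lam i * v ⟨i, a⟩ + if h : (a : ℕ) + 1 < n i then v ⟨i, ⟨a + 1, h⟩⟩ else 0 := by
  rw [Fintype.sum_sigma, Finset.sum_eq_single i]
  · simp only [Matrix.blockDiagonal'_apply_eq, jordanCell, Matrix.of_apply]
    split_ifs with h
    · rw [Finset.sum_eq_add a ⟨a + 1, h⟩ (by simp [Fin.ext_iff])]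
      · simp [Fin.ext_iff]
      · rintro b - ⟨h1, h2⟩
        rw [if_neg h1.symm, if_neg (fun h3 => h2 (Fin.ext h3)), zero_mul]
      · simp
      · simp
    · rw [Finset.sum_eq_single a]
      · simp
      · intro b _ hb
        have := b.2
        rw [if_neg hb.symm, if_neg (by omega), zero_mul]
      · simp
  · intro k _ hk
    exact Finset.sum_eq_zero fun b _ => by
      rw [Matrix.blockDiagonal'_apply_ne _ _ _ hk.symm, zero_mul]
  · simp

/-- The eigenvectors of a Jordan matrix. -/
theorem eigenvector_support {v : BlockIndex n → ℂ} {c : ℂ}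
    (h : ∀ i (a : Fin (n i)), lam i * v ⟨i, a⟩ +
      (if h : (a : ℕ) + 1 < n i then v ⟨i, ⟨a + 1, h⟩⟩ else 0) = c * v ⟨i, a⟩)
    (i : Fin s) (a : Fin (n i)) (hv : v ⟨i, a⟩ ≠ 0) : lam i = c ∧ (a : ℕ) = 0 := by
  by_cases hc : lam i = c
  · refine ⟨hc, ?_⟩
    by_contra h0
    have ha := a.2
    have e := h i ⟨a - 1, by omega⟩
    rw [hc, dif_pos (show (a : ℕ) - 1 + 1 < n i by omega)] at e
    apply hv
    have h1 : (⟨(a : ℕ) - 1 + 1, by omega⟩ : Fin (n i)) = a := Fin.ext (by simp; omega)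
    rw [h1] at e
    exact left_eq_add.mp e.symm
  · exfalso
    have key : ∀ k : ℕ, ∀ b : Fin (n i), n i - b ≤ k → v ⟨i, b⟩ = 0 := by
      intro k
      induction k with
      | zero => intro b hb; have := b.2; omega
      | succ k ih =>
        intro b hb
        have e := h i b
        have h2 : (if h : (b : ℕ) + 1 < n i then v ⟨i, ⟨b + 1, h⟩⟩ else 0) = 0 := by
          split_ifs with h3
          · exact ih _ (by simp only; omega)
          · rfl
        rw [h2, add_zero, ← sub_eq_zero, ← sub_mul] at e
        exact (mul_eq_zero.mp e).resolve_left (sub_ne_zero.mpr hc)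
    exact hv (key _ a le_rfl)

variable {A Y : Matrix (BlockIndex n) (BlockIndex n) FormalSeries} {t : Fin s → ℕ → ℂ}

/-- This is the coefficient of x^r in the gauge equation multiplied by n_j x. Since r ≥ 1, neither
the derivative of Y nor the matrix G contributes. -/
theorem leading_eqn (hr : 1 ≤ r) (hn : ∀ j, 1 ≤ n j)
    (hdeg : ∀ k : ℤ, (r : ℤ) - 1 < k → coeffMatrix A k = 0)
    (h : IsNormalizingGauge r n lam A Y t) (p : BlockIndex n) (j : Fin s) (b : Fin (n j)) :
    n j * ∑ q, coeffMatrix A ((r : ℤ) - 1) p q * coeffMatrix Y 0 q ⟨j, b⟩ =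
      ∑ J ∈ Finset.range (r * n j + 1), t j J *
        xcoeff (Y p ⟨j, residue (hn j) ((b : ℕ) + (J : ℕ))⟩)
          (r - ((b : ℕ) + (J : ℕ) : ℤ) / n j) := by
  have e1 := mul_normalForm_apply (r := r) hn t Y p j b
  rw [← h.eqn, Matrix.sub_apply, Matrix.map_apply, mul_assoc, mul_sub] at e1
  have e2 := congrArg (fun f => xcoeff f r) e1
  have hY : ∀ p q, ∀ k : ℤ, 0 < k → xcoeff (Y p q) k = 0 := fun p q k hk =>
    congrFun (congrFun (h.1.1 k hk) p) q
  simp only [xcoeff_natCast_mul, xcoeff_sub, xcoeff_sum, xcoeff_C_mul, xcoeff_colExt,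
    xcoeff_x_mul_ddx] at e2
  rw [hY p _ r (by omega), mul_zero, mul_zero, sub_zero, sub_zero, xcoeff_x_mul, Matrix.mul_apply,
    xcoeff_sum] at e2
  rw [← e2]
  congr 1
  refine Finset.sum_congr rfl fun q _ => ?_
  rw [xcoeff_mul_leading (fun k hk => congrFun (congrFun (hdeg k hk) p) q) (hY q _)]
  rfl

/-- If the subleading parameter vanished, the second column of block j of Y_0 would be an
eigenvector of A_r, besides the first column of each block with eigenvalue λ_j. The eigenspace has
only one dimension per cell with this eigenvalue, whereas the columns of Y_0 are independent. -/
theorem IsNormalizingGauge.ne_zero (hr : 1 ≤ r) (hn : ∀ j, 1 ≤ n j)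
    (hdeg : ∀ k : ℤ, (r : ℤ) - 1 < k → coeffMatrix A k = 0)
    (hlead : coeffMatrix A ((r : ℤ) - 1)
      = Matrix.blockDiagonal' fun j => jordanCell (lam j) (n j))
    (h : IsNormalizingGauge r n lam A Y t) (j : Fin s) (hj : 2 ≤ n j) :
    t j (r * n j - 1) ≠ 0 := by
  classical
  intro h0
  have hY : ∀ p q, ∀ k : ℤ, 0 < k → xcoeff (Y p q) k = 0 := fun p q k hk =>
    congrFun (congrFun (h.1.1 k hk) p) q
  -- the columns that are eigenvectors of the leading coefficient
  have hcol : ∀ (k : Fin s) (b : Fin (n k)), ((b : ℕ) = 0 ∨ k = j ∧ (b : ℕ) = 1) →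
      ∀ i (a : Fin (n i)), coeffMatrix Y 0 ⟨i, a⟩ ⟨k, b⟩ ≠ 0 → lam i = lam k ∧ (a : ℕ) = 0 := by
    intro k b hb
    refine eigenvector_support (v := fun q => coeffMatrix Y 0 q ⟨k, b⟩) fun i a => ?_
    have e := leading_eqn hr hn hdeg h ⟨i, a⟩ k b
    have hnk := hn k
    have hk' : (n k : ℂ) ≠ 0 := Nat.cast_ne_zero.mpr (by omega)
    have hb2 := b.2
    rw [hlead, jordan_mul_apply, Finset.sum_eq_single (r * n k)] at e
    · rw [show ((b : ℕ) : ℤ) + ((r * n k : ℕ) : ℤ) = (b : ℕ) + n k * r by push_cast; ring,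
        residue_add_mul, residue_natCast, Int.add_mul_ediv_left _ _ (by omega),
        Int.ediv_eq_zero_of_lt (by omega) (by omega), zero_add, sub_self, h.2.1 k] at e
      apply mul_left_cancel₀ hk'
      rw [e, mul_assoc]
      rfl
    · intro J hJ hne
      have hJ1 := Finset.mem_range.mp hJ
      -- Such terms involve a positive power of x in Y. Apart from the top term, only b = 1, J = r
      -- n_k - 1 escapes, and there the parameter is assumed to be 0.
      by_cases hJ2 : (b : ℕ) + J < r * n k
      · rw [hY _ _ _ ?_, mul_zero]
        have : (((b : ℕ) + (J : ℕ) : ℤ)) / n k < r := by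
          rw [Int.ediv_lt_iff_lt_mul (by omega)]
          exact_mod_cast hJ2
        omega
      · have hJ3 : k = j ∧ J = r * n k - 1 := by
          rcases hb with hb | ⟨rfl, hb⟩
          · omega
          · exact ⟨rfl, by omega⟩
        have hk0 : t k (r * n k - 1) = 0 := by rw [hJ3.1]; exact h0
        rw [hJ3.2, hk0, zero_mul]
    · intro hc
      exact absurd (Finset.mem_range.mpr (by omega)) hc
  let I := {i : Fin s // lam i = lam j}
  -- `none` stands for the extra second column of block j, the other values for the first columns of
  -- the blocks with eigenvalue λ_j.
  let idx : Option I → BlockIndex n := fun o =>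
    o.elim ⟨j, ⟨1, by omega⟩⟩ fun k => ⟨k, ⟨0, hn k⟩⟩
  have hidx : Function.Injective idx := by
    rintro (_ | ⟨k, hk⟩) (_ | ⟨l, hl⟩) h'
    · rfl
    · exfalso
      simp only [idx, Option.elim] at h'
      obtain ⟨rfl, h2⟩ := Sigma.mk.inj_iff.mp h'
      simpa using congrArg Fin.val (eq_of_heq h2)
    · exfalso
      simp only [idx, Option.elim] at h'
      obtain ⟨rfl, h2⟩ := Sigma.mk.inj_iff.mp h'
      simpa using congrArg Fin.val (eq_of_heq h2)
    · have := congrArg Sigma.fst h'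
      simp only [idx, Option.elim] at this
      subst this
      rfl
  have hidxcol : ∀ o i (a : Fin (n i)), coeffMatrix Y 0 ⟨i, a⟩ (idx o) ≠ 0 →
      lam i = lam j ∧ (a : ℕ) = 0 := by
    rintro (_ | k) i a h'
    · exact hcol j _ (Or.inr ⟨rfl, rfl⟩) i a h'
    · have := hcol k _ (Or.inl rfl) i a h'
      exact ⟨this.1.trans k.2, this.2⟩
  let Φ : (Option I → ℂ) →ₗ[ℂ] (I → ℂ) :=
    Matrix.mulVecLin (Matrix.of fun i o => coeffMatrix Y 0 ⟨i, ⟨0, hn i⟩⟩ (idx o))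
  have hΦ : Function.Injective Φ := by
    rw [injective_iff_map_eq_zero]
    intro g hg
    have hz := Matrix.eq_zero_of_mulVec_eq_zero h.1.2
      (v := ∑ o, Pi.single (idx o) (g o)) (by
        rw [Matrix.mulVec_sum]
        funext ⟨i, a⟩
        rw [Finset.sum_apply]
        simp only [Matrix.mulVec_single, Pi.smul_apply, Matrix.col_apply,
          MulOpposite.smul_eq_mul_unop, MulOpposite.unop_op, Pi.zero_apply]
        by_cases hia : lam i = lam j ∧ (a : ℕ) = 0
        · have ha : a = ⟨0, hn i⟩ := Fin.ext hia.2
          have := congrFun hg ⟨i, hia.1⟩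
          rw [ha]
          simpa [Φ, Matrix.mulVec, dotProduct] using this
        · refine Finset.sum_eq_zero fun o _ => ?_
          have : coeffMatrix Y 0 ⟨i, a⟩ (idx o) = 0 := by
            by_contra h'
            exact hia (hidxcol o i a h')
          rw [this, zero_mul])
    funext o
    have := congrFun hz (idx o)
    rw [Finset.sum_apply, Finset.sum_eq_single o, Pi.single_eq_same] at this
    · exact this
    · intro o' _ ho'
      exact Pi.single_eq_of_ne (fun h' => ho' (hidx h').symm) _
    · simp
  have := LinearMap.finrank_le_finrank_of_injective hΦ
  simp at this

variable {Y' : Matrix (BlockIndex n) (BlockIndex n) FormalSeries} {t' : Fin s → ℕ → ℂ}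

theorem IsNormalizingGauge.exists_monomialMatrix (hr : 1 ≤ r) (hn : ∀ j, 1 ≤ n j)
    (hdeg : ∀ k : ℤ, (r : ℤ) - 1 < k → coeffMatrix A k = 0)
    (hlead : coeffMatrix A ((r : ℤ) - 1)
      = Matrix.blockDiagonal' fun j => jordanCell (lam j) (n j))
    (h : IsNormalizingGauge r n lam A Y t) (hres : IsNonresonant r n lam t)
    (h' : IsNormalizingGauge r n lam A Y' t') :
    ∃ (σ : Equiv.Perm (Fin s)) (ζ c : Fin s → ℂ),
      (∀ j, n (σ j) = n j ∧ lam (σ j) = lam j ∧ ζ j ^ n j = 1 ∧ c j ≠ 0) ∧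
      (∀ j, ∀ J ≤ r * n j, t (σ j) J = ζ j ^ J * t' j J) ∧ Y' = Y * monomialMatrix n σ ζ c := by
  obtain ⟨σ, ζ, c, h1, h2, h3⟩ := exists_eq_monomialMatrix hr hn (h.1.inv_mul h'.1)
    (h.intertwine h') h.2.1 h'.2.1 hres (h'.ne_zero hr hn hdeg hlead)
  refine ⟨σ, ζ, c, h1, h2, ?_⟩
  rw [← h3, Matrix.mul_nonsing_inv_cancel_left _ _ h.1.isUnit_det]

/-- The nonresonance conditions are unchanged by permuting cells of equal type and by the factors
ζ_j^J, since ζ_j^(n_j) = 1. One nonresonant gauge thus settles all of them. -/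
theorem IsNormalizingGauge.isNonresonant (hr : 1 ≤ r) (hn : ∀ j, 1 ≤ n j)
    (hdeg : ∀ k : ℤ, (r : ℤ) - 1 < k → coeffMatrix A k = 0)
    (hlead : coeffMatrix A ((r : ℤ) - 1)
      = Matrix.blockDiagonal' fun j => jordanCell (lam j) (n j))
    (h : IsNormalizingGauge r n lam A Y t) (hres : IsNonresonant r n lam t)
    (h' : IsNormalizingGauge r n lam A Y' t') : IsNonresonant r n lam t' := by
  obtain ⟨σ, ζ, c, h1, h2, -⟩ := h.exists_monomialMatrix hr hn hdeg hlead hres h'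
  refine ⟨h'.ne_zero hr hn hdeg hlead, fun i j hl hs hrn k hk => ?_, fun i j hl hs hrn hp => ?_⟩
  · refine σ.injective (hres.eq_of_int (σ i) (σ j) ?_ ?_ ?_ k ?_)
    · rw [(h1 i).2.1, (h1 j).2.1, hl]
    · rw [(h1 i).1, (h1 j).1, hs]
    · rw [(h1 j).1, hrn]
    · rw [h2 i 0 (Nat.zero_le _), h2 j 0 (Nat.zero_le _), ← hk]
      simp
  · have hpow : ∀ i : Fin s, n i = n j →
        t (σ i) (r * n j - 1) ^ n j = t' i (r * n j - 1) ^ n j := fun i hi => by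
      rw [h2 i _ (by rw [hi]; omega), mul_pow, ← pow_mul, mul_comm _ (n j), pow_mul, ← hi,
        (h1 i).2.2.1, one_pow, one_mul]
    refine σ.injective (hres.eq_of_pow (σ i) (σ j) ?_ ?_ ?_ ?_)
    · rw [(h1 i).2.1, (h1 j).2.1, hl]
    · rw [(h1 i).1, (h1 j).1, hs]
    · rwa [(h1 j).1]
    · rw [(h1 j).1, hpow i hs, hpow j rfl, hp]

/-- With equal parameters on both sides, nonresonance makes the permutation trivial. -/
theorem IsNormalizingGauge.exists_diagonal (hr : 1 ≤ r) (hn : ∀ j, 1 ≤ n j)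
    (hdeg : ∀ k : ℤ, (r : ℤ) - 1 < k → coeffMatrix A k = 0)
    (hlead : coeffMatrix A ((r : ℤ) - 1)
      = Matrix.blockDiagonal' fun j => jordanCell (lam j) (n j))
    (h : IsNormalizingGauge r n lam A Y t) (hres : IsNonresonant r n lam t)
    (h' : IsNormalizingGauge r n lam A Y' t) :
    ∃ c : Fin s → ℂ, (∀ j, c j ≠ 0) ∧
      Y' = Y * Matrix.diagonal fun p => HahnSeries.C (c p.1) := by
  obtain ⟨σ, ζ, c, h1, h2, h3⟩ := h.exists_monomialMatrix hr hn hdeg hlead hres h'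
  have hσ : ∀ j, σ j = j := by
    intro j
    by_cases hrn : r * n j = 1
    · refine hres.eq_of_int _ _ (h1 j).2.1 (h1 j).1 hrn 0 ?_
      rw [h2 j 0 (Nat.zero_le _)]
      simp
    · refine hres.eq_of_pow _ _ (h1 j).2.1 (h1 j).1 hrn ?_
      rw [h2 j _ (by omega), mul_pow, ← pow_mul, mul_comm _ (n j), pow_mul, (h1 j).2.2.1, one_pow,
        one_mul]
  -- For n_j ≥ 2, comparing the nonzero parameter of index r n_j - 1 with itself gives ζ^(r n_j - 1)
  -- = 1, and ζ^(r n_j) = 1 as well.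
  have hζ : ∀ j, ζ j = 1 := by
    intro j
    have hz := (h1 j).2.2.1
    rcases (hn j).eq_or_lt with h4 | h4
    · rwa [← h4, pow_one] at hz
    · have h5 := h2 j (r * n j - 1) (by omega)
      rw [hσ j] at h5
      have h6 : ζ j ^ (r * n j - 1) = 1 :=
        mul_right_cancel₀ (hres.ne_zero j h4) (by rw [one_mul]; exact h5.symm)
      have h7 : ζ j ^ (r * n j) = 1 := by rw [mul_comm, pow_mul, hz, one_pow]
      have h8 : 1 ≤ r * n j := Nat.mul_pos hr (hn j)
      rw [show r * n j = r * n j - 1 + 1 by omega, pow_succ, h6, one_mul] at h7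
      exact h7
  refine ⟨c, fun j => (h1 j).2.2.2, ?_⟩
  rw [h3]
  congr 1
  ext ⟨i, a⟩ ⟨j, b⟩ : 1
  simp only [monomialMatrix, Matrix.of_apply, hσ, hζ, one_pow, mul_one, Matrix.diagonal_apply]
  by_cases hij : i = j
  · subst hij
    by_cases hab : a = b
    · subst hab
      simp
    · rw [if_neg (fun h4 => hab (Fin.ext h4.2)), if_neg (fun h4 => hab (by simpa using h4))]
  · rw [if_neg (fun h4 => hij h4.1), if_neg (fun h4 => hij (congrArg Sigma.fst h4))]

end ResonantConnection
end

/-! ### The linear equations of the formal eigenvectors -/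

noncomputable section

namespace ResonantConnection
open FormalSeries

variable {s : ℕ} {n : Fin s → ℕ}

/-- The order in `x ^ (-1 / n j)` of the `p`-th coordinate of the formal eigenvector attached to
the `j`-th cell. -/
def colOrder (lam : Fin s → ℂ) (j : Fin s) (p : BlockIndex n) : ℕ :=
  open Classical in if lam p.1 = lam j then min p.2 (n j) else 0

/-- The order of the `p`-th row of the equation of the formal eigenvector attached to the `j`-th
cell. -/
def rowOrder (lam : Fin s → ℂ) (j : Fin s) (p : BlockIndex n) : ℕ :=
  open Classical in if lam p.1 = lam j then min (p.2 + 1) (n j) else 0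

/-- The rows whose leading part involves the eigenvalue. -/
def Active (lam : Fin s → ℂ) (j : Fin s) (p : BlockIndex n) : Prop :=
  lam p.1 = lam j ∧ (p.2 : ℕ) < n j

open Classical in
theorem rowOrder_eq (lam : Fin s → ℂ) (j : Fin s) (p : BlockIndex n) :
    rowOrder lam j p = colOrder lam j p + if Active lam j p then 1 else 0 := by
  unfold rowOrder colOrder Active
  by_cases h : lam p.1 = lam j
  · by_cases h2 : (p.2 : ℕ) < n j
    · simp only [h, h2, if_true, and_self]; omega
    · simp only [h, h2, if_true, and_false, if_false]; omega
  · simp [h]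

open Classical in
/-- The leading part of the equation of the formal eigenvector attached to the `j`-th cell. -/
def principalPart (lam : Fin s → ℂ) (B : Matrix (BlockIndex n) (BlockIndex n) ℂ) (j : Fin s)
    (w : BlockIndex n → ℂ) (p : BlockIndex n) : ℂ :=
  (lam p.1 - lam j) * w p +
    (if h : (p.2 : ℕ) + 1 < n p.1 then w ⟨p.1, ⟨p.2 + 1, h⟩⟩ else 0) +
    if lam p.1 = lam j ∧ n j ≤ p.2 + 1 then
      ∑ q, (if colOrder lam j q = 0 then B p q * w q else 0) else 0

theorem principalPart_add_smul (lam : Fin s → ℂ) (B : Matrix (BlockIndex n) (BlockIndex n) ℂ)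
    (j : Fin s) (w w' : BlockIndex n → ℂ) (c : ℂ) (p : BlockIndex n) :
    principalPart lam B j (w + c • w') p =
      principalPart lam B j w p + c * principalPart lam B j w' p := by
  unfold principalPart
  have h1 : ∑ q, (if colOrder lam j q = 0 then B p q * (w + c • w') q else 0) =
      ∑ q, (if colOrder lam j q = 0 then B p q * w q else 0) +
        c * ∑ q, (if colOrder lam j q = 0 then B p q * w' q else 0) := by
    rw [Finset.mul_sum, ← Finset.sum_add_distrib]
    refine Finset.sum_congr rfl fun q _ => ?_
    split_ifs
    · simp only [Pi.add_apply, Pi.smul_apply, smul_eq_mul]; ring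
    · ring
  rw [h1]
  simp only [Pi.add_apply, Pi.smul_apply, smul_eq_mul]
  split_ifs <;> ring

open Classical in
/-- The leading part of the formal eigenvector attached to the `j`-th cell. -/
def leadingVector (hn : ∀ j, 1 ≤ n j) (lam : Fin s → ℂ)
    (B : Matrix (BlockIndex n) (BlockIndex n) ℂ) (j : Fin s) (U : Fin s → ℂ) (μ : ℂ)
    (p : BlockIndex n) : ℂ :=
  if Above (n := n) lam j p.1 then
    if (p.2 : ℕ) < n j then μ ^ (p.2 : ℕ) * U p.1 else
      (if (p.2 : ℕ) = n j then μ ^ n j * U p.1 else 0) -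
        ∑ k, B ⟨p.1, ⟨p.2 - 1, by have := p.2.2; omega⟩⟩ ⟨k, ⟨0, hn k⟩⟩ * U k
  else 0

section

variable {hn : ∀ j, 1 ≤ n j} {lam : Fin s → ℂ} {B : Matrix (BlockIndex n) (BlockIndex n) ℂ}
  {ν : Fin s → ℂ} {U : Fin s → Fin s → ℂ}

open Classical in
/-- The components at the beginning of the cells above the `j`-th one. -/
def cellHead (hn : ∀ j, 1 ≤ n j) (lam : Fin s → ℂ) (j : Fin s) (w : BlockIndex n → ℂ)
    (i : Fin s) : ℂ :=
  if Above (n := n) lam j i then w ⟨i, ⟨0, hn i⟩⟩ else 0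

/-- In a cell above the j-th one, only the first coordinate has order 0. Hence the leading part sees
only the first columns of the blocks of B. -/
theorem sum_colOrder_eq_zero (j : Fin s) (p : BlockIndex n) {w : BlockIndex n → ℂ}
    (hw : ∀ q : BlockIndex n, ¬ Above (n := n) lam j q.1 → w q = 0) :
    ∑ q, (if colOrder lam j q = 0 then B p q * w q else 0) =
      ∑ k, B p ⟨k, ⟨0, hn k⟩⟩ * cellHead hn lam j w k := by
  rw [Fintype.sum_sigma]
  refine Finset.sum_congr rfl fun k _ => ?_
  rw [Finset.sum_eq_single ⟨0, hn k⟩]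
  · have h0 : colOrder lam j ⟨k, ⟨0, hn k⟩⟩ = 0 := by simp [colOrder]
    rw [if_pos h0, cellHead]
    split_ifs with h
    · rfl
    · rw [hw _ h]
  · intro b _ hb
    by_cases h : Above (n := n) lam j k
    · have hb' : (b : ℕ) ≠ 0 := fun h' => hb (Fin.ext h')
      have := hn j
      rw [if_neg]
      simp only [colOrder, h.1, if_true]
      omega
    · rw [hw ⟨k, b⟩ h, mul_zero, ite_self]
  · simp

theorem cellHead_leadingVector {j : Fin s} (hU : ∀ i, U j i ≠ 0 → Above (n := n) lam j i) (μ : ℂ) :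
    cellHead hn lam j (leadingVector hn lam B j (U j) μ) = U j := by
  funext i
  unfold cellHead leadingVector
  have := hn j
  by_cases h : Above (n := n) lam j i
  · simp [h, show 0 < n j by omega]
  · rw [if_neg h]
    by_contra h'
    exact h (hU i (Ne.symm h'))

/-- Rows a with a + 1 < n_j multiply by μ along a cell. From there on, the components are defined so
as to cancel the contribution of B, except in the last row of a cell, which is exactly the pencil
equation for U, with μ^(n_j) = ν_j. -/
theorem principalPart_leadingVector (hL : LidskiiBasis hn lam B ν U) (j : Fin s) {μ : ℂ}
    (hμ : μ ^ n j = ν j) (p : BlockIndex n) :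
    principalPart lam B j (leadingVector hn lam B j (U j) μ) p =
      open Classical in
      if Active lam j p then μ * leadingVector hn lam B j (U j) μ p else 0 := by
  classical
  obtain ⟨i, a⟩ := p
  have hsum := sum_colOrder_eq_zero (hn := hn) (lam := lam) (B := B) j ⟨i, a⟩
    (w := leadingVector hn lam B j (U j) μ) (fun q hq => by simp [leadingVector, hq])
  rw [cellHead_leadingVector (hL.support j)] at hsum
  unfold principalPart
  rw [hsum]
  have ha := a.2
  have hnj := hn j
  by_cases h : Above (n := n) lam j i
  · have hl := h.1
    have hle := h.2
    have heig := hL.eigen j i h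
    simp only [hl, sub_self, zero_mul, zero_add, true_and, Active]
    by_cases h1 : (a : ℕ) + 1 < n j
    · rw [dif_pos (show (a : ℕ) + 1 < n i by omega), if_neg (by omega), if_pos (by omega)]
      simp only [leadingVector, h, if_true, h1, show (a : ℕ) < n j by omega]
      ring
    · rw [if_pos (show n j ≤ (a : ℕ) + 1 by omega)]
      by_cases h2 : (a : ℕ) + 1 < n i
      · rw [dif_pos h2]
        simp only [leadingVector, h, if_true, h1, if_false, Nat.add_sub_cancel]
        by_cases h3 : (a : ℕ) + 1 = n j
        · rw [if_pos h3, if_pos (by omega), if_pos (by omega), ← h3]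
          ring
        · rw [if_neg h3, if_neg (by omega)]
          ring
      · rw [dif_neg h2, zero_add]
        have h3 : a = ⟨n i - 1, by omega⟩ := Fin.ext (by simp only; omega)
        have h4 : ∑ k, B ⟨i, a⟩ ⟨k, ⟨0, hn k⟩⟩ * U j k = ∑ k, lidskiiMatrix hn B i k * U j k := by
          rw [h3]; rfl
        rw [h4, heig]
        by_cases h5 : n i = n j
        · rw [if_pos h5, if_pos (by omega)]
          simp only [leadingVector, h, if_true, show (a : ℕ) < n j by omega]
          rw [← hμ, ← mul_assoc, ← pow_succ', show (a : ℕ) + 1 = n j by omega]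
        · rw [if_neg h5, if_neg (by omega)]
  · have h0 : ∀ b, leadingVector hn lam B j (U j) μ ⟨i, b⟩ = 0 := fun b => by
      simp [leadingVector, h]
    have h1 : ¬ (lam i = lam j ∧ n j ≤ (a : ℕ) + 1) := fun h2 => h ⟨h2.1, by omega⟩
    simp [h0, h1]

theorem eq_zero_of_descending {i : Fin s} {w : BlockIndex n → ℂ} {γ : ℂ} (hγ : γ ≠ 0)
    (h : ∀ a : Fin (n i), (if h : (a : ℕ) + 1 < n i then w ⟨i, ⟨a + 1, h⟩⟩ else 0) = γ * w ⟨i, a⟩)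
    (a : Fin (n i)) : w ⟨i, a⟩ = 0 := by
  have key : ∀ k : ℕ, ∀ b : Fin (n i), n i - b ≤ k → w ⟨i, b⟩ = 0 := by
    intro k
    induction k with
    | zero => intro b hb; have := b.2; omega
    | succ k ih =>
      intro b hb
      have e := h b
      have h2 : (if h : (b : ℕ) + 1 < n i then w ⟨i, ⟨b + 1, h⟩⟩ else 0) = 0 := by
        split_ifs with h3
        · exact ih _ (by simp only; omega)
        · rfl
      rw [h2] at e
      exact (mul_eq_zero.mp e.symm).resolve_left hγ
  exact key _ a le_rfl

/-! ### Kernel and solvability of the leading operator -/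

section Kernel

open Classical in
-- On a cell with another eigenvalue the operator is a nonzero scalar plus a nilpotent shift. On a
-- smaller cell with the same eigenvalue all rows are active, and it is the shift minus μ. Both are
-- injective. The alternative in `hμ'` serves the regular singular case, in which n_j = 1 leaves no
-- smaller cells and μ' is free.
theorem eq_zero_of_not_above {j : Fin s} {μ μ' b : ℂ} (hμ0 : μ ≠ 0) (hμ' : n j = 1 ∨ μ' = μ)
    {w : BlockIndex n → ℂ}
    (hw : ∀ p, principalPart lam B j w p = if Active lam j p then
      μ' * w p + b * leadingVector hn lam B j (U j) μ p else 0)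
    (q : BlockIndex n) (hq : ¬ Above (n := n) lam j q.1) : w q = 0 := by
  obtain ⟨i, a⟩ := q
  by_cases hl : lam i = lam j
  · have hlt : n i < n j := by
      by_contra h
      exact hq ⟨hl, not_lt.mp h⟩
    have hni := hn i
    have hμ'' : μ' = μ := hμ'.resolve_left (by omega)
    refine eq_zero_of_descending hμ0 (fun a => ?_) a
    have e := hw ⟨i, a⟩
    have ha := a.2
    have h0 : leadingVector hn lam B j (U j) μ ⟨i, a⟩ = 0 := if_neg hq
    rw [h0, if_pos ⟨hl, by simp only; omega⟩, hμ''] at e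
    unfold principalPart at e
    rw [if_neg (fun h => by have := h.2; simp only at this; omega)] at e
    simp only [hl, sub_self, zero_mul, zero_add, add_zero, mul_zero] at e
    exact e
  · refine eq_zero_of_descending (sub_ne_zero.mpr (Ne.symm hl)) (fun a => ?_) a
    have e := hw ⟨i, a⟩
    rw [if_neg (fun h => hl h.1)] at e
    unfold principalPart at e
    rw [if_neg (fun h => hl h.1)] at e
    simp only [add_zero] at e
    linear_combination e

open Classical in
-- Recursion along a cell expresses every component of index below n_j through the head, with an
-- inhomogeneity a μ^(a-1) b, the variation of μ^a. The last row then becomes a pencil equation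
-- whose inhomogeneity is the variation of μ^(n_j).
theorem pencil_of_kernel {j : Fin s} {μ μ' b : ℂ} (hμ0 : μ ≠ 0) (hμ' : n j = 1 ∨ μ' = μ)
    {w : BlockIndex n → ℂ}
    (hw : ∀ p, principalPart lam B j w p = if Active lam j p then
      μ' * w p + b * leadingVector hn lam B j (U j) μ p else 0)
    (i : Fin s) (hi : Above (n := n) lam j i) :
    ∑ k, lidskiiMatrix hn B i k * cellHead hn lam j w k =
      if n i = n j then μ' ^ n j * cellHead hn lam j w i + (n j * μ ^ (n j - 1) * b) * U j i
      else 0 := by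
  have hna := eq_zero_of_not_above (hn := hn) hμ0 hμ' hw
  have hnj := hn j
  have hni := hn i
  have hle := hi.2
  have hl := hi.1
  have hhead : cellHead hn lam j w i = w ⟨i, ⟨0, hn i⟩⟩ := if_pos hi
  have hlead : ∀ (a : ℕ) (ha : a < n i), a < n j →
      leadingVector hn lam B j (U j) μ ⟨i, ⟨a, ha⟩⟩ = μ ^ a * U j i := fun a ha h => by
    simp [leadingVector, hi, h]
  have hpow : ∀ (a : ℕ) (ha : a < n i), a < n j →
      w ⟨i, ⟨a, ha⟩⟩ = μ' ^ a * cellHead hn lam j w i + a * μ ^ (a - 1) * b * U j i := by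
    intro a
    induction a with
    | zero => intro ha _; simp [hhead]
    | succ a ih =>
      intro ha haj
      have hμ'' : μ' = μ := hμ'.resolve_left (by omega)
      have e := hw ⟨i, ⟨a, by omega⟩⟩
      unfold principalPart at e
      rw [if_neg (fun h => by have := h.2; simp only at this; omega), dif_pos ha,
        if_pos ⟨hl, by simp only; omega⟩, hlead a (by omega) (by omega),
        ih (by omega) (by omega)] at e
      simp only [hl, sub_self, zero_mul, zero_add, add_zero] at e
      rw [e, hμ'']
      rcases Nat.eq_zero_or_pos a with rfl | h0
      · simp
      · obtain ⟨a', rfl⟩ : ∃ a', a = a' + 1 := ⟨a - 1, by omega⟩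
        simp only [Nat.add_sub_cancel]
        push_cast
        ring
  have e := hw ⟨i, ⟨n i - 1, by omega⟩⟩
  unfold principalPart at e
  rw [dif_neg (by simp only; omega), if_pos ⟨hl, by simp only; omega⟩,
    sum_colOrder_eq_zero (hn := hn) j _ hna] at e
  simp only [hl, sub_self, zero_mul, zero_add] at e
  refine Eq.trans ?_ (e.trans ?_)
  · rfl
  · by_cases h : n i = n j
    · rw [if_pos ⟨hl, by simp only; omega⟩, if_pos h, hlead _ _ (by omega),
        hpow _ _ (by omega)]
      rcases hnj.eq_or_lt with h1 | h1
      · simp [h, ← h1]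
      · have hμ'' : μ' = μ := hμ'.resolve_left (by omega)
        rw [hμ'', h]
        obtain ⟨m, hm⟩ : ∃ m, n j = m + 2 := ⟨n j - 2, by omega⟩
        rw [hm]
        simp only [show m + 2 - 1 = m + 1 by omega, Nat.add_sub_cancel]
        push_cast
        ring
    · rw [if_neg (fun h2 => by have := h2.2; simp only at this; omega), if_neg h]

open Classical in
-- With vanishing heads B drops out, and each row of a cell yields the next component.
theorem eq_zero_of_kernel {j : Fin s} {μ μ' : ℂ} (hμ0 : μ ≠ 0) (hμ' : n j = 1 ∨ μ' = μ)
    {w : BlockIndex n → ℂ}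
    (hw : ∀ p, principalPart lam B j w p = if Active lam j p then μ' * w p else 0)
    (hhead : cellHead hn lam j w = 0) : w = 0 := by
  have hna := eq_zero_of_not_above (hn := hn) (lam := lam) (B := B) (U := 0) (b := 0) hμ0 hμ'
    (w := w) (by simpa using hw)
  funext ⟨i, ⟨a, ha⟩⟩
  by_cases hi : Above (n := n) lam j i
  · induction a with
    | zero =>
      have := congrFun hhead i
      rwa [cellHead, if_pos hi] at this
    | succ a ih =>
      have e := hw ⟨i, ⟨a, by omega⟩⟩
      unfold principalPart at e
      have h0 : w ⟨i, ⟨a, by omega⟩⟩ = 0 := ih (by omega)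
      rw [sum_colOrder_eq_zero (hn := hn) j _ hna, dif_pos ha, hhead, h0] at e
      simpa using e
  · exact hna ⟨i, ⟨a, ha⟩⟩ hi

open Classical in
/-- The linear equations for the successive coefficients of a formal eigenvector, away from the
regular singular case, are solvable. -/
theorem exists_solution_of_simple (hL : LidskiiBasis hn lam B ν U) {j : Fin s} {μ : ℂ}
    (hμ0 : μ ≠ 0) (hμ : μ ^ n j = ν j) (R : BlockIndex n → ℂ) :
    ∃ (a : BlockIndex n → ℂ) (b : ℂ), ∀ p, principalPart lam B j a p -
      (if Active lam j p then μ * a p + b * leadingVector hn lam B j (U j) μ p else 0) = R p := by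
  set w₀ := leadingVector hn lam B j (U j) μ with hw₀
  let T : ((BlockIndex n → ℂ) × ℂ) →ₗ[ℂ] (BlockIndex n → ℂ) :=
    { toFun := fun ab p => principalPart lam B j ab.1 p -
        (if Active lam j p then μ * ab.1 p + ab.2 * w₀ p else 0)
      map_add' := fun x y => by
        funext p
        have := principalPart_add_smul lam B j x.1 y.1 1 p
        rw [one_smul] at this
        simp only [Prod.fst_add, Prod.snd_add, this, Pi.add_apply]
        split_ifs <;> ring
      map_smul' := fun c x => by
        funext p
        have h0 := principalPart_add_smul lam B j 0 x.1 c p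
        have h1 := principalPart_add_smul lam B j 0 0 (-1) p
        simp only [zero_add, smul_zero] at h0 h1
        have h2 : principalPart lam B j 0 p = 0 := by linear_combination h1
        rw [h2] at h0
        simp only [Prod.smul_fst, Prod.smul_snd, h0, Pi.smul_apply, smul_eq_mul,
          RingHom.id_apply]
        split_ifs <;> ring }
  -- Simplicity of the pseudovalue excludes generalized eigenvectors (b = 0) and leaves only
  -- multiples of the leading vector. The source has one dimension more than the target, so `T` is
  -- onto.
  have hker : LinearMap.ker T ≤ Submodule.span ℂ {(w₀, 0)} := by
    rintro ⟨w, b⟩ hwb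
    have hw : ∀ p, principalPart lam B j w p =
        if Active lam j p then μ * w p + b * w₀ p else 0 := fun p =>
      sub_eq_zero.mp (congrFun (LinearMap.mem_ker.mp hwb) p)
    have hp := pencil_of_kernel hμ0 (Or.inr rfl) hw
    obtain ⟨h1, β, hβ⟩ := hL.simple j (cellHead hn lam j w) (n j * μ ^ (n j - 1) * b)
      (fun i hi => by
        by_contra h
        exact hi (if_neg h))
      (fun i hi => by rw [hp i hi, hμ])
    have hb : b = 0 := by
      have hnj := hn j
      have h2 : (n j : ℂ) * μ ^ (n j - 1) ≠ 0 :=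
        mul_ne_zero (Nat.cast_ne_zero.mpr (by omega)) (pow_ne_zero _ hμ0)
      exact (mul_eq_zero.mp h1).resolve_left h2
    have hz : w + (-β) • w₀ = 0 := by
      refine eq_zero_of_kernel (hn := hn) (lam := lam) (j := j) (B := B) hμ0 (Or.inr rfl) (fun p => ?_) ?_
      · rw [principalPart_add_smul, hw p, hw₀, principalPart_leadingVector hL j hμ, hb]
        split_ifs
        · simp only [Pi.add_apply, Pi.smul_apply, smul_eq_mul]; ring
        · ring
      · have h3 := cellHead_leadingVector (hn := hn) (B := B) (hL.support j) μ
        rw [← hw₀] at h3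
        have h4 : cellHead hn lam j (w + (-β) • w₀) =
            cellHead hn lam j w + (-β) • cellHead hn lam j w₀ := by
          funext i
          simp only [cellHead, Pi.add_apply, Pi.smul_apply, smul_eq_mul]
          split_ifs <;> ring
        rw [h4, hβ, h3, neg_smul, add_neg_cancel]
    refine Submodule.mem_span_singleton.mpr ⟨β, ?_⟩
    rw [Prod.smul_mk, smul_zero, hb, Prod.mk.injEq]
    refine ⟨?_, rfl⟩
    rw [neg_smul, ← sub_eq_add_neg, sub_eq_zero] at hz
    exact hz.symm
  have hsurj : Function.Surjective T := by
    rw [← LinearMap.range_eq_top]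
    apply Submodule.eq_top_of_finrank_eq
    have h1 := LinearMap.finrank_range_add_finrank_ker T
    have h2 := (Submodule.finrank_mono hker).trans (finrank_span_le_card (R := ℂ) {((w₀, 0) : (BlockIndex n → ℂ) × ℂ)})
    have h3 := Submodule.finrank_le (LinearMap.range T)
    rw [Module.finrank_prod, Module.finrank_self] at h1
    simp only [Set.toFinset_singleton, Finset.card_singleton] at h2
    omega
  obtain ⟨⟨a, b⟩, hab⟩ := hsurj R
  exact ⟨a, b, fun p => congrFun hab p⟩

open Classical in
/-- The linear equations for the successive coefficients of a formal eigenvector in the regular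
singular case are solvable. -/
theorem exists_solution_of_not_isRoot {j : Fin s} (hnj : n j = 1) {μ' : ℂ}
    (hμ' : ¬ (pseudoCharpoly hn lam B (lam j) (n j)).IsRoot μ') (R : BlockIndex n → ℂ) :
    ∃ a : BlockIndex n → ℂ, ∀ p, principalPart lam B j a p -
      (if Active lam j p then μ' * a p else 0) = R p := by
  let T : (BlockIndex n → ℂ) →ₗ[ℂ] (BlockIndex n → ℂ) :=
    { toFun := fun a p => principalPart lam B j a p - (if Active lam j p then μ' * a p else 0)
      map_add' := fun x y => by
        funext p
        have := principalPart_add_smul lam B j x y 1 p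
        rw [one_smul] at this
        simp only [this, Pi.add_apply]
        split_ifs <;> ring
      map_smul' := fun c x => by
        funext p
        have h0 := principalPart_add_smul lam B j 0 x c p
        have h1 := principalPart_add_smul lam B j 0 0 (-1) p
        simp only [zero_add, smul_zero] at h0 h1
        have h2 : principalPart lam B j 0 p = 0 := by linear_combination h1
        rw [h2] at h0
        simp only [h0, Pi.smul_apply, smul_eq_mul, RingHom.id_apply]
        split_ifs <;> ring }
  have hinj : Function.Injective T := by
    rw [injective_iff_map_eq_zero]
    intro w hw0
    have hw : ∀ p, principalPart lam B j w p = if Active lam j p then μ' * w p else 0 :=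
      fun p => sub_eq_zero.mp (congrFun hw0 p)
    -- The inhomogeneous term is absent; since n_j = 1, the nonzero `μ` plays no role and is set to
    -- 1.
    have hp := pencil_of_kernel (hn := hn) (U := 0) (μ := 1) (b := 0) (w := w) one_ne_zero
      (Or.inl hnj) (by simpa using hw)
    refine eq_zero_of_kernel (hn := hn) (lam := lam) (j := j) (B := B) (μ := 1) one_ne_zero (Or.inl hnj) hw ?_
    refine eq_zero_of_not_isRoot hμ' (fun i hi => ?_) fun i hi => ?_
    · by_contra h
      exact hi (if_neg h)
    · rw [hp i hi, hnj]
      simp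
  obtain ⟨a, ha⟩ := LinearMap.injective_iff_surjective.mp hinj R
  exact ⟨a, fun p => congrFun ha p⟩

end Kernel

end
end ResonantConnection
end

/-! ### Ramified formal eigenvectors -/

noncomputable section

namespace ResonantConnection

section FormalEigenvector

open PowerSeries

/-- The series `f(z ^ m)`. -/
def pullback (m : ℕ) (f : ℂ⟦X⟧) : ℂ⟦X⟧ := mk fun k => if m ∣ k then coeff (k / m) f else 0

variable {s : ℕ} {n : Fin s → ℕ} {hn : ∀ j, 1 ≤ n j} {lam : Fin s → ℂ}
  {B : Matrix (BlockIndex n) (BlockIndex n) ℂ}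
  {Ahat : Matrix (BlockIndex n) (BlockIndex n) ℂ⟦X⟧}

open Classical in
/-- The leading coefficient with the eigenvalue of the `j`-th cell subtracted. -/
def nilpotentPart (lam : Fin s → ℂ) (j : Fin s) : Matrix (BlockIndex n) (BlockIndex n) ℂ :=
  fun p q => (Matrix.blockDiagonal' fun j => jordanCell (lam j) (n j)) p q -
    if p = q then lam j else 0

/-- The weights are chosen so that the leading coefficient minus λ_j is homogeneous. -/
theorem colOrder_eq_rowOrder_of_ne_zero {j : Fin s} {p q : BlockIndex n}
    (h : nilpotentPart lam j p q ≠ 0) : colOrder lam j q = rowOrder lam j p := by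
  classical
  obtain ⟨i, a⟩ := p
  obtain ⟨k, b⟩ := q
  by_cases hik : i = k
  · subst hik
    simp only [nilpotentPart, Matrix.blockDiagonal'_apply_eq, jordanCell, Matrix.of_apply] at h
    by_cases hab : a = b
    · subst hab
      simp only [if_true] at h
      have : lam i ≠ lam j := sub_ne_zero.mp h
      simp [colOrder, rowOrder, this]
    · have h2 : (⟨i, a⟩ : BlockIndex n) ≠ ⟨i, b⟩ := by simpa using hab
      rw [if_neg hab, if_neg h2, sub_zero] at h
      have h' : (b : ℕ) = a + 1 := by
        by_contra h'
        exact h (if_neg h')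
      simp [colOrder, rowOrder, h']
  · exfalso
    apply h
    rw [nilpotentPart, Matrix.blockDiagonal'_apply_ne _ _ _ hik, if_neg, sub_zero]
    intro h'
    exact hik (congrArg Sigma.fst h')

/-- The pullback has only exponents divisible by n_j, and row orders are at most n_j. So up to the
row order, A_(r-1) can enter only in rows of order n_j and columns of order 0; everything else there
comes from the homogeneous nilpotent part. -/
theorem coeff_pullback_sub_mul {j : Fin s} (hnj : 1 ≤ n j)
    (h0 : ∀ p q, coeff 0 (Ahat p q) =
      (Matrix.blockDiagonal' fun j => jordanCell (lam j) (n j)) p q)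
    (h1 : ∀ p q, coeff 1 (Ahat p q) = B p q) (p q : BlockIndex n) {l : ℕ}
    (hl : l ≤ rowOrder lam j p) :
    open Classical in
    coeff l ((pullback (n j) (Ahat p q) - if p = q then C (lam j) else 0) *
      X ^ colOrder lam j q) = if l = rowOrder lam j p then nilpotentPart lam j p q +
        (if (lam p.1 = lam j ∧ n j ≤ p.2 + 1) ∧ colOrder lam j q = 0 then B p q else 0)
      else 0 := by
  classical
  have hc0 : coeff 0 (pullback (n j) (Ahat p q) - if p = q then C (lam j) else 0) =
      nilpotentPart lam j p q := by
    rw [map_sub, pullback, coeff_mk, nilpotentPart]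
    simp only [dvd_zero, if_true, Nat.zero_div, h0]
    split_ifs <;> simp
  have hck : ∀ k, 1 ≤ k → coeff k (pullback (n j) (Ahat p q) - if p = q then C (lam j) else 0) =
      if n j ∣ k then coeff (k / n j) (Ahat p q) else 0 := by
    intro k hk
    rw [map_sub, pullback, coeff_mk]
    have : coeff k (if p = q then C (lam j) else (0 : ℂ⟦X⟧)) = 0 := by
      split_ifs
      · rw [coeff_C, if_neg (by omega)]
      · simp
    rw [this, sub_zero]
  have hrow : rowOrder lam j p ≤ n j := by
    unfold rowOrder; split_ifs <;> omega
  have hrow' : rowOrder lam j p = n j ↔ (lam p.1 = lam j ∧ n j ≤ p.2 + 1) := by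
    unfold rowOrder
    by_cases h : lam p.1 = lam j
    · simp only [h, if_true, true_and]; omega
    · simp only [h, if_false, false_and, iff_false]; omega
  rw [coeff_mul_X_pow']
  simp only [← hrow']
  by_cases hd : colOrder lam j q ≤ l
  · rw [if_pos hd]
    by_cases hdl : colOrder lam j q = l
    · rw [hdl, Nat.sub_self, hc0]
      by_cases hle : l = rowOrder lam j p
      · rw [if_pos hle, if_neg, add_zero]
        omega
      · rw [if_neg hle]
        by_contra hne
        exact hle (hdl ▸ colOrder_eq_rowOrder_of_ne_zero hne)
    · rw [hck _ (by omega)]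
      have hnil : l = rowOrder lam j p → nilpotentPart lam j p q = 0 := by
        intro hle
        by_contra hne
        exact hdl ((colOrder_eq_rowOrder_of_ne_zero hne).trans hle.symm)
      by_cases hfull : l = rowOrder lam j p ∧ rowOrder lam j p = n j ∧ colOrder lam j q = 0
      · obtain ⟨e1, e2, e3⟩ := hfull
        rw [if_pos e1, hnil e1, if_pos (And.intro e2 e3), e3, Nat.sub_zero, e1, e2,
          if_pos (dvd_refl (n j)), Nat.div_self hnj, h1, zero_add]
      · rw [if_neg (fun h => by have := Nat.le_of_dvd (by omega) h; omega)]
        split_ifs with e1 e2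
        · exact absurd ⟨e1, e2⟩ hfull
        · rw [hnil e1, add_zero]
        · rfl
  · rw [if_neg hd]
    split_ifs with e1 e2
    · omega
    · rw [add_zero]
      by_contra hne
      have := colOrder_eq_rowOrder_of_ne_zero (Ne.symm hne)
      omega
    · rfl

theorem sum_nilpotentPart_eq_principalPart (j : Fin s) (w : BlockIndex n → ℂ) (p : BlockIndex n) :
    open Classical in
    ∑ q, (nilpotentPart lam j p q + if (lam p.1 = lam j ∧ n j ≤ p.2 + 1) ∧ colOrder lam j q = 0
      then B p q else 0) * w q = principalPart lam B j w p := by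
  classical
  obtain ⟨i, a⟩ := p
  unfold principalPart nilpotentPart
  simp only [add_mul, sub_mul, Finset.sum_add_distrib, Finset.sum_sub_distrib]
  rw [jordan_mul_apply]
  simp only [ite_mul, zero_mul, Finset.sum_ite_eq, Finset.mem_univ, if_true]
  congr 1
  · ring
  · split_ifs with h
    · simp [h]
    · simp [h]

/-- Every cell carries a ramified formal eigenvector of the connection. -/
theorem exists_cell_eigenvector {ν : Fin s → ℂ} {U : Fin s → Fin s → ℂ}
    (hL : LidskiiBasis hn lam B ν U) {r : ℕ} (hr : 1 ≤ r)
    (hres : r = 1 → ∀ j, n j = 1 → ∀ μ ν : ℂ,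
      (pseudoCharpoly hn lam B (lam j) 1).IsRoot μ →
      (pseudoCharpoly hn lam B (lam j) 1).IsRoot ν → ∀ k : ℤ, μ - ν = k → k = 0)
    (h0 : ∀ p q, coeff 0 (Ahat p q) =
      (Matrix.blockDiagonal' fun j => jordanCell (lam j) (n j)) p q)
    (h1 : ∀ p q, coeff 1 (Ahat p q) = B p q) (j : Fin s) {μ : ℂ} (hμ0 : μ ≠ 0)
    (hμ : μ ^ n j = ν j) :
    ∃ (v : BlockIndex n → ℂ⟦X⟧) (Q : ℂ⟦X⟧),
      (∀ i, coeff 0 (v ⟨i, ⟨0, hn i⟩⟩) = U j i) ∧ coeff 0 Q = lam j ∧ coeff 1 Q = μ ∧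
      (∀ i, r * n j < i → coeff i Q = 0) ∧
      ∀ p, ∑ q, pullback (n j) (Ahat p q) * v q +
        C (n j : ℂ)⁻¹ * X ^ (r * n j) * theta (v p) = Q * v p := by
  classical
  have hnj := hn j
  have hN : 1 ≤ r * n j := Nat.mul_pos hr hnj
  have hκ : (n j : ℂ)⁻¹ ≠ 0 := inv_ne_zero (Nat.cast_ne_zero.mpr (by omega))
  set M : BlockIndex n → BlockIndex n → ℂ⟦X⟧ := fun p q =>
    (pullback (n j) (Ahat p q) - if p = q then C (lam j) else 0) * X ^ colOrder lam j q with hM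
  have hMc := fun p q l => coeff_pullback_sub_mul hnj h0 h1 p q (l := l)
  -- The pulled-back system with weighted columns, each row divided by its order; its constant term
  -- is the leading operator.
  let Bs : Matrix (BlockIndex n) (BlockIndex n) ℂ⟦X⟧ :=
    fun p q => mk fun k => coeff (k + rowOrder lam j p) (M p q)
  have hBs : ∀ p q, M p q = X ^ rowOrder lam j p * Bs p q := by
    intro p q
    ext l
    rw [coeff_X_pow_mul']
    split_ifs with h
    · rw [coeff_mk, Nat.sub_add_cancel h]
    · rw [hMc p q l (by omega), if_neg (by omega)]
  have hBs0 : ∀ (w : BlockIndex n → ℂ) p, ∑ q, constantCoeff (Bs p q) * w q =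
      principalPart lam B j w p := by
    intro w p
    rw [← sum_nilpotentPart_eq_principalPart]
    refine Finset.sum_congr rfl fun q _ => ?_
    rw [← coeff_zero_eq_constantCoeff_apply, coeff_mk, zero_add, hMc p q _ le_rfl, if_pos rfl]
  have hone : r * n j = 1 → r = 1 ∧ n j = 1 := mul_eq_one.mp
  have hdact : n j = 1 → ∀ p : BlockIndex n, Active lam j p → colOrder lam j p = 0 := by
    intro h p hp
    have := hp.2
    simp only [colOrder, hp.1, if_true]
    omega
  obtain ⟨w, Q, hw0, hQ0, hwQ⟩ := exists_formal_eigenvector Bs (Active lam j)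
    (fun p => (colOrder lam j p : ℂ)) (n j : ℂ)⁻¹ hN (leadingVector hn lam B j (U j) μ) μ
    (by
      intro p
      rw [hBs0, principalPart_leadingVector hL j hμ]
      by_cases hp : r * n j = 1 ∧ Active lam j p
      · simp [hdact (hone hp.1).2 p hp.2]
      · rw [if_neg hp, add_zero])
    (by
      intro k hk R
      -- Then r = n_j = 1 and κ = 1: at order k the derivation adds k on the active rows, so the
      -- eigenvalue becomes μ - k, which is not a root because k ≥ 1. No correction of Q is needed.
      by_cases hN1 : r * n j = 1
      · obtain ⟨hr1, hn1⟩ := hone hN1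
        have hroot := hL.isRoot j
        rw [hn1, ← hμ, hn1, pow_one] at hroot
        obtain ⟨a, ha⟩ := exists_solution_of_not_isRoot (hn := hn) (lam := lam) (B := B) hn1
          (μ' := μ - k) (by
            intro h
            rw [hn1] at h
            have := hres hr1 j hn1 _ _ hroot h k (by push_cast; ring)
            omega) R
        refine ⟨a, 0, fun p => ?_⟩
        rw [hBs0, ← ha p]
        by_cases hp : Active lam j p
        · rw [if_pos (And.intro hN1 hp), if_pos hp, if_pos hp, hdact hn1 p hp, hn1]
          push_cast
          ring
        · simp [hp]
      · obtain ⟨a, b, hab⟩ := exists_solution_of_simple hL hμ0 hμ R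
        refine ⟨a, b, fun p => ?_⟩
        rw [hBs0, ← hab p, if_neg (fun h => hN1 h.1), add_zero])
  -- Undoing the weights: the eigenvalue becomes λ_j + X Q, with linear coefficient μ.
  let v : BlockIndex n → ℂ⟦X⟧ := fun p => X ^ colOrder lam j p * w p
  have hv : ∀ p, ∑ q, pullback (n j) (Ahat p q) * v q +
      C (n j : ℂ)⁻¹ * X ^ (r * n j) * theta (v p) = (C (lam j) + X * Q) * v p := by
    intro p
    have e1 : ∑ q, pullback (n j) (Ahat p q) * v q =
        X ^ rowOrder lam j p * ∑ q, Bs p q * w q + C (lam j) * v p := by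
      have : C (lam j) * v p = ∑ q, (if p = q then C (lam j) else 0) * v q := by
        simp
      rw [this, Finset.mul_sum, ← Finset.sum_add_distrib]
      refine Finset.sum_congr rfl fun q _ => ?_
      rw [← mul_assoc (X ^ _), ← hBs, hM]
      simp only [v]
      ring
    have e2 := hwQ p
    unfold residual at e2
    have e3 : theta (v p) = X ^ colOrder lam j p * (theta (w p) + C (colOrder lam j p : ℂ) * w p) := by
      simp only [v]
      rw [theta_mul, theta_X_pow, map_natCast]
      ring
    rw [e1, e3, rowOrder_eq]
    simp only [v]
    by_cases hp : Active lam j p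
    · simp only [hp, if_true] at e2 ⊢
      obtain ⟨N, hN'⟩ : ∃ N, r * n j = N + 1 := ⟨r * n j - 1, by omega⟩
      rw [hN'] at e2 ⊢
      rw [Nat.add_sub_cancel] at e2
      linear_combination X ^ (colOrder lam j p + 1) * e2
    · simp only [hp, if_false] at e2 ⊢
      linear_combination X ^ (colOrder lam j p) * e2
  -- The scalar factor makes the eigenvalue a polynomial of degree at most r n_j; as f has constant
  -- term 1, the leading data are unchanged.
  obtain ⟨f, hf, hfv⟩ := exists_truncated_eigenvalue
    (Matrix.of fun p q => pullback (n j) (Ahat p q)) hκ (r * n j) v _ hv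
  refine ⟨fun p => f * v p, _, fun i => ?_, ?_, ?_, ?_, hfv⟩
  · simp only [v]
    have : colOrder lam j ⟨i, ⟨0, hn i⟩⟩ = 0 := by simp [colOrder]
    have h2 := congrFun (cellHead_leadingVector (hn := hn) (B := B) (hL.support j) μ) i
    rw [this, pow_zero, one_mul, coeff_zero_eq_constantCoeff_apply, map_mul, hf, one_mul, hw0]
    rw [← h2, cellHead]
    split_ifs with h
    · rfl
    · simp [leadingVector, h]
  · simp
  · rw [coeff_mk, if_pos hN, map_add, coeff_C, if_neg one_ne_zero, zero_add,
      show (1 : ℕ) = 0 + 1 from rfl, coeff_succ_X_mul, coeff_zero_eq_constantCoeff_apply, hQ0]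
  · intro i hi
    rw [coeff_mk, if_neg (by omega)]

end FormalEigenvector
end ResonantConnection
end

/-! ### From ramified eigenvectors to gauges -/

noncomputable section

namespace ResonantConnection
open FormalSeries

section Ramified

open PowerSeries

/-- The part of `f` with exponents congruent to `b` modulo `m`. -/
def sector (m b : ℕ) (f : ℂ⟦X⟧) : ℂ⟦X⟧ := mk fun k => coeff (b + m * k) f

/-- The coefficients of a power series, extended by zero to negative degrees. -/
def zcoeff (f : ℂ⟦X⟧) (k : ℤ) : ℂ := xcoeff (HahnSeries.ofPowerSeries ℤ ℂ f) (-k)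

theorem zcoeff_natCast (f : ℂ⟦X⟧) (k : ℕ) : zcoeff f k = coeff k f := xcoeff_ofPowerSeries f k

theorem zcoeff_of_neg (f : ℂ⟦X⟧) {k : ℤ} (hk : k < 0) : zcoeff f k = 0 :=
  xcoeff_ofPowerSeries_of_pos f (by omega)

theorem zcoeff_sub (f g : ℂ⟦X⟧) (k : ℤ) : zcoeff (f - g) k = zcoeff f k - zcoeff g k := by
  rw [zcoeff, map_sub, xcoeff_sub]; rfl

theorem zcoeff_C_mul (c : ℂ) (f : ℂ⟦X⟧) (k : ℤ) : zcoeff (C c * f) k = c * zcoeff f k := by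
  rw [zcoeff, map_mul, HahnSeries.ofPowerSeries_C, xcoeff_C_mul]; rfl

theorem zcoeff_X_pow_mul (N : ℕ) (f : ℂ⟦X⟧) (k : ℤ) :
    zcoeff (X ^ N * f) k = zcoeff f (k - N) := by
  rw [zcoeff, map_mul, HahnSeries.ofPowerSeries_X_pow,
    show HahnSeries.single (N : ℤ) (1 : ℂ) = x ^ (-(N : ℤ)) by rw [x_zpow, neg_neg],
    xcoeff_zpow_mul, zcoeff]
  congr 1
  ring

theorem zcoeff_theta (f : ℂ⟦X⟧) (k : ℤ) : zcoeff (theta f) k = k * zcoeff f k := by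
  rcases lt_or_ge k 0 with h | h
  · rw [zcoeff_of_neg _ h, zcoeff_of_neg _ h, mul_zero]
  · obtain ⟨m, rfl⟩ := Int.eq_ofNat_of_zero_le h
    rw [zcoeff_natCast, zcoeff_natCast, coeff_theta]
    push_cast
    rfl

theorem zcoeff_mul_of_truncated {Q : ℂ⟦X⟧} {N : ℕ} (hQ : ∀ i, N < i → coeff i Q = 0)
    (f : ℂ⟦X⟧) (k : ℤ) :
    zcoeff (Q * f) k = ∑ i ∈ Finset.range (N + 1), coeff i Q * zcoeff f (k - i) := by
  have h : Q = ∑ i ∈ Finset.range (N + 1), C (coeff i Q) * X ^ i := by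
    ext l
    rw [map_sum]
    simp only [coeff_C_mul, coeff_X_pow, mul_ite, mul_one, mul_zero, Finset.sum_ite_eq,
      Finset.mem_range]
    split_ifs with h
    · rfl
    · exact hQ l (by omega)
  conv_lhs => rw [h, Finset.sum_mul, zcoeff, map_sum, xcoeff_sum]
  refine Finset.sum_congr rfl fun i _ => ?_
  change zcoeff _ _ = _
  rw [mul_assoc, zcoeff_C_mul, zcoeff_X_pow_mul]

theorem xcoeff_sector {m : ℕ} (b : Fin m) (f : ℂ⟦X⟧) (k : ℤ) :
    xcoeff (HahnSeries.ofPowerSeries ℤ ℂ (sector m b f)) k = zcoeff f ((b : ℕ) - m * k) := by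
  rcases lt_or_ge 0 k with h | h
  · rw [xcoeff_ofPowerSeries_of_pos _ h, zcoeff_of_neg]
    have := b.2
    nlinarith
  · obtain ⟨l, rfl⟩ : ∃ l : ℕ, k = -(l : ℤ) := ⟨(-k).toNat, by omega⟩
    rw [xcoeff_ofPowerSeries, sector, coeff_mk, ← zcoeff_natCast]
    congr 1
    push_cast
    ring

/-- Multiplication by a series in z^m preserves exponents modulo m, so it acts on each sector as the
original series. -/
theorem sector_pullback_mul {m : ℕ} (hm : 1 ≤ m) (b : Fin m) (f g : ℂ⟦X⟧) :
    sector m b (pullback m f * g) = f * sector m b g := by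
  ext k
  rw [sector, coeff_mk, coeff_mul, coeff_mul]
  symm
  refine Finset.sum_of_injOn (fun i => (m * i.1, (b : ℕ) + m * i.2)) ?_ ?_ ?_ ?_
  · rintro ⟨i, l⟩ - ⟨i', l'⟩ - h
    simp only [Prod.mk.injEq, add_right_inj, mul_eq_mul_left_iff] at h ⊢
    omega
  · rintro ⟨i, l⟩ h
    simp only [Finset.mem_coe, Finset.HasAntidiagonal.mem_antidiagonal] at h ⊢
    rw [← h]; ring
  · rintro ⟨i, l⟩ h h'
    simp only [Finset.HasAntidiagonal.mem_antidiagonal] at h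
    simp only [pullback, coeff_mk]
    rw [if_neg, zero_mul]
    rintro ⟨i', rfl⟩
    apply h'
    have hb := b.2
    have hi : i' ≤ k := by
      by_contra hc
      nlinarith
    refine ⟨(i', k - i'), by simp [hi], ?_⟩
    simp only [Prod.mk.injEq, true_and]
    obtain ⟨e, rfl⟩ := Nat.exists_eq_add_of_le hi
    rw [Nat.add_sub_cancel_left]
    nlinarith
  · rintro ⟨i, l⟩ _
    simp only [pullback, sector, coeff_mk, dvd_mul_right, if_true]
    rw [Nat.mul_div_cancel_left _ (by omega)]

variable {s : ℕ} {n : Fin s → ℕ} {r : ℕ}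

/-- The gauge whose blocks of columns are the sectors of ramified eigenvectors. -/
def sectorMatrix (n : Fin s → ℕ) (v : Fin s → BlockIndex n → ℂ⟦X⟧) :
    Matrix (BlockIndex n) (BlockIndex n) ℂ⟦X⟧ :=
  fun p q => sector (n q.1) q.2 (v q.1 p)

/-- Ramified eigenvectors of a connection provide solutions of the gauge equation. -/
theorem sectorMatrix_eqn (hn : ∀ j, 1 ≤ n j)
    {A : Matrix (BlockIndex n) (BlockIndex n) FormalSeries}
    {Ahat : Matrix (BlockIndex n) (BlockIndex n) ℂ⟦X⟧}
    (hA : ∀ p q, A p q = x ^ ((r : ℤ) - 1) * HahnSeries.ofPowerSeries ℤ ℂ (Ahat p q))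
    {v : Fin s → BlockIndex n → ℂ⟦X⟧} {Q : Fin s → ℂ⟦X⟧}
    (hQ : ∀ j i, r * n j < i → coeff i (Q j) = 0)
    (hv : ∀ j p, ∑ q, pullback (n j) (Ahat p q) * v j q +
        C (n j : ℂ)⁻¹ * X ^ (r * n j) * theta (v j p) = Q j * v j p) :
    A * (sectorMatrix n v).map (HahnSeries.ofPowerSeries ℤ ℂ) -
        ((sectorMatrix n v).map (HahnSeries.ofPowerSeries ℤ ℂ)).map ddx =
      (sectorMatrix n v).map (HahnSeries.ofPowerSeries ℤ ℂ) *
        normalForm r n fun j J => n j * coeff (r * n j - J) (Q j) := by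
  refine Matrix.ext fun p ⟨j, b⟩ => ?_
  have hnj := hn j
  have hnj' : (n j : ℂ) ≠ 0 := Nat.cast_ne_zero.mpr (by omega)
  apply mul_left_cancel₀ (mul_ne_zero (natCast_ne_zero (m := n j) (by omega)) x_ne_zero)
  rw [mul_normalForm_apply hn]
  refine xcoeff_ext fun k => ?_
  set Y := (sectorMatrix n v).map (HahnSeries.ofPowerSeries ℤ ℂ) with hY
  have hYx : ∀ (b : Fin (n j)) k, xcoeff (Y p ⟨j, b⟩) k = zcoeff (v j p) ((b : ℕ) - n j * k) :=
    fun b k => xcoeff_sector b (v j p) k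
  have hAY : x * (A * Y) p ⟨j, b⟩ = x ^ (r : ℤ) * HahnSeries.ofPowerSeries ℤ ℂ
      (sector (n j) b (∑ q, pullback (n j) (Ahat p q) * v j q)) := by
    have h1 : sector (n j) b (∑ q, pullback (n j) (Ahat p q) * v j q) =
        ∑ q, Ahat p q * sector (n j) b (v j q) := by
      simp_rw [← sector_pullback_mul hnj]
      ext k
      simp [sector, map_sum]
    rw [h1, map_sum, Finset.mul_sum, Matrix.mul_apply, Finset.mul_sum]
    refine Finset.sum_congr rfl fun q _ => ?_
    rw [hA, map_mul, show (r : ℤ) = 1 + (r - 1) by ring, zpow_add₀ x_ne_zero, zpow_one,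
      add_sub_cancel_left]
    simp only [hY, Matrix.map_apply, sectorMatrix]
    ring
  rw [Matrix.sub_apply, mul_assoc, mul_sub, hAY, Matrix.map_apply, xcoeff_natCast_mul, xcoeff_sub,
    xcoeff_x_mul_ddx, xcoeff_zpow_mul, xcoeff_sector, eq_sub_of_add_eq (hv j p), zcoeff_sub,
    zcoeff_mul_of_truncated (hQ j), mul_assoc, zcoeff_C_mul, zcoeff_X_pow_mul, zcoeff_theta,
    xcoeff_sub, xcoeff_sum, xcoeff_natCast_mul, hYx]
  have hR : ∀ J ∈ Finset.range (r * n j + 1),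
      xcoeff (HahnSeries.C (n j * coeff (r * n j - J) (Q j)) *
        colExt (hn j) (fun b => Y p ⟨j, b⟩) ((b : ℕ) + (J : ℕ))) k =
      n j * (coeff (r * n j - J) (Q j) * zcoeff (v j p)
        ((b : ℕ) - n j * (k - r) - ((r * n j - J : ℕ) : ℤ))) := by
    intro J hJ
    have := Finset.mem_range.mp hJ
    rw [xcoeff_C_mul, xcoeff_colExt, hYx, mul_assoc]
    congr 3
    have h2 := residue_add_ediv (hn j) ((b : ℕ) + (J : ℕ))
    rw [Nat.cast_sub (by omega)]
    push_cast
    linear_combination h2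
  rw [Finset.sum_congr rfl hR, ← Finset.mul_sum]
  -- Multiplication by z corresponds to the inverse shift and x^r to its power r n_j; so the i-th
  -- coefficient of Q belongs to J = r n_j - i.
  have hflip := Finset.sum_range_reflect (fun i => coeff i (Q j) * zcoeff (v j p)
    ((b : ℕ) - n j * (k - r) - (i : ℤ))) (r * n j + 1)
  simp only [Nat.add_sub_cancel_right] at hflip
  rw [hflip]
  have h3 : ((b : ℕ) - n j * (k - r) - ((r * n j : ℕ) : ℤ) : ℤ) = (b : ℕ) - n j * k := by
    push_cast; ring
  rw [h3]
  push_cast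
  field_simp
  ring

end Ramified
end ResonantConnection
end

/-! ### Existence of the normalizing gauge -/

noncomputable section

namespace ResonantConnection
open FormalSeries

section Existence

open PowerSeries

variable {s : ℕ} {n : Fin s → ℕ} {r : ℕ} {hn : ∀ j, 1 ≤ n j} {lam : Fin s → ℂ}
  {B : Matrix (BlockIndex n) (BlockIndex n) ℂ} {ν : Fin s → ℂ} {U : Fin s → Fin s → ℂ}

/-- The block diagonal matrix of upper triangular Toeplitz blocks with entries `q j (b - a)`. -/
def toeplitz (n : Fin s → ℕ) (q : Fin s → ℕ → ℂ) : Matrix (BlockIndex n) (BlockIndex n) ℂ :=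
  Matrix.blockDiagonal' fun j => Matrix.of fun a b : Fin (n j) =>
    if (a : ℕ) ≤ b then q j (b - a) else 0

theorem toeplitz_mulVec_apply (q : Fin s → ℕ → ℂ) (c : BlockIndex n → ℂ) (j : Fin s)
    (a : Fin (n j)) : (toeplitz n q).mulVec c ⟨j, a⟩ =
      ∑ b : Fin (n j), (if (a : ℕ) ≤ b then q j (b - a) else 0) * c ⟨j, b⟩ := by
  rw [Matrix.mulVec, dotProduct, Fintype.sum_sigma, Finset.sum_eq_single j]
  · simp [toeplitz, Matrix.blockDiagonal'_apply_eq]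
  · intro k _ hk
    refine Finset.sum_eq_zero fun b _ => ?_
    rw [toeplitz, Matrix.blockDiagonal'_apply_ne _ _ _ hk.symm, zero_mul]
  · simp

/-- In the last row where an eigenvector is nonzero the diagonal entry must equal the eigenvalue.
The row before it, if there is one, would then force the nonzero superdiagonal entry to kill that
component. -/
theorem toeplitz_eigenvector_support {q : Fin s → ℕ → ℂ} (hq : ∀ j, q j 1 ≠ 0)
    {c : BlockIndex n → ℂ} {e : ℂ} (h : (toeplitz n q).mulVec c = e • c) (j : Fin s)
    (a : Fin (n j)) (ha : c ⟨j, a⟩ ≠ 0) : q j 0 = e ∧ (a : ℕ) = 0 := by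
  classical
  obtain ⟨b, hb, hmax⟩ := Finset.exists_max_image (Finset.univ.filter fun b => c ⟨j, b⟩ ≠ 0)
    (fun b : Fin (n j) => (b : ℕ)) ⟨a, by simpa using ha⟩
  have hb' : c ⟨j, b⟩ ≠ 0 := by simpa using hb
  have hgt : ∀ b' : Fin (n j), (b : ℕ) < b' → c ⟨j, b'⟩ = 0 := by
    intro b' hlt
    by_contra hne
    have := hmax b' (by simpa using hne)
    omega
  have e1 := congrFun h ⟨j, b⟩
  rw [toeplitz_mulVec_apply, Finset.sum_eq_single b] at e1
  · rw [if_pos le_rfl, Nat.sub_self, Pi.smul_apply, smul_eq_mul] at e1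
    have hqe : q j 0 = e := mul_right_cancel₀ hb' e1
    refine ⟨hqe, ?_⟩
    have hab : (a : ℕ) ≤ b := hmax a (by simpa using ha)
    by_contra hne
    have hb2 := b.2
    have e2 := congrFun h ⟨j, ⟨b - 1, by omega⟩⟩
    rw [toeplitz_mulVec_apply, Finset.sum_eq_add ⟨b - 1, by omega⟩ b
      (by rw [Ne, Fin.ext_iff]; simp only; omega)] at e2
    · simp only [le_refl, if_true, Nat.sub_self, Pi.smul_apply, smul_eq_mul,
        show (b : ℕ) - 1 ≤ b by omega, show (b : ℕ) - (b - 1) = 1 by omega, hqe] at e2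
      exact mul_ne_zero (hq j) hb' (by linear_combination e2)
    · rintro b' - ⟨h1, h2⟩
      rcases lt_or_ge (b : ℕ) b' with h3 | h3
      · rw [hgt b' h3, mul_zero]
      · rw [if_neg, zero_mul]
        rw [Ne, Fin.ext_iff] at h1 h2
        simp only at h1 ⊢
        omega
    · simp
    · simp
  · intro b' _ hne
    rcases lt_or_ge (b : ℕ) b' with h3 | h3
    · rw [hgt b' h3, mul_zero]
    · rw [if_neg, zero_mul]
      rw [Ne, Fin.ext_iff] at hne
      omega
  · simp

/-- The relation J Y = Y T, T the Toeplitz matrix, makes the kernel of Y invariant under T, so a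
nontrivial kernel contains an eigenvector of T. Supported on first indices, it gives a linear
relation between the vectors U. -/
theorem det_ne_zero_of_toeplitz (hL : LidskiiBasis hn lam B ν U)
    {J Y : Matrix (BlockIndex n) (BlockIndex n) ℂ} {q : Fin s → ℕ → ℂ}
    (hq : ∀ j, q j 1 ≠ 0) (hJY : J * Y = Y * toeplitz n q)
    (hU : ∀ i j, Y ⟨i, ⟨0, hn i⟩⟩ ⟨j, ⟨0, hn j⟩⟩ = U j i) : Y.det ≠ 0 := by
  classical
  intro hdet
  obtain ⟨c₀, hc₀, hYc₀⟩ := Matrix.exists_mulVec_eq_zero_iff.mpr hdet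
  let K := LinearMap.ker Y.mulVecLin
  have hinv : ∀ c ∈ K, (toeplitz n q).mulVecLin c ∈ K := by
    intro c hc
    have hc' : Y.mulVec c = 0 := hc
    change Y.mulVec ((toeplitz n q).mulVec c) = 0
    rw [Matrix.mulVec_mulVec, ← hJY, ← Matrix.mulVec_mulVec, hc', Matrix.mulVec_zero]
  have : Nontrivial K := ⟨⟨⟨c₀, hYc₀⟩, 0, fun h => hc₀ (congrArg Subtype.val h)⟩⟩
  obtain ⟨e, he⟩ := Module.End.exists_eigenvalue
    ((toeplitz n q).mulVecLin.restrict hinv : Module.End ℂ K)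
  obtain ⟨⟨c, hcK⟩, hc1, hc2⟩ := he.exists_hasEigenvector
  have hc0 : c ≠ 0 := fun h => hc2 (Subtype.ext h)
  have heig : (toeplitz n q).mulVec c = e • c :=
    congrArg Subtype.val (Module.End.mem_eigenspace_iff.mp hc1)
  have hYc : Y.mulVec c = 0 := hcK
  have hsupp := toeplitz_eigenvector_support hq heig
  obtain ⟨⟨j₁, a₁⟩, hj₁⟩ := Function.ne_iff.mp hc0
  have hz : ∀ j a, c ⟨j, a⟩ ≠ 0 → a = ⟨0, hn j⟩ := fun j a h => Fin.ext (hsupp j a h).2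
  -- Take the smallest size in the support. Since U k vanishes on cells smaller than the k-th, on
  -- rows of this size only cells of this very size contribute, and `indep` applies.
  obtain ⟨j, hj, hmin⟩ := Finset.exists_min_image
    (Finset.univ.filter fun k => c ⟨k, ⟨0, hn k⟩⟩ ≠ 0) n
    ⟨j₁, Finset.mem_filter.mpr ⟨Finset.mem_univ _, by rw [← hz j₁ a₁ hj₁]; exact hj₁⟩⟩
  have hj' : c ⟨j, ⟨0, hn j⟩⟩ ≠ 0 := by simpa using hj
  refine hj' (hL.indep j (fun k => c ⟨k, ⟨0, hn k⟩⟩) (fun i hi hni => ?_) j rfl rfl)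
  have e1 := congrFun hYc ⟨i, ⟨0, hn i⟩⟩
  rw [Matrix.mulVec, dotProduct, Fintype.sum_sigma] at e1
  refine Eq.trans (Finset.sum_congr rfl fun k _ => ?_) e1
  rw [Finset.sum_eq_single ⟨0, hn k⟩, hU]
  · by_cases hk : c ⟨k, ⟨0, hn k⟩⟩ = 0
    · simp [hk]
    · by_cases hUk : U k i = 0
      · simp [hUk]
      · have h1 := hL.support k i hUk
        have h2 := hmin k (by simpa using hk)
        have h3 : n k ≤ n i := h1.2
        rw [if_pos ⟨h1.1.symm.trans hi, by omega⟩, mul_comm]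
  · intro b _ hb
    by_contra hne
    exact hb (hz k b (right_ne_zero_of_mul hne))
  · simp

/-- A normalizing gauge with nonresonant parameters exists. -/
theorem exists_nonresonant_gauge (hr : 1 ≤ r)
    {A : Matrix (BlockIndex n) (BlockIndex n) FormalSeries}
    (hdeg : ∀ k : ℤ, (r : ℤ) - 1 < k → coeffMatrix A k = 0)
    (hlead : coeffMatrix A ((r : ℤ) - 1)
      = Matrix.blockDiagonal' fun j => jordanCell (lam j) (n j))
    (hgen : LidskiiGeneric hn lam (coeffMatrix A ((r : ℤ) - 2)))
    (hres : r = 1 → ∀ j, n j = 1 → ∀ μ ν : ℂ,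
      (pseudoCharpoly hn lam (coeffMatrix A ((r : ℤ) - 2)) (lam j) 1).IsRoot μ →
      (pseudoCharpoly hn lam (coeffMatrix A ((r : ℤ) - 2)) (lam j) 1).IsRoot ν →
      ∀ k : ℤ, μ - ν = k → k = 0) :
    ∃ Y t, IsNormalizingGauge r n lam A Y t ∧ IsNonresonant r n lam t := by
  classical
  obtain ⟨ν, U, hL⟩ := exists_lidskiiBasis hgen
  have hν := hL.ne_zero hgen
  -- The choice of an n_j-th root of the pseudovalue is the choice of a determination of x^(1/n_j).
  choose μ hμ using fun j => IsAlgClosed.exists_pow_nat_eq (ν j) (hn j)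
  have hμ0 : ∀ j, μ j ≠ 0 := fun j h => hν j (by
    rw [← hμ j, h, zero_pow (by have := hn j; omega)])
  choose Ahat hA using fun p q => exists_zpow_mul_ofPowerSeries (f := A p q) (K := (r : ℤ) - 1)
    (fun k hk => congrFun (congrFun (hdeg k hk) p) q)
  have hA0 : ∀ p q, coeff 0 (Ahat p q) =
      (Matrix.blockDiagonal' fun j => jordanCell (lam j) (n j)) p q := by
    intro p q
    rw [← xcoeff_zpow_mul_ofPowerSeries ((r : ℤ) - 1), ← hA, ← hlead]
    simp [coeffMatrix]
  have hA1 : ∀ p q, coeff 1 (Ahat p q) = coeffMatrix A ((r : ℤ) - 2) p q := by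
    intro p q
    rw [← xcoeff_zpow_mul_ofPowerSeries ((r : ℤ) - 1), ← hA, coeffMatrix, Matrix.map_apply]
    congr 1
    push_cast
    ring
  choose v Q hvU hQ0 hQ1 hQN hv using fun j =>
    exists_cell_eigenvector (Ahat := Ahat) hL hr hres hA0 hA1 j (hμ0 j) (hμ j)
  set Z := sectorMatrix n v with hZ
  set t : Fin s → ℕ → ℂ := fun j J => n j * coeff (r * n j - J) (Q j) with ht
  have hN : ∀ j, n j ≤ r * n j := fun j => Nat.le_mul_of_pos_left _ hr
  have hdet : IsUnit Z.det := by
    rw [PowerSeries.isUnit_iff_constantCoeff, RingHom.map_det, isUnit_iff_ne_zero]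
    -- The coefficients of order b < n_j of the eigenvector equations form the relation J Y_0 = Y_0
    -- T: the derivation starts at order r n_j ≥ n_j, and of the pullback only the constant term is
    -- visible.
    refine det_ne_zero_of_toeplitz hL (q := fun j i => coeff i (Q j)) (J :=
      Matrix.blockDiagonal' fun j => jordanCell (lam j) (n j))
      (fun j => by rw [hQ1]; exact hμ0 j) ?_ (fun i j => ?_)
    · ext p ⟨j, b⟩
      have e := congrArg (coeff (b : ℕ)) (hv j p)
      have hb := b.2
      have hNj := hN j
      rw [map_add, mul_assoc, coeff_C_mul, coeff_X_pow_mul', if_neg (by omega), mul_zero, add_zero,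
        map_sum] at e
      rw [Matrix.mul_apply, Matrix.mul_apply]
      refine Eq.trans (Finset.sum_congr rfl fun q _ => ?_) (e.trans ?_)
      · rw [coeff_mul, Finset.sum_eq_single (0, (b : ℕ))]
        · simp [pullback, hZ, sectorMatrix, sector, ← hA0]
        · rintro ⟨i, l⟩ h1 h2
          simp only [Finset.HasAntidiagonal.mem_antidiagonal] at h1
          simp only [pullback, coeff_mk]
          rw [if_neg, zero_mul]
          intro h3
          rcases Nat.eq_zero_or_pos i with h4 | h4
          · exact h2 (by rw [h4, ← h1, h4, zero_add])
          · have := Nat.le_of_dvd h4 h3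
            omega
        · intro h
          exact absurd (by simp [Finset.HasAntidiagonal.mem_antidiagonal]) h
      · rw [mul_comm, coeff_mul, Fintype.sum_sigma, Finset.sum_eq_single j]
        · rw [Finset.Nat.sum_antidiagonal_eq_sum_range_succ
            (fun a i => coeff a (v j p) * coeff i (Q j))]
          have h1 := Fin.sum_univ_eq_sum_range (fun a => coeff a (v j p) *
            if a ≤ (b : ℕ) then coeff (b - a) (Q j) else 0) (n j)
          refine Eq.trans (Eq.trans ?_ h1.symm) (Finset.sum_congr rfl fun a _ => ?_)
          · refine Eq.trans (Finset.sum_congr rfl fun a ha => ?_)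
              (Finset.sum_subset (Finset.range_mono (show (b : ℕ).succ ≤ n j by omega))
                fun a _ ha => ?_)
            · have := Finset.mem_range.mp ha
              rw [if_pos (by omega)]
            · have : ¬ a < (b : ℕ).succ := fun h => ha (Finset.mem_range.mpr h)
              rw [if_neg (by omega), mul_zero]
          · simp [toeplitz, Matrix.blockDiagonal'_apply_eq, hZ, sectorMatrix, sector]
        · intro k _ hk
          refine Finset.sum_eq_zero fun a _ => ?_
          rw [toeplitz, Matrix.blockDiagonal'_apply_ne _ _ _ hk, mul_zero]
        · simp
    · simpa [hZ, sectorMatrix, sector] using hvU j i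
  refine ⟨Z.map (HahnSeries.ofPowerSeries ℤ ℂ), t, ⟨isFormalGauge_iff.mpr ⟨Z, rfl, hdet⟩,
    fun j => ?_, ?_⟩, ?_, ?_, ?_⟩
  · simp [ht, hQ0]
  · rw [gauge_eq_iff (isFormalGauge_iff.mpr ⟨Z, rfl, hdet⟩).isUnit_det]
    exact sectorMatrix_eqn hn hA hQN hv
  all_goals
    -- The subleading parameter is n_j μ_j. Its n_j-th power is therefore n_j^(n_j) times the
    -- pseudovalue, and nonresonance becomes distinctness of the pseudovalues, modulo integers when
    -- r n_j = 1.
    have htop : ∀ j, t j (r * n j - 1) = n j * μ j := fun j => by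
      have h1 := hn j
      have h2 := hN j
      rw [ht, ← hQ1 j]
      simp only
      rw [show r * n j - (r * n j - 1) = 1 by omega]
  · intro j _
    have h1 := hn j
    rw [htop]
    exact mul_ne_zero (Nat.cast_ne_zero.mpr (by omega)) (hμ0 j)
  · intro i j hl hs hrn k hk
    obtain ⟨h1, h2⟩ := mul_eq_one.mp hrn
    have e1 := htop i
    have e2 := htop j
    rw [hs, hrn, h2, Nat.sub_self, Nat.cast_one, one_mul] at e1
    rw [hrn, h2, Nat.sub_self, Nat.cast_one, one_mul] at e2
    have e3 := hμ i
    have e4 := hμ j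
    rw [hs, h2, pow_one] at e3
    rw [h2, pow_one] at e4
    rw [e1, e2, e3, e4] at hk
    have hi := hL.isRoot i
    have hj := hL.isRoot j
    rw [hl, hs, h2] at hi
    rw [h2] at hj
    have hk0 := hres h1 j h2 _ _ hi hj k hk
    rw [hk0, Int.cast_zero, sub_eq_zero] at hk
    exact hL.injective i j hl.symm hs.symm hk
  · intro i j hl hs _ hp
    refine hL.injective i j hl.symm hs.symm ?_
    have e1 := htop i
    rw [hs] at e1
    rw [e1, htop j, mul_pow, mul_pow, hμ j, ← hs, hμ i, hs] at hp
    have h1 := hn j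
    exact mul_left_cancel₀ (pow_ne_zero _ (Nat.cast_ne_zero.mpr (by omega))) hp

end Existence
end ResonantConnection
end

/-! ### The derivative of the bare solution -/

noncomputable section

namespace ResonantConnection

/-- Commutation allows factoring exp S(u) = exp(S(u) - S(w)) exp S(w), which leaves only the
derivative of exp at 0. -/
theorem hasDerivAt_exp_of_commute {𝔸 : Type*} [NormedRing 𝔸] [NormedAlgebra ℂ 𝔸]
    [CompleteSpace 𝔸] {S : ℂ → 𝔸} {S' : 𝔸} {w : ℂ} (hS : HasDerivAt S S' w)
    (hc : ∀ u, Commute (S u) (S w)) :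
    HasDerivAt (fun u => NormedSpace.exp (S u)) (S' * NormedSpace.exp (S w)) w := by
  let _ : NormedAlgebra ℚ 𝔸 := NormedAlgebra.restrictScalars ℚ ℂ 𝔸
  have h1 : (fun u => NormedSpace.exp (S u)) =
      fun u => NormedSpace.exp (S u - S w) * NormedSpace.exp (S w) := by
    funext u
    rw [← NormedSpace.exp_add_of_commute ((hc u).sub_left (Commute.refl _)), sub_add_cancel]
  rw [h1]
  have h2 : HasFDerivAt (NormedSpace.exp : 𝔸 → 𝔸) (1 : 𝔸 →L[ℂ] 𝔸) (S w - S w) := by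
    rw [sub_self]
    exact hasFDerivAt_exp_zero
  have h3 := h2.comp_hasDerivAt w (hS.sub_const (S w))
  exact HasDerivAt.mul_const h3 _

theorem logDeriv_algebra {𝔸 : Type*} [Ring 𝔸] [Algebra ℂ 𝔸] {H E S : 𝔸} (G V : 𝔸) (e : ℂ)
    {τ τ₀ κ : ℂ} (hτ : τ = τ₀ * κ) (h : H * E = τ₀ • E + E * S) :
    e • (-(κ • G) * E * V + E * (κ • S * V)) + (e * τ) • (E * V) =
      κ • (H - G) * e • (E * V) := by
  rw [hτ, smul_mul_smul_comm, sub_mul, ← mul_assoc H, h]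
  simp only [add_mul, neg_mul, smul_mul_assoc, mul_smul_comm, mul_assoc]
  module

section BareBlock

variable {m : ℕ}

/-- The matrix `x ^ (- G / m)`, `G = diag (0, 1, …, m - 1)`. -/
def twist (m : ℕ) (w : ℂ) : Matrix (Fin m) (Fin m) ℂ :=
  Matrix.diagonal fun a => Complex.exp (-((a : ℕ) : ℂ) / m * w)

theorem twist_mul_twist_neg (w : ℂ) : twist m w * twist m (-w) = 1 := by
  rw [twist, twist, Matrix.diagonal_mul_diagonal, ← Matrix.diagonal_one]
  congr 1
  funext a
  rw [← Complex.exp_add, ← Complex.exp_zero]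
  congr 1
  ring

theorem isUnit_twist (w : ℂ) : IsUnit (twist m w) :=
  IsUnit.of_mul_eq_one (twist m (-w)) (twist_mul_twist_neg w)

theorem twist_inv (w : ℂ) : (twist m w)⁻¹ = twist m (-w) :=
  Matrix.inv_eq_right_inv (twist_mul_twist_neg w)

/-- Conjugation by x^(-G/m) multiplies the (a, b) entry by x^((b-a)/m). With the prefactor x^(1/m)
this is 1 below the diagonal and x in the corner, where b - a = m - 1. -/
theorem shiftMatrix_exp (hm : 1 ≤ m) (w : ℂ) : shiftMatrix m (Complex.exp w) =
    Complex.exp (w / m) • (twist m w * shiftMatrix m 1 * (twist m w)⁻¹) := by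
  have hm' : (m : ℂ) ≠ 0 := Nat.cast_ne_zero.mpr (by omega)
  rw [twist_inv]
  ext a b
  rw [Matrix.smul_apply, twist, twist, Matrix.mul_diagonal, Matrix.diagonal_mul, smul_eq_mul]
  simp only [shiftMatrix, Matrix.of_apply]
  split_ifs with h1 h2
  · rw [mul_one, ← Complex.exp_add, ← Complex.exp_add, ← Complex.exp_zero]
    congr 1
    rw [h1]
    push_cast
    ring
  · rw [mul_one, ← Complex.exp_add, ← Complex.exp_add]
    congr 1
    have h3 : ((b : ℕ) : ℂ) + 1 = m := by exact_mod_cast h2.2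
    rw [h2.1]
    field_simp
    linear_combination (-1) * w * h3
  · ring

theorem shiftMatrix_exp_pow (hm : 1 ≤ m) (w : ℂ) (J : ℕ) :
    shiftMatrix m (Complex.exp w) ^ J =
      Complex.exp (J * w / m) • (twist m w * shiftMatrix m 1 ^ J * (twist m w)⁻¹) := by
  have h : twist m w * shiftMatrix m 1 ^ J * (twist m w)⁻¹ =
      (twist m w * shiftMatrix m 1 * (twist m w)⁻¹) ^ J := by
    obtain ⟨u, hu⟩ := isUnit_twist (m := m) w
    rw [← hu, ← Matrix.coe_units_inv, Units.conj_pow]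
  rw [shiftMatrix_exp hm, smul_pow, ← Complex.exp_nat_mul, mul_div_assoc, h]

/-- The exponent of the bare solution in the frame in which it has constant directions. -/
def untwistedExponent (r m : ℕ) (t : ℕ → ℂ) (w : ℂ) : Matrix (Fin m) (Fin m) ℂ :=
  ∑ J ∈ Finset.Icc 1 (r * m), (t J / J * Complex.exp (J * w / m)) • shiftMatrix m (1 : ℂ) ^ J

/-- The twist passes through the exponential and cancels against the diagonal factor x^(-G/m). What
remains is a scalar power, the twist, and the exponential of a polynomial in the constant matrix
H(1). -/
theorem bareBlock_eq (hm : 1 ≤ m) (r : ℕ) (t : ℕ → ℂ) (w : ℂ) :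
    bareBlock r m t w = Complex.exp (t 0 / m * w) •
      (twist m w * NormedSpace.exp (untwistedExponent r m t w)) := by
  have h1 : ∑ J ∈ Finset.Icc 1 (r * m), (t J / J) • shiftMatrix m (Complex.exp w) ^ J =
      twist m w * untwistedExponent r m t w * (twist m w)⁻¹ := by
    rw [untwistedExponent, Finset.mul_sum, Finset.sum_mul]
    refine Finset.sum_congr rfl fun J _ => ?_
    rw [shiftMatrix_exp_pow hm, smul_smul, Matrix.mul_smul, Matrix.smul_mul]
  have h2 : (Matrix.diagonal fun a : Fin m => Complex.exp ((t 0 - (a : ℕ)) / m * w)) =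
      Complex.exp (t 0 / m * w) • twist m w := by
    rw [twist, ← Matrix.diagonal_smul]
    congr 1
    funext a
    rw [Pi.smul_apply, smul_eq_mul, ← Complex.exp_add]
    congr 1
    ring
  rw [bareBlock, h1, h2, Matrix.exp_conj _ _ (isUnit_twist w), Matrix.mul_smul, Matrix.mul_assoc,
    Matrix.nonsing_inv_mul _ ((Matrix.isUnit_iff_isUnit_det _).mp (isUnit_twist w)),
    Matrix.mul_one]

section

attribute [local instance] Matrix.linftyOpNormedRing Matrix.linftyOpNormedAlgebra

theorem hasDerivAt_twist (w : ℂ) : HasDerivAt (twist m)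
    ((Matrix.diagonal fun a : Fin m => -((a : ℕ) : ℂ) / m) * twist m w) w := by
  set D : Matrix (Fin m) (Fin m) ℂ := Matrix.diagonal fun a => -((a : ℕ) : ℂ) / m with hD
  have h1 : twist m = fun u => NormedSpace.exp (u • D) := by
    funext u
    rw [hD, ← Matrix.diagonal_smul, Matrix.exp_diagonal, twist]
    congr 1
    funext a
    rw [Pi.coe_exp, Pi.smul_apply, smul_eq_mul, mul_comm, Complex.exp_eq_exp_ℂ]
  have h2 : HasDerivAt (fun u : ℂ => u • D) D w :=
    ((hasDerivAt_id w).smul_const D).congr_deriv (one_smul ℂ D)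
  rw [h1]
  exact hasDerivAt_exp_of_commute h2 fun u =>
    ((Commute.refl D).smul_left u).smul_right w

theorem hasDerivAt_untwistedExponent (r : ℕ) (t : ℕ → ℂ) (w : ℂ) :
    HasDerivAt (untwistedExponent r m t) ((m : ℂ)⁻¹ • ∑ J ∈ Finset.Icc 1 (r * m),
      (t J * Complex.exp (J * w / m)) • shiftMatrix m (1 : ℂ) ^ J) w := by
  rw [Finset.smul_sum]
  refine HasDerivAt.fun_sum fun J hJ => ?_
  have hJ' : (J : ℂ) ≠ 0 := Nat.cast_ne_zero.mpr (by have := Finset.mem_Icc.mp hJ; omega)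
  have h1 : HasDerivAt (fun u : ℂ => (J : ℂ) * u / m) ((J : ℂ) / m) w := by
    simpa using ((hasDerivAt_id w).const_mul (J : ℂ)).div_const (m : ℂ)
  have h2 := (h1.cexp.const_mul (t J / J)).smul_const (shiftMatrix m (1 : ℂ) ^ J)
  rw [smul_smul]
  convert h2 using 2
  field_simp

/-- The derivative is with respect to w = log x, hence equals x D times the block: the scalar power
gives the term J = 0, the twist gives -G, and the commuting exponents give the terms J ≥ 1. -/
theorem hasDerivAt_bareBlock (hm : 1 ≤ m) (r : ℕ) (t : ℕ → ℂ) (w : ℂ) :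
    HasDerivAt (bareBlock r m t) ((m : ℂ)⁻¹ • (∑ J ∈ Finset.range (r * m + 1),
        t J • shiftMatrix m (Complex.exp w) ^ J - Matrix.diagonal fun a : Fin m => ((a : ℕ) : ℂ)) *
      bareBlock r m t w) w := by
  have hcomm : ∀ u, Commute (untwistedExponent r m t u) (untwistedExponent r m t w) := fun u =>
    Commute.sum_left _ _ _ fun J _ => Commute.sum_right _ _ _ fun J' _ =>
      (((Commute.refl _).pow_pow J J').smul_left _).smul_right _
  have h1 := (hasDerivAt_twist (m := m) w).mul
    (hasDerivAt_exp_of_commute (hasDerivAt_untwistedExponent r t w) hcomm)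
  have h2 : HasDerivAt (fun u : ℂ => Complex.exp (t 0 / m * u))
      (Complex.exp (t 0 / m * w) * (t 0 / m)) w := by
    simpa using ((hasDerivAt_id w).const_mul (t 0 / m)).cexp
  have h3 := h2.smul h1
  have h4 : bareBlock r m t = fun u => Complex.exp (t 0 / m * u) •
      (twist m u * NormedSpace.exp (untwistedExponent r m t u)) := funext (bareBlock_eq hm r t)
  rw [h4]
  refine h3.congr_deriv ?_
  have h5 : (∑ J ∈ Finset.range (r * m + 1), t J • shiftMatrix m (Complex.exp w) ^ J) *
      twist m w = t 0 • twist m w + twist m w * ∑ J ∈ Finset.Icc 1 (r * m),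
        (t J * Complex.exp (J * w / m)) • shiftMatrix m (1 : ℂ) ^ J := by
    rw [Finset.range_eq_Ico, Finset.sum_eq_sum_Ico_succ_bot (Nat.succ_pos _), pow_zero, add_mul,
      Matrix.smul_mul, Matrix.one_mul, zero_add, Finset.sum_mul, Finset.mul_sum]
    congr 1
    refine Finset.sum_congr rfl fun J _ => ?_
    rw [shiftMatrix_exp_pow hm, Matrix.smul_mul, Matrix.smul_mul, Matrix.mul_assoc _ _ (twist m w),
      Matrix.nonsing_inv_mul _ ((Matrix.isUnit_iff_isUnit_det _).mp (isUnit_twist w)),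
      Matrix.mul_one, smul_smul, Matrix.mul_smul]
  have h6 : (Matrix.diagonal fun a : Fin m => -((a : ℕ) : ℂ) / m) =
      -((m : ℂ)⁻¹ • Matrix.diagonal fun a : Fin m => ((a : ℕ) : ℂ)) := by
    rw [← Matrix.diagonal_smul, Matrix.diagonal_neg]
    congr 1
    funext a
    simp only [Pi.smul_apply, smul_eq_mul]
    ring
  rw [h6, Pi.mul_apply]
  exact logDeriv_algebra _ _ _ (div_eq_mul_inv (t 0) (m : ℂ)) h5

end

end BareBlock
end ResonantConnection
end

/-! ### Fundamental solutions -/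

noncomputable section

namespace ResonantConnection

theorem HolFun.isUnit_of_forall_ne_zero {f : HolFun} (h : ∀ w, f.1 w ≠ 0) : IsUnit f := by
  have hd : Differentiable ℂ fun w => (f.1 w)⁻¹ := fun w => (f.2 w).inv (h w)
  refine IsUnit.of_mul_eq_one (⟨fun w => (f.1 w)⁻¹, hd⟩ : HolFun) ?_
  exact Subtype.ext (funext fun w => mul_inv_cancel₀ (h w))

/-- Evaluation at `w = log x`. -/
def HolFun.eval (w : ℂ) : HolFun →+* ℂ :=
  (Pi.evalRingHom (fun _ : ℂ => ℂ) w).comp entireFunctions.val.toRingHom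

theorem HolFun.eval_apply (w : ℂ) (f : HolFun) : HolFun.eval w f = f.1 w := rfl

theorem HolFun.eval_algebraMap (w c : ℂ) : HolFun.eval w (algebraMap ℂ HolFun c) = c := rfl

theorem HolFun.eval_xUnit (w : ℂ) : HolFun.eval w HolFun.xUnit = Complex.exp w := rfl

theorem HolFun.eval_xUnit_inv (w : ℂ) :
    HolFun.eval w (HolFun.xUnit⁻¹ : HolFunˣ) = Complex.exp (-w) := rfl

theorem HolFun.ext_eval {f g : HolFun} (h : ∀ w, HolFun.eval w f = HolFun.eval w g) : f = g :=
  Subtype.ext (funext h)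

theorem HolFun.eval_ddx (w : ℂ) (f : HolFun) :
    HolFun.eval w (HolFun.ddx f) = Complex.exp (-w) * deriv f.1 w := rfl

namespace FormalSolutionRing

/-- `ofSeries` as a ring homomorphism. -/
def ofSeriesHom : FormalSeries →+* FormalSolutionRing :=
  Algebra.TensorProduct.includeLeftRingHom

/-- `ofHol` as a ring homomorphism. -/
def ofHolHom : HolFun →+* FormalSolutionRing :=
  (Algebra.TensorProduct.includeRight (R := LaurentPolynomial ℂ) (A := FormalSeries)
    (B := HolFun)).toRingHom

theorem ofSeriesHom_apply (f : FormalSeries) : ofSeriesHom f = ofSeries f := rfl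

theorem ofHolHom_apply (f : HolFun) : ofHolHom f = ofHol f := rfl

/-- The normal form has Laurent polynomial entries. It occurs as formal series in the gauge equation
and as functions in the equation of the bare solution; the tensor product over Laurent polynomials
identifies the two. -/
theorem ofSeries_algebraMap (p : LaurentPolynomial ℂ) :
    ofSeries (algebraMap _ FormalSeries p) = ofHol (algebraMap _ HolFun p) := by
  rw [ofSeries, ofHol, Algebra.algebraMap_eq_smul_one, Algebra.algebraMap_eq_smul_one,
    TensorProduct.smul_tmul]

theorem ddx_ofSeries (f : FormalSeries) : ddx (ofSeries f) = ofSeries (FormalSeries.ddx f) := by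
  have h : HolFun.ddx 1 = 0 := by
    rw [← map_one (algebraMap ℂ HolFun), HolFun.ddx_algebraMap]
  rw [ofSeries, ddx_tmul, h, TensorProduct.tmul_zero, add_zero, ofSeries]

theorem ddx_ofHol (φ : HolFun) : ddx (ofHol φ) = ofHol (HolFun.ddx φ) := by
  have h : FormalSeries.ddx 1 = 0 := by
    rw [← map_one (HahnSeries.C : ℂ →+* HahnSeries ℤ ℂ)]
    exact FormalSeries.ddx_C 1
  rw [ofHol, ddx_tmul, h, TensorProduct.zero_tmul, zero_add, ofHol]

end FormalSolutionRing

open FormalSolutionRing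

theorem shiftMatrix_map {R S : Type*} [CommRing R] [CommRing S] (φ : R →+* S) (m : ℕ) (y : R) :
    (shiftMatrix m y).map φ = shiftMatrix m (φ y) := by
  ext a b
  simp only [shiftMatrix, Matrix.map_apply, Matrix.of_apply]
  split_ifs <;> simp

/-- The blocks of the normal form, as matrices of Laurent polynomials. -/
def laurentBlock (r m : ℕ) (t : ℕ → ℂ) : Matrix (Fin m) (Fin m) (LaurentPolynomial ℂ) :=
  (LaurentPolynomial.C (m : ℂ)⁻¹ * LaurentPolynomial.T (-1)) •
    (∑ J ∈ Finset.range (r * m + 1),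
        LaurentPolynomial.C (t J) • shiftMatrix m (LaurentPolynomial.T 1) ^ J
      - Matrix.diagonal fun a : Fin m => ((a : ℕ) : LaurentPolynomial ℂ))

theorem laurentBlock_map {S : Type*} [CommRing S] (φ : LaurentPolynomial ℂ →+* S) (r m : ℕ)
    (t : ℕ → ℂ) : (laurentBlock r m t).map φ =
      (φ (LaurentPolynomial.C (m : ℂ)⁻¹) * φ (LaurentPolynomial.T (-1))) •
        (∑ J ∈ Finset.range (r * m + 1), φ (LaurentPolynomial.C (t J)) •
          shiftMatrix m (φ (LaurentPolynomial.T 1)) ^ J -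
            Matrix.diagonal fun a : Fin m => ((a : ℕ) : S)) := by
  have h : ∀ J, (shiftMatrix m (LaurentPolynomial.T 1)  ^ J).map φ =
      shiftMatrix m (φ (LaurentPolynomial.T 1)) ^ J := fun J => by
    rw [← RingHom.mapMatrix_apply, map_pow, RingHom.mapMatrix_apply, shiftMatrix_map]
  have hs : ∀ (c : LaurentPolynomial ℂ) (M : Matrix (Fin m) (Fin m) (LaurentPolynomial ℂ)),
      (c • M).map φ = φ c • M.map φ := fun c M => by
    ext a b
    simp
  rw [laurentBlock, hs, map_mul, ← RingHom.mapMatrix_apply φ (_ - _), map_sub, map_sum]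
  simp only [RingHom.mapMatrix_apply, hs, h]
  congr 2
  ext a b
  simp only [Matrix.map_apply, Matrix.diagonal_apply]
  split_ifs <;> simp

theorem normalBlock_eq_map (r m : ℕ) (t : ℕ → ℂ) :
    normalBlock r m t = (laurentBlock r m t).map (algebraMap _ FormalSeries) := by
  have hK : ∀ q : LaurentPolynomial ℂ, algebraMap _ FormalSeries q =
    LaurentPolynomial.eval₂ HahnSeries.C FormalSeries.xUnit q := fun _ => rfl
  rw [laurentBlock_map, normalBlock]
  simp only [hK, LaurentPolynomial.eval₂_C, LaurentPolynomial.eval₂_T, zpow_one, zpow_neg_one]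
  have hx : ((FormalSeries.xUnit⁻¹ : FormalSeriesˣ) : FormalSeries) = FormalSeries.x⁻¹ := by
    rw [Units.val_inv_eq_inv_val]; rfl
  rw [hx, mul_inv, FormalSeries.natCast_eq_C, ← map_inv₀]
  rfl

theorem laurentBlock_map_eval (r m : ℕ) (t : ℕ → ℂ) (w : ℂ) :
    (laurentBlock r m t).map (fun p => HolFun.eval w (algebraMap _ HolFun p)) =
      Complex.exp (-w) • ((m : ℂ)⁻¹ • (∑ J ∈ Finset.range (r * m + 1),
        t J • shiftMatrix m (Complex.exp w) ^ J -
          Matrix.diagonal fun a : Fin m => ((a : ℕ) : ℂ))) := by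
  have hO : ∀ q : LaurentPolynomial ℂ, algebraMap _ HolFun q =
    LaurentPolynomial.eval₂ (algebraMap ℂ HolFun) HolFun.xUnit q := fun _ => rfl
  refine (laurentBlock_map ((HolFun.eval w).comp (algebraMap _ HolFun)) r m t).trans ?_
  simp only [RingHom.comp_apply, hO, LaurentPolynomial.eval₂_C, LaurentPolynomial.eval₂_T,
    zpow_one, zpow_neg_one, HolFun.eval_algebraMap, HolFun.eval_xUnit, HolFun.eval_xUnit_inv]
  rw [smul_smul, mul_comm (m : ℂ)⁻¹]

theorem isUnit_det_bareBlock (r m : ℕ) (t : ℕ → ℂ) (w : ℂ) : IsUnit (bareBlock r m t w).det := by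
  have h1 : IsUnit (NormedSpace.exp (∑ J ∈ Finset.Icc 1 (r * m),
      (t J / J) • shiftMatrix m (Complex.exp w) ^ J)) := Matrix.isUnit_exp _
  have h2 : (∏ a : Fin m, Complex.exp ((t 0 - (a : ℕ)) / m * w)) ≠ 0 :=
    Finset.prod_ne_zero_iff.mpr fun a _ => Complex.exp_ne_zero _
  rw [bareBlock, Matrix.det_mul, Matrix.det_diagonal]
  exact ((Matrix.isUnit_iff_isUnit_det _).mp h1).mul (isUnit_iff_ne_zero.mpr h2)

section Bare

variable {s : ℕ} {n : Fin s → ℕ} {r : ℕ}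

/-- The normal form, as a matrix of Laurent polynomials. -/
def laurentForm (r : ℕ) (n : Fin s → ℕ) (t : Fin s → ℕ → ℂ) :
    Matrix (BlockIndex n) (BlockIndex n) (LaurentPolynomial ℂ) :=
  Matrix.blockDiagonal' fun j => laurentBlock r (n j) (t j)

theorem bareSolution_map_eval (r : ℕ) (n : Fin s → ℕ) (t : Fin s → ℕ → ℂ) (w : ℂ) :
    (bareSolution r n t).map (HolFun.eval w) =
      Matrix.blockDiagonal' fun j => bareBlock r (n j) (t j) w := by
  rw [bareSolution, Matrix.blockDiagonal'_map _ _ (map_zero _)]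
  rfl

/-- The determinant is an entire function of w without zeros, hence invertible. -/
theorem isUnit_det_bareSolution (t : Fin s → ℕ → ℂ) : IsUnit (bareSolution r n t).det := by
  refine HolFun.isUnit_of_forall_ne_zero fun w => ?_
  rw [← HolFun.eval_apply, RingHom.map_det, RingHom.mapMatrix_apply, bareSolution_map_eval]
  refine IsUnit.ne_zero ((Matrix.isUnit_iff_isUnit_det _).mp (IsUnit.of_mul_eq_one
    (Matrix.blockDiagonal' fun j => (bareBlock r (n j) (t j) w)⁻¹) ?_))
  rw [← Matrix.blockDiagonal'_mul, ← Matrix.blockDiagonal'_one]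
  congr 1
  funext j
  exact Matrix.mul_nonsing_inv _ (isUnit_det_bareBlock r (n j) (t j) w)

section

attribute [local instance] Matrix.linftyOpNormedRing Matrix.linftyOpNormedAlgebra

theorem deriv_bareBlock_apply {m : ℕ} (hm : 1 ≤ m) (r : ℕ) (t : ℕ → ℂ) (w : ℂ) (a b : Fin m) :
    deriv (fun u => bareBlock r m t u a b) w =
      ((m : ℂ)⁻¹ • (∑ J ∈ Finset.range (r * m + 1),
        t J • shiftMatrix m (Complex.exp w) ^ J - Matrix.diagonal fun a : Fin m => ((a : ℕ) : ℂ)) *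
      bareBlock r m t w) a b :=
  ((LinearMap.toContinuousLinearMap (Matrix.entryLinearMap ℂ ℂ a b)).hasFDerivAt.comp_hasDerivAt w
    (hasDerivAt_bareBlock hm r t w)).deriv

end

theorem ddx_bareSolution (hn : ∀ j, 1 ≤ n j) (t : Fin s → ℕ → ℂ) :
    (bareSolution r n t).map HolFun.ddx =
      (laurentForm r n t).map (algebraMap _ HolFun) * bareSolution r n t := by
  have hz : HolFun.ddx 0 = 0 := by
    have := HolFun.ddx_algebraMap 0
    rwa [map_zero] at this
  rw [bareSolution, laurentForm, Matrix.blockDiagonal'_map _ _ (map_zero _),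
    Matrix.blockDiagonal'_map _ _ hz, ← Matrix.blockDiagonal'_mul]
  congr 1
  funext j
  refine Matrix.ext fun a b => HolFun.ext_eval fun w => ?_
  rw [Matrix.map_apply, HolFun.eval_ddx, Matrix.mul_apply, map_sum]
  refine (congrArg _ (deriv_bareBlock_apply (hn j) r (t j) w a b)).trans ?_
  have h := laurentBlock_map_eval r (n j) (t j) w
  rw [Matrix.mul_apply, Finset.mul_sum]
  refine Finset.sum_congr rfl fun c _ => ?_
  rw [map_mul, ← mul_assoc]
  congr 1
  exact (congrFun (congrFun h a) c).symm

/-- The product of a normalizing gauge with the bare solution is a fundamental solution. -/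
theorem IsNormalizingGauge.isFundamentalSolution {lam : Fin s → ℂ} (hn : ∀ j, 1 ≤ n j)
    {A Y : Matrix (BlockIndex n) (BlockIndex n) FormalSeries} {t : Fin s → ℕ → ℂ}
    (h : IsNormalizingGauge r n lam A Y t) :
    IsFundamentalSolution A (formalSolution r n Y t) := by
  have hY : Y.map ofSeries = Y.map ofSeriesHom := rfl
  have hA : A.map ofSeries = A.map ofSeriesHom := rfl
  have hB : (bareSolution r n t).map ofHol = (bareSolution r n t).map ofHolHom := rfl
  constructor
  · have hddx : (formalSolution r n Y t).map ddx =
        (Y.map FormalSeries.ddx).map ofSeriesHom * (bareSolution r n t).map ofHolHom +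
          Y.map ofSeriesHom * ((bareSolution r n t).map HolFun.ddx).map ofHolHom := by
      ext p q
      simp only [formalSolution, Matrix.map_apply, Matrix.mul_apply, Matrix.add_apply, map_sum,
        ddx_mul, ddx_ofSeries, ddx_ofHol, Finset.sum_add_distrib, ofSeriesHom_apply,
        ofHolHom_apply]
    have hD : ((laurentForm r n t).map (algebraMap _ HolFun)).map ofHolHom =
        (normalForm r n t).map ofSeriesHom := by
      have h1 : normalForm r n t = (laurentForm r n t).map (algebraMap _ FormalSeries) := by
        rw [laurentForm, Matrix.blockDiagonal'_map _ _ (map_zero _), normalForm]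
        congr 1
        funext j
        exact normalBlock_eq_map r (n j) (t j)
      rw [h1]
      ext p q
      exact (ofSeries_algebraMap _).symm
    rw [hddx, ddx_bareSolution hn, Matrix.map_mul, hD, ← Matrix.mul_assoc, ← Matrix.map_mul,
      ← h.eqn, ← Matrix.add_mul, formalSolution, hA, hY, hB, ← Matrix.mul_assoc, ← Matrix.map_mul]
    congr 1
    ext p q
    simp
  · rw [formalSolution, Matrix.det_mul, hY, hB]
    rw [← RingHom.mapMatrix_apply, ← RingHom.map_det, ← RingHom.mapMatrix_apply, ← RingHom.map_det]
    exact (h.1.isUnit_det.map _).mul ((isUnit_det_bareSolution t).map _)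

end Bare
end ResonantConnection
end

open ResonantConnection in
theorem theorem3p1 (r : ℕ) (hr : 1 ≤ r) (s : ℕ) (n : Fin s → ℕ) (hn : ∀ j, 1 ≤ n j)
    (lam : Fin s → ℂ) (A : Matrix (BlockIndex n) (BlockIndex n) FormalSeries)
    (hdeg : ∀ k : ℤ, (r : ℤ) - 1 < k → coeffMatrix A k = 0)
    (hlead : coeffMatrix A ((r : ℤ) - 1)
      = Matrix.blockDiagonal' fun j => jordanCell (lam j) (n j))
    (hgen : LidskiiGeneric hn lam (coeffMatrix A ((r : ℤ) - 2)))
    (hres : r = 1 → ∀ j, n j = 1 → ∀ μ ν : ℂ,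
      (pseudoCharpoly hn lam (coeffMatrix A ((r : ℤ) - 2)) (lam j) 1).IsRoot μ →
      (pseudoCharpoly hn lam (coeffMatrix A ((r : ℤ) - 2)) (lam j) 1).IsRoot ν →
      ∀ k : ℤ, μ - ν = k → k = 0) :
    (∃ Y t, IsNormalizingGauge r n lam A Y t) ∧
    (∀ Y t, IsNormalizingGauge r n lam A Y t →
      IsFundamentalSolution A (formalSolution r n Y t)) ∧
    (∀ Y Y' t, IsNormalizingGauge r n lam A Y t → IsNormalizingGauge r n lam A Y' t →
      ∃ c : Fin s → ℂ, (∀ j, c j ≠ 0) ∧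
        Y' = Y * Matrix.diagonal fun p => HahnSeries.C (c p.1)) ∧
    (∀ Y t Y' t', IsNormalizingGauge r n lam A Y t → IsNormalizingGauge r n lam A Y' t' →
      ∃ (σ : Equiv.Perm (Fin s)) (ζ c : Fin s → ℂ),
        (∀ j, n (σ j) = n j ∧ lam (σ j) = lam j ∧ ζ j ^ n j = 1 ∧ c j ≠ 0) ∧
        (∀ j, ∀ J ≤ r * n j, t (σ j) J = ζ j ^ J * t' j J) ∧
        Y' = Y * monomialMatrix n σ ζ c) := by
  obtain ⟨Y₀, t₀, h₀, hres₀⟩ := exists_nonresonant_gauge hr hdeg hlead hgen hres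
  -- Nonresonance is known by construction for one gauge only; comparison with it gives nonresonance
  -- for every normalizing pair.
  have hnr : ∀ Y t, IsNormalizingGauge r n lam A Y t → IsNonresonant r n lam t := fun Y t h =>
    h₀.isNonresonant hr hn hdeg hlead hres₀ h
  exact ⟨⟨Y₀, t₀, h₀⟩, fun Y t h => h.isFundamentalSolution hn,
    fun Y Y' t h h' => h.exists_diagonal hr hn hdeg hlead (hnr Y t h) h',
    fun Y t Y' t' h h' => h.exists_monomialMatrix hr hn hdeg hlead (hnr Y t h) h'⟩
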